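/- Let $n\ge 1$ and $m\ge 0$ be integers, let $I,V,W$ be complex vector spaces of dimensions $2$, $n+1$, $m+2$, let $X=\mathbb P(\mathrm{Hom}(W,I\otimes V)^*)$ be the projective space of lines in $\mathrm{Hom}(W,I\otimes V)$, and let $G=\mathrm{SL}(I)\times \mathrm{SL}(W)\cong \mathrm{SL}(2)\times \mathrm{SL}(m+2)$ act on it by $(P,Q)\cdot A=(P\otimes \mathrm{id}_V)\circ A\circ Q^{-1}$. For $A\in X$ let $f_A: I^*\otimes\mathcal O_{\mathbb P^n}\to W^*\otimes\mathcal O_{\mathbb P^n}(1)$ be the induced morphism of sheaves on $\mathbb P^n=\mathbb P(V)$ and $\mathcal F_A=\mathrm{coker}\, f_A$. (1) Let $A\in X$ be such that $f_A$ is injective and $\mathcal F_A$ is simple, i.e. $\mathrm{Aut}(\mathcal F_A)=\mathbb C^*$. Then the stabilizer of the point $A\in X$ is the finite group $$\mathrm{Stab}_G(A)=\{(\lambda\,\mathrm{Id}_2,\mu\,\mathrm{Id}_{m+2}) : \lambda,\mu\in\mathbb C,\ \lambda^{2}=1,\ \mu^{m+2}=1\},$$ and in particular $\dim \mathrm{Stab}_G(A)=0$.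 (2) Let $\mathcal M_{n,m,2}=X/\!/G$ be the categorical (GIT) quotient, i.e. the $\mathrm{Proj}$ of the graded ring of $G$-invariant polynomial functions on $\mathrm{Hom}(W,I\otimes V)$. If $m<2n$ and $(n,m)\ne(1,0)$, then $$\dim \mathcal M_{n,m,2}=\dim X-\dim G.$$ -/

import Mathlib

noncomputable section

namespace SteinerKronecker

open CategoryTheory AlgebraicGeometry TopologicalSpace Opposite

section Twist

variable {A : Type} [CommRing A] [Algebra ℂ A] (𝒜 : ℕ → Submodule ℂ A) [GradedAlgebra 𝒜]

/-- The complement of the homogeneous prime of a point of `Proj`. -/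
def complAt (x : ProjectiveSpectrum.top 𝒜) : Submonoid A :=
  have : (ProjectiveSpectrum.asHomogeneousIdeal (𝒜 := 𝒜) x).toIdeal.IsPrime :=
    ProjectiveSpectrum.isPrime (𝒜 := 𝒜) x
  (ProjectiveSpectrum.asHomogeneousIdeal (𝒜 := 𝒜) x).toIdeal.primeCompl

/-- The localization `A_𝔭` of the whole ring at the homogeneous prime of a point of `Proj`. -/
abbrev LocAt (x : ProjectiveSpectrum.top 𝒜) : Type :=
  Localization (complAt 𝒜 x)

/-- `f` is given on `U` by one fraction `r / s` with `r`, `s` homogeneous,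
`deg r = d + deg s`. -/
def IsTwistFraction (d : ℕ) {U : Opens (ProjectiveSpectrum.top 𝒜)} (f : ∀ x : U, LocAt 𝒜 x.1) :
    Prop :=
  ∃ (i : ℕ) (r s : A), r ∈ 𝒜 (d + i) ∧ s ∈ 𝒜 i ∧ ∀ x : U,
    ∃ hs : s ∈ complAt 𝒜 x.1, f x = Localization.mk r ⟨s, hs⟩

/-- Being a single fraction of degree `d` passes to smaller open sets. -/
def twistPrelocal (d : ℕ) : TopCat.PrelocalPredicate (LocAt 𝒜) where
  pred f := IsTwistFraction 𝒜 d f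
  res := by
    rintro V U i f ⟨j, r, s, hr, hs, w⟩
    exact ⟨j, r, s, hr, hs, fun x => w (i x)⟩

/-- Being locally a fraction of degree `d`. -/
def twistLocal (d : ℕ) : TopCat.LocalPredicate (LocAt 𝒜) :=
  (twistPrelocal 𝒜 d).sheafify

/-- Sections of `𝒪(d)` over `U`: families of elements of the localizations that are locally
fractions of degree `d`. -/
def twistSections (d : ℕ) (U : Opens (ProjectiveSpectrum.top 𝒜)) :
    AddSubgroup (∀ x : U, LocAt 𝒜 x.1) where
  carrier := {f | (twistLocal 𝒜 d).pred f}
  zero_mem' := fun x => ⟨U, x.2, 𝟙 U, 0, 0, 1, Submodule.zero_mem _, SetLike.GradedOne.one_mem,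
    fun y => ⟨Submonoid.one_mem _, (Localization.mk_zero _).symm⟩⟩
  add_mem' := by
    intro a b ha hb
    refine TopCat.PrelocalPredicate.sheafify_inductionOn₂' (twistPrelocal 𝒜 d)
      (twistPrelocal 𝒜 d) (twistPrelocal 𝒜 d) (fun p q => p + q) ?_ ha hb
    rintro U V a b ⟨i, r, s, hr, hs, h⟩ ⟨j, r', s', hr', hs', h'⟩
    refine ⟨i + j, s * r' + s' * r, s * s', ?_, SetLike.GradedMul.mul_mem hs hs', ?_⟩
    · refine Submodule.add_mem _ ?_ ?_
      · have := SetLike.GradedMul.mul_mem hs hr'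
        rwa [show i + (d + j) = d + (i + j) by omega] at this
      · have := SetLike.GradedMul.mul_mem hs' hr
        rwa [show j + (d + i) = d + (i + j) by omega] at this
    · intro x
      obtain ⟨h1, h2⟩ := h ⟨x.1, x.2.1⟩
      obtain ⟨h1', h2'⟩ := h' ⟨x.1, x.2.2⟩
      refine ⟨Submonoid.mul_mem _ h1 h1', ?_⟩
      refine (congrArg₂ (· + ·) h2 h2').trans ?_
      exact Localization.add_mk _ _ _ _
  neg_mem' := by
    intro a ha
    refine TopCat.PrelocalPredicate.sheafify_inductionOn' (twistPrelocal 𝒜 d)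
      (fun p => -p) ?_ ha
    rintro U a ⟨i, r, s, hr, hs, h⟩
    refine ⟨i, -r, s, Submodule.neg_mem _ hr, hs, fun x => ?_⟩
    obtain ⟨h1, h2⟩ := h x
    exact ⟨h1, (congrArg (- ·) h2).trans (Localization.neg_mk _ _)⟩

/-- Evaluation of sections of the structure sheaf of `Proj`. -/
def evalStruct (U : Opens (ProjectiveSpectrum.top 𝒜)) :
    Γ(Proj 𝒜, U) →+* (∀ x : U, LocAt 𝒜 x.1) where
  toFun r x := (((r : (ProjectiveSpectrum.Proj.structureSheaf 𝒜).1.obj (op U)).1 x).val)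
  map_one' := by
    funext x; exact HomogeneousLocalization.val_one
  map_zero' := by
    funext x; exact HomogeneousLocalization.val_zero
  map_add' r s := by
    funext x; exact HomogeneousLocalization.val_add _ _
  map_mul' r s := by
    funext x; exact HomogeneousLocalization.val_mul _ _

theorem evalStruct_mul_mem (d : ℕ) (U : Opens (ProjectiveSpectrum.top 𝒜)) (r : Γ(Proj 𝒜, U))
    (s : twistSections 𝒜 d U) : evalStruct 𝒜 U r * s.1 ∈ twistSections 𝒜 d U := by
  intro x
  obtain ⟨V, hV, iV, i, a, b, hb, h⟩ :=
    (r : (ProjectiveSpectrum.Proj.structureSheaf 𝒜).1.obj (op U)).2 x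
  obtain ⟨W, hW, iW, j, a', b', ha', hb', h'⟩ := s.2 x
  refine ⟨V ⊓ W, ⟨hV, hW⟩, Opens.infLELeft _ _ ≫ iV, i + j, a.1 * a', b.1 * b', ?_,
    SetLike.GradedMul.mul_mem b.2 hb', ?_⟩
  · have := SetLike.GradedMul.mul_mem a.2 ha'
    rwa [show i + (d + j) = d + (i + j) by omega] at this
  · intro y
    have h1 := h ⟨y.1, y.2.1⟩
    obtain ⟨h2, h3⟩ := h' ⟨y.1, y.2.2⟩
    refine ⟨Submonoid.mul_mem _ (hb ⟨y.1, y.2.1⟩) h2, ?_⟩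
    have e1 : evalStruct 𝒜 U r ⟨y.1, iV.le y.2.1⟩ =
        Localization.mk a.1 ⟨b.1, hb ⟨y.1, y.2.1⟩⟩ :=
      (congrArg HomogeneousLocalization.val h1).trans (HomogeneousLocalization.val_mk _)
    refine (congrArg₂ (· * ·) e1 h3).trans ?_
    exact Localization.mk_mul _ _ _ _

instance twistModule (d : ℕ) (U : Opens (ProjectiveSpectrum.top 𝒜)) :
    Module Γ(Proj 𝒜, U) (twistSections 𝒜 d U) where
  smul r s := ⟨evalStruct 𝒜 U r * s.1, evalStruct_mul_mem 𝒜 d U r s⟩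
  one_smul s := Subtype.ext (by
    change evalStruct 𝒜 U 1 * s.1 = s.1
    rw [map_one, one_mul])
  mul_smul r r' s := Subtype.ext (by
    change evalStruct 𝒜 U (r * r') * s.1 = evalStruct 𝒜 U r * (evalStruct 𝒜 U r' * s.1)
    rw [map_mul, mul_assoc])
  smul_zero r := Subtype.ext (mul_zero _)
  smul_add r s s' := Subtype.ext (mul_add _ _ _)
  add_smul r r' s := Subtype.ext (by
    change evalStruct 𝒜 U (r + r') * s.1 = evalStruct 𝒜 U r * s.1 + evalStruct 𝒜 U r' * s.1
    rw [map_add, add_mul])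
  zero_smul s := Subtype.ext (by
    change evalStruct 𝒜 U 0 * s.1 = 0
    rw [map_zero, zero_mul])

/-- Restriction of sections of `𝒪(d)`. -/
def twistRes (d : ℕ) {U V : Opens (ProjectiveSpectrum.top 𝒜)} (i : V ⟶ U) :
    twistSections 𝒜 d U →+ twistSections 𝒜 d V where
  toFun s := ⟨fun x => s.1 (i x), (twistLocal 𝒜 d).res i s.1 s.2⟩
  map_zero' := rfl
  map_add' _ _ := rfl

/-- `𝒪(d)` as a presheaf of abelian groups. -/
def twistPresheaf (d : ℕ) : (Proj 𝒜).Opensᵒᵖ ⥤ Ab where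
  obj U := AddCommGrpCat.of (twistSections 𝒜 d U.unop)
  map i := AddCommGrpCat.ofHom (twistRes 𝒜 d i.unop)

instance twistPresheafModule (d : ℕ) (U : (Proj 𝒜).Opensᵒᵖ) :
    Module ((Proj 𝒜).ringCatSheaf.obj.obj U) ((twistPresheaf 𝒜 d).obj U) :=
  twistModule 𝒜 d U.unop

/-- Serre's twisting sheaf `𝒪(d)` on `Proj`. -/
def twistingSheaf (d : ℕ) : (Proj 𝒜).Modules where
  val := PresheafOfModules.ofPresheaf (twistPresheaf 𝒜 d) (fun _ _ _ _ _ => rfl)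
  isSheaf := (TopCat.Presheaf.isSheaf_iff_isSheaf_comp (forget Ab) _).2
    (TopCat.subsheafToTypes (twistLocal 𝒜 d)).2


/-- The global section of `𝒪(d)` given by an element `a` of degree `d`, restricted to `U`. -/
def twistSection {d : ℕ} (a : A) (ha : a ∈ 𝒜 d) (U : Opens (ProjectiveSpectrum.top 𝒜)) :
    twistSections 𝒜 d U :=
  ⟨fun x => Localization.mk a (1 : complAt 𝒜 x.1), fun x => ⟨U, x.2, 𝟙 U, 0, a, 1, ha,
    SetLike.GradedOne.one_mem, fun _ => ⟨Submonoid.one_mem _, rfl⟩⟩⟩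

/-- The structure sheaf `𝒪` as a sheaf of modules over itself. -/
def structureModule : (Proj 𝒜).Modules :=
  SheafOfModules.unit (Proj 𝒜).ringCatSheaf

/-- The morphism `𝒪 ⟶ 𝒪(d)`, `r ↦ r · a`, given by an element `a` of degree `d`. -/
def twistMul {d : ℕ} (a : A) (ha : a ∈ 𝒜 d) : structureModule 𝒜 ⟶ twistingSheaf 𝒜 d :=
  (SheafOfModules.unitHomEquiv (R := (Proj 𝒜).ringCatSheaf) (twistingSheaf 𝒜 d)).symm
    (PresheafOfModules.sectionsMk (M := (twistingSheaf 𝒜 d).val)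
      (fun U => twistSection 𝒜 a ha U.unop) (fun _ _ _ => rfl))

/-- The constant `c` as a section over `U` of the structure sheaf of `Proj`. -/
def constSection (U : (Proj 𝒜).Opens) (c : ℂ) : Γ(Proj 𝒜, U) :=
  (⟨fun _ => HomogeneousLocalization.fromZeroRingHom 𝒜 _ (algebraMap ℂ (𝒜 0) c),
    fun x => ⟨U, x.2, 𝟙 _, 0, algebraMap ℂ (𝒜 0) c, 1,
      fun y => Submonoid.one_mem (complAt 𝒜 y.1), fun _ => rfl⟩⟩ :
    (ProjectiveSpectrum.Proj.structureSheaf 𝒜).1.obj (op U))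

/-- The homothety of a sheaf of modules on `Proj` with ratio `c`. -/
def homothety (F : (Proj 𝒜).Modules) (c : ℂ) : F ⟶ F where
  val := PresheafOfModules.homMk
    { app U := F.smul (constSection 𝒜 U.unop c)
      naturality U V i := (F.map_comp_smul i.unop (constSection 𝒜 U.unop c)).symm }
    (fun U (r : Γ(Proj 𝒜, U.unop)) (m : Γ(F, U.unop)) => by
      change constSection 𝒜 U.unop c • r • m = r • constSection 𝒜 U.unop c • m
      rw [smul_smul, smul_smul, mul_comm])

/-- `Aut F = ℂ^*`: every automorphism is the homothety by a unique nonzero scalar. -/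
def IsSimpleSheaf (F : (Proj 𝒜).Modules) : Prop :=
  ∀ φ : F ≅ F, ∃! c : ℂˣ, φ.hom = homothety 𝒜 F c

end Twist

instance homogeneousGradedAlgebra (σ : Type) :
    GradedAlgebra (MvPolynomial.homogeneousSubmodule σ ℂ) :=
  MvPolynomial.gradedAlgebra

section Steiner

variable {n m : ℕ}

/-- The homogeneous coordinate ring `ℂ[x₀, …, xₙ]` of `ℙⁿ`, graded by degree. -/
abbrev coordGrading (n : ℕ) : ℕ → Submodule ℂ (MvPolynomial (Fin (n + 1)) ℂ) :=
  MvPolynomial.homogeneousSubmodule (Fin (n + 1)) ℂ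

/-- `Hom(W, I ⊗ V)` with `I = ℂ²`, `V = ℂⁿ⁺¹`, `W = ℂᵐ⁺²`: matrices whose rows are indexed by the
basis `eᵢ ⊗ xₖ` of `I ⊗ V` and whose columns are indexed by the basis of `W`. -/
abbrev HomSpace (n m : ℕ) : Type := Matrix (Fin 2 × Fin (n + 1)) (Fin (m + 2)) ℂ

/-- The linear form `∑ₖ A_{(i,k),j} xₖ`, the `(i, j)` entry of `f_A`. -/
def linearForm (A : HomSpace n m) (i : Fin 2) (j : Fin (m + 2)) :
    MvPolynomial (Fin (n + 1)) ℂ :=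
  ∑ k, MvPolynomial.C (A (i, k) j) * MvPolynomial.X k

theorem linearForm_mem (A : HomSpace n m) (i : Fin 2) (j : Fin (m + 2)) :
    linearForm A i j ∈ coordGrading n 1 :=
  Submodule.sum_mem _ fun k _ => by
    simpa using (MvPolynomial.isHomogeneous_C _ (A (i, k) j)).mul (MvPolynomial.isHomogeneous_X ℂ k)

instance modulesFiniteBiproducts (X : Scheme.{0}) : Limits.HasFiniteBiproducts X.Modules :=
  Abelian.hasFiniteBiproducts

/-- The morphism of sheaves `f_A : I^* ⊗ 𝒪 ⟶ W^* ⊗ 𝒪(1)` on `ℙⁿ`. -/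
def steinerMap (A : HomSpace n m) :
    Limits.biproduct (fun _ : Fin 2 => structureModule (coordGrading n)) ⟶
      Limits.biproduct (fun _ : Fin (m + 2) => twistingSheaf (coordGrading n) 1) :=
  Limits.biproduct.matrix fun i j =>
    twistMul (coordGrading n) (linearForm A i j) (linearForm_mem A i j)

/-- The sheaf `F_A = coker f_A`. -/
def steinerSheaf (A : HomSpace n m) : (Proj (coordGrading n)).Modules :=
  Limits.cokernel (steinerMap A)

end Steiner

section Action

variable {n m : ℕ}

/-- The group `G = SL(I) × SL(W) = SL(2) × SL(m + 2)`. -/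
abbrev GroupG (m : ℕ) : Type :=
  Matrix.SpecialLinearGroup (Fin 2) ℂ × Matrix.SpecialLinearGroup (Fin (m + 2)) ℂ

open scoped Kronecker in
/-- The linear action of `G` on `Hom(W, I ⊗ V)`: `(P, Q) · A = (P ⊗ id_V) ∘ A ∘ Q⁻¹`. -/
instance homSpaceAction : DistribMulAction (GroupG m) (HomSpace n m) where
  smul g A := (g.1.1 ⊗ₖ (1 : Matrix (Fin (n + 1)) (Fin (n + 1)) ℂ)) * A * (g.2⁻¹).1
  one_smul A := by
    change ((1 : Matrix (Fin 2) (Fin 2) ℂ) ⊗ₖ (1 : Matrix (Fin (n + 1)) (Fin (n + 1)) ℂ)) * A *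
      ((1 : Matrix.SpecialLinearGroup (Fin (m + 2)) ℂ)⁻¹).1 = A
    simp
  mul_smul g h A := by
    change ((g.1 * h.1).1 ⊗ₖ (1 : Matrix (Fin (n + 1)) (Fin (n + 1)) ℂ)) * A *
      ((g.2 * h.2)⁻¹).1 = (g.1.1 ⊗ₖ (1 : Matrix (Fin (n + 1)) (Fin (n + 1)) ℂ)) *
        ((h.1.1 ⊗ₖ (1 : Matrix (Fin (n + 1)) (Fin (n + 1)) ℂ)) * A * (h.2⁻¹).1) * (g.2⁻¹).1
    have e : (g.1 * h.1).1 ⊗ₖ (1 : Matrix (Fin (n + 1)) (Fin (n + 1)) ℂ) =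
        (g.1.1 ⊗ₖ (1 : Matrix (Fin (n + 1)) (Fin (n + 1)) ℂ)) *
          (h.1.1 ⊗ₖ (1 : Matrix (Fin (n + 1)) (Fin (n + 1)) ℂ)) := by
      rw [← Matrix.mul_kronecker_mul, one_mul, Matrix.SpecialLinearGroup.coe_mul]
    rw [e, mul_inv_rev, Matrix.SpecialLinearGroup.coe_mul]
    simp only [Matrix.mul_assoc]
  smul_zero g := by
    change (g.1.1 ⊗ₖ (1 : Matrix (Fin (n + 1)) (Fin (n + 1)) ℂ)) * (0 : HomSpace n m) *
      (g.2⁻¹).1 = 0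
    rw [Matrix.mul_zero, Matrix.zero_mul]
  smul_add g A B := by
    change (g.1.1 ⊗ₖ (1 : Matrix (Fin (n + 1)) (Fin (n + 1)) ℂ)) * (A + B) * (g.2⁻¹).1 =
      (g.1.1 ⊗ₖ (1 : Matrix (Fin (n + 1)) (Fin (n + 1)) ℂ)) * A * (g.2⁻¹).1 +
        (g.1.1 ⊗ₖ (1 : Matrix (Fin (n + 1)) (Fin (n + 1)) ℂ)) * B * (g.2⁻¹).1
    rw [Matrix.mul_add, Matrix.add_mul]

open scoped Kronecker in
instance homSpaceSMulComm : SMulCommClass (GroupG m) ℂ (HomSpace n m) where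
  smul_comm g c A := by
    change (g.1.1 ⊗ₖ (1 : Matrix (Fin (n + 1)) (Fin (n + 1)) ℂ)) * (c • A) * (g.2⁻¹).1 =
      c • ((g.1.1 ⊗ₖ (1 : Matrix (Fin (n + 1)) (Fin (n + 1)) ℂ)) * A * (g.2⁻¹).1)
    rw [Matrix.mul_smul, Matrix.smul_mul]

/-- The stabilizer in `G` of the point `[A]` of the projective space `X = ℙ(Hom(W, I ⊗ V)^*)` of
lines in `Hom(W, I ⊗ V)`. -/
def stab (A : HomSpace n m) (hA : A ≠ 0) : Subgroup (GroupG m) :=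
  MulAction.stabilizer (GroupG m) (Projectivization.mk ℂ A hA)

/-- The matrix entries of an element of `G`, as a point of affine space. -/
def groupCoords (g : GroupG m) : (Fin 2 × Fin 2) ⊕ (Fin (m + 2) × Fin (m + 2)) → ℂ :=
  Sum.elim (fun p => g.1.1 p.1 p.2) (fun p => g.2.1 p.1 p.2)

/-- The dimension of (the Zariski closure of) a subset of the affine algebraic group `G`: the Krull
dimension of the ring of polynomial functions on it. -/
def algDim (S : Set (GroupG m)) : WithBot ℕ∞ :=
  ringKrullDim (MvPolynomial ((Fin 2 × Fin 2) ⊕ (Fin (m + 2) × Fin (m + 2))) ℂ ⧸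
    MvPolynomial.vanishingIdeal ℂ (groupCoords '' S))

end Action

section Quotient

/-- Coordinates on `Hom(W, I ⊗ V)`. -/
abbrev HomIndex (n m : ℕ) : Type := (Fin 2 × Fin (n + 1)) × Fin (m + 2)

/-- The value at `A` of a polynomial function on `Hom(W, I ⊗ V)`. -/
def polyEval {n m : ℕ} (A : HomSpace n m) : MvPolynomial (HomIndex n m) ℂ →ₐ[ℂ] ℂ :=
  MvPolynomial.aeval fun p => A p.1 p.2

/-- The algebra of `G`-invariant polynomial functions on `Hom(W, I ⊗ V)`. -/
def invariants (n m : ℕ) : Subalgebra ℂ (MvPolynomial (HomIndex n m) ℂ) where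
  carrier := {f | ∀ (g : GroupG m) (A : HomSpace n m), polyEval (g • A) f = polyEval A f}
  mul_mem' := fun hf hg g A => by rw [map_mul, map_mul, hf g A, hg g A]
  add_mem' := fun hf hg g A => by rw [map_add, map_add, hf g A, hg g A]
  algebraMap_mem' := fun c g A => by rw [AlgHom.commutes, AlgHom.commutes]

/-- The grading of the algebra of invariants by the degree of polynomials. -/
def invariantGrading (n m : ℕ) : ℕ → Submodule ℂ (invariants n m) := fun d =>
  (MvPolynomial.homogeneousSubmodule (HomIndex n m) ℂ d).comap (invariants n m).val.toLinearMap

theorem polyEval_smul {n m d : ℕ} (t : ℂ) (A : HomSpace n m) {f : MvPolynomial (HomIndex n m) ℂ}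
    (hf : f.IsHomogeneous d) : polyEval (t • A) f = t ^ d * polyEval A f := by
  simp only [polyEval, MvPolynomial.aeval_def, MvPolynomial.eval₂_eq, Finset.mul_sum]
  refine Finset.sum_congr rfl fun u hu => ?_
  have hd : ∑ i ∈ u.support, u i = d := by
    rw [← hf (MvPolynomial.mem_support_iff.mp hu), Finsupp.weight_apply]
    simp [Finsupp.sum]
  simp only [Matrix.smul_apply, smul_eq_mul, mul_pow, Finset.prod_mul_distrib,
    Finset.prod_pow_eq_pow_sum, hd]
  ring

theorem homogeneousComponent_mem_invariants {n m : ℕ} {f : MvPolynomial (HomIndex n m) ℂ}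
    (hf : f ∈ invariants n m) (d : ℕ) :
    MvPolynomial.homogeneousComponent d f ∈ invariants n m := by
  intro g A
  have key : ∀ (B : HomSpace n m) (t : ℂ), polyEval (t • B) f =
      (∑ i ∈ Finset.range (f.totalDegree + 1),
        Polynomial.monomial i (polyEval B (MvPolynomial.homogeneousComponent i f))).eval t := by
    intro B t
    conv_lhs => rw [← MvPolynomial.sum_homogeneousComponent f]
    rw [map_sum, Polynomial.eval_finsetSum]
    refine Finset.sum_congr rfl fun i _ => ?_
    rw [polyEval_smul t B (MvPolynomial.homogeneousComponent_isHomogeneous i f),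
      Polynomial.eval_monomial, mul_comm]
  have h : (∑ i ∈ Finset.range (f.totalDegree + 1),
        Polynomial.monomial i (polyEval (g • A) (MvPolynomial.homogeneousComponent i f))) =
      ∑ i ∈ Finset.range (f.totalDegree + 1),
        Polynomial.monomial i (polyEval A (MvPolynomial.homogeneousComponent i f)) := by
    refine Polynomial.funext fun t => ?_
    rw [← key, ← key, ← smul_comm g t A]
    exact hf g (t • A)
  by_cases hd : d < f.totalDegree + 1
  · have h' := congrArg (fun p => Polynomial.coeff p d) h
    simpa [Polynomial.finsetSum_coeff, Polynomial.coeff_monomial, hd] using h'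
  · rw [MvPolynomial.homogeneousComponent_eq_zero _ _ (by omega), map_zero, map_zero]

instance invariantGradedMonoid (n m : ℕ) : SetLike.GradedMonoid (invariantGrading n m) where
  one_mem := MvPolynomial.isHomogeneous_one _ _
  mul_mem := fun _ _ _ _ hf hg => MvPolynomial.IsHomogeneous.mul hf hg

/-- The homogeneous component of degree `d` of an invariant polynomial. -/
def invariantComponent {n m : ℕ} (d : ℕ) (f : invariants n m) : invariantGrading n m d :=
  ⟨⟨MvPolynomial.homogeneousComponent d f.1, homogeneousComponent_mem_invariants f.2 d⟩,
    MvPolynomial.homogeneousComponent_isHomogeneous d f.1⟩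

theorem component_coe {n m : ℕ} (x : DirectSum ℕ fun d => invariantGrading n m d) (d : ℕ) :
    MvPolynomial.homogeneousComponent d
      (DirectSum.coeAddMonoidHom (invariantGrading n m) x).1 = (x d).1.1 := by
  induction x using DirectSum.induction_on with
  | zero => simp
  | of i y =>
    rw [DirectSum.coeAddMonoidHom_of, MvPolynomial.homogeneousComponent_of_mem (p := y.1.1) y.2]
    by_cases h : d = i
    · subst h
      simp
    · rw [if_neg h, DirectSum.of_eq_of_ne _ _ _ h]
      rfl
  | add x y hx hy =>
    rw [map_add]
    change MvPolynomial.homogeneousComponent d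
      ((DirectSum.coeAddMonoidHom (invariantGrading n m) x).1 +
        (DirectSum.coeAddMonoidHom (invariantGrading n m) y).1) = (x d).1.1 + (y d).1.1
    rw [map_add, hx, hy]

theorem mk_component {n m : ℕ} (f : invariants n m) (d : ℕ) :
    DirectSum.mk (fun d => invariantGrading n m d) (Finset.range (f.1.totalDegree + 1))
      (fun i => invariantComponent i f) d = invariantComponent d f := by
  by_cases hd : d ∈ Finset.range (f.1.totalDegree + 1)
  · exact DirectSum.mk_apply_of_mem hd
  · rw [DirectSum.mk_apply_of_notMem hd]
    refine Subtype.ext (Subtype.ext ?_)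
    exact (MvPolynomial.homogeneousComponent_eq_zero _ _ (by simpa using hd)).symm

instance invariantGradedAlgebra (n m : ℕ) : GradedAlgebra (invariantGrading n m) where
  toGradedMonoid := invariantGradedMonoid n m
  decompose' f := DirectSum.mk (fun d => invariantGrading n m d)
    (Finset.range (f.1.totalDegree + 1)) (fun i => invariantComponent i f)
  left_inv f := by
    have h : ∀ d, MvPolynomial.homogeneousComponent d (DirectSum.coeAddMonoidHom
        (invariantGrading n m) (DirectSum.mk (fun d => invariantGrading n m d)
          (Finset.range (f.1.totalDegree + 1)) (fun i => invariantComponent i f))).1 =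
        MvPolynomial.homogeneousComponent d f.1 := fun d => by
      rw [component_coe, mk_component]
      rfl
    refine Subtype.ext (MvPolynomial.ext _ _ fun u => ?_)
    have := congrArg (MvPolynomial.coeff u) (h u.degree)
    simpa [MvPolynomial.coeff_homogeneousComponent] using this
  right_inv x := by
    refine DFinsupp.ext fun d => ?_
    rw [mk_component]
    exact Subtype.ext (Subtype.ext (component_coe x d))

/-- The categorical quotient `M_{n,m,2} = ℙ(Hom(W, I ⊗ V)^*) // G`, the `Proj` of the graded algebra
of invariants. -/
def kroneckerModuli (n m : ℕ) : Scheme.{0} :=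
  Proj (invariantGrading n m)

/-- `X = ℙ(Hom(W, I ⊗ V)^*)` as a scheme. -/
def projHom (n m : ℕ) : Scheme.{0} :=
  Proj (MvPolynomial.homogeneousSubmodule (HomIndex n m) ℂ)

end Quotient

end SteinerKronecker

end

/-! Stabilizers. If (P, Q) fixes the line of A, then (P ⊗ 1)A = A(aQ) for a scalar a, so P and aQ
are automorphisms of I^* ⊗ 𝒪 and W^* ⊗ 𝒪(1) compatible with f_A, and they induce an automorphism of
the cokernel. Simplicity makes it a homothety c. Then aQ - c maps into the image of f_A, so it
factors through a morphism from copies of 𝒪(1) to copies of 𝒪; for n ≥ 1 such a morphism is zero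
(`twistingSheaf_one_hom_eq_zero`). Hence aQ = c, and P = c because f_A is a monomorphism.
Determinants then give the roots of unity.

Dimension. For a graded subalgebra of a polynomial ring of transcendence degree t ≥ 1, Proj has
dimension t - 1 (`topologicalKrullDim_proj_eq`); the chains of primes come from restriction to a
general flag of linear subspaces, so no finite generation of the invariants is needed. It remains to
show that the invariants have transcendence degree dim Hom(W, I ⊗ V) - dim G, where dim G = (m+2)² +
2.

Lower bound (`le_trdeg_invariants`): more than dim G coordinates, moved by a variable group element,
satisfy one polynomial relation over the function field K valid for every group element. A relation
of minimal support has, after scaling, coefficients in K^G. Since G is perfect and polynomial rings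
are factorial, K^G consists of fractions of invariants.

Upper bound (`trdeg_invariants_le`): the Lie algebra of G acts by vector fields that annihilate the
invariants. At a matrix A with only scalar endomorphisms (a brick) these vectors are linearly
independent, hence they are generically independent, and a Jacobian argument bounds the
transcendence degree. A brick exists because m < 2n and (n, m) ≠ (1, 0) (`exists_brick`). -/

/-! ### Transcendence degree and Krull dimension -/

open Cardinal in
/-- A non-injective surjection of domains lowers the transcendence degree. -/
theorem trdeg_add_one_le_of_not_injective {k A B : Type} [Field k] [CommRing A] [IsDomain A]
    [CommRing B] [IsDomain B] [Algebra k A] [Algebra k B] (f : A →ₐ[k] B)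
    (hf : Function.Surjective f) (hi : ¬ Function.Injective f) :
    Algebra.trdeg k B + 1 ≤ Algebra.trdeg k A := by
  obtain ⟨s, hs⟩ := exists_isTranscendenceBasis k B
  obtain ⟨a, ha, ha0⟩ : ∃ a, f a = 0 ∧ a ≠ 0 := by
    by_contra! h
    exact hi ((injective_iff_map_eq_zero f).2 h)
  choose g hg using hf
  have hfg : (f ∘ fun b : s => g b) = ((↑) : s → B) := funext fun b => hg b
  have hy : AlgebraicIndependent k (fun b : s => g b) := by
    refine AlgebraicIndependent.of_comp f ?_
    rw [hfg]
    exact hs.1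
  -- A nonzero element a of the kernel is transcendental over lifts of a transcendence basis of B.
  -- After cancelling powers of X, a relation for a has nonzero constant term; applying f leaves a
  -- relation between the basis elements alone.
  have key : Transcendental (Algebra.adjoin k (Set.range fun b : s => g b)) a := by
    rintro ⟨p, hp, hpa⟩
    obtain ⟨n, q, hq, hpq⟩ : ∃ n q, Polynomial.coeff q 0 ≠ 0 ∧ p = Polynomial.X ^ n * q := by
      obtain ⟨q, hq⟩ := Polynomial.X_pow_dvd_iff.2 (fun d hd =>
        Polynomial.coeff_eq_zero_of_lt_natTrailingDegree (p := p) hd)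
      refine ⟨_, q, ?_, hq⟩
      have := Polynomial.trailingCoeff_nonzero_iff_nonzero.2 hp
      rw [Polynomial.trailingCoeff] at this
      conv at this => enter [1, 1]; rw [hq]
      simpa [Polynomial.coeff_X_pow_mul'] using this
    have hqa : Polynomial.aeval a q = 0 := by
      rw [hpq, map_mul, map_pow, Polynomial.aeval_X] at hpa
      exact (mul_eq_zero.1 hpa).resolve_left (pow_ne_zero _ ha0)
    have h0 : f (q.coeff 0 : A) = 0 := by
      rw [← Polynomial.X_mul_divX_add q] at hqa
      simp only [map_add, map_mul, Polynomial.aeval_X, Polynomial.aeval_C] at hqa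
      have := congrArg f hqa
      rw [map_add, map_mul, ha, zero_mul, zero_add, map_zero] at this
      exact this
    obtain ⟨F, hF⟩ : ∃ F : MvPolynomial s k,
        MvPolynomial.aeval (fun b : s => g b) F = (q.coeff 0 : A) := by
      have h2 : ∀ y ∈ Algebra.adjoin k (Set.range fun b : s => g b), ∃ F : MvPolynomial s k,
          MvPolynomial.aeval (fun b : s => g b) F = y := fun y hy => by
        rwa [Algebra.adjoin_range_eq_range_aeval] at hy
      exact h2 _ (q.coeff 0).2
    have hF0 : F = 0 := by
      have h1 : MvPolynomial.aeval ((↑) : s → B) F = 0 := by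
        rw [← hfg, ← h0, ← hF]
        exact (MvPolynomial.comp_aeval_apply _ f F).symm
      exact (injective_iff_map_eq_zero _).1 hs.1 F h1
    apply hq
    rw [hF0, map_zero] at hF
    exact Subtype.ext hF.symm
  have h := ((hy.option_iff_transcendental a).2 key).cardinalMk_le_trdeg
  rwa [mk_option, hs.cardinalMk_eq_trdeg] at h

/-- The transcendence degree as a natural number. -/
noncomputable def natTrdeg (k A : Type) [Field k] [CommRing A] [Algebra k A] : ℕ :=
  (Algebra.trdeg k A).toNat

open Cardinal in
theorem natTrdeg_quotient_lt {k A : Type} [Field k] [CommRing A] [Algebra k A]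
    (hA : Algebra.trdeg k A < ℵ₀) {p q : Ideal A} [p.IsPrime] [q.IsPrime] (h : p < q) :
    natTrdeg k (A ⧸ q) < natTrdeg k (A ⧸ p) := by
  have h1 := trdeg_add_one_le_of_not_injective (Ideal.Quotient.factorₐ k h.le)
    (Ideal.Quotient.factor_surjective h.le) (fun hi => by
      obtain ⟨a, ha, hb⟩ := Set.exists_of_ssubset h
      apply hb
      rw [SetLike.mem_coe, ← Ideal.Quotient.eq_zero_iff_mem]
      apply hi
      rw [map_zero]
      exact Ideal.Quotient.eq_zero_iff_mem.2 ha)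
  have h2 : Algebra.trdeg k (A ⧸ p) < ℵ₀ :=
    (_root_.trdeg_le_of_surjective (Ideal.Quotient.mkₐ k p) (Ideal.Quotient.mkₐ_surjective k p)).trans_lt hA
  have h3 : Algebra.trdeg k (A ⧸ q) < ℵ₀ := lt_of_le_of_lt (le_self_add.trans h1) h2
  have := toNat_le_toNat h1 h2
  rw [toNat_add h3 one_lt_aleph0, map_one] at this
  exact Nat.lt_of_succ_le this

/-- Along a chain of length l the function f drops by at least l, inside a window of width b. The
lower end a is kept free because for Proj the value 0 is excluded, which saves one dimension. -/
theorem krullDim_le_of_strictAnti_nat {α : Type*} [Preorder α] (f : α → ℕ) (hf : StrictAnti f)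
    {a b : ℕ} (hb : ∀ x, a ≤ f x ∧ f x ≤ a + b) : Order.krullDim α ≤ b := by
  refine iSup_le fun l => ?_
  have h : ∀ i : ℕ, ∀ hi : i < l.length + 1, f (l ⟨i, hi⟩) + i ≤ f (l 0) := by
    intro i
    induction i with
    | zero => intro hi; exact le_rfl
    | succ i ih =>
      intro hi
      have h1 := ih (by omega)
      have h2 : f (l ⟨i + 1, hi⟩) < f (l ⟨i, by omega⟩) := hf (l.strictMono (by simp [Fin.lt_def]))
      omega
  have h1 := h l.length (by omega)
  have h2 := (hb (l 0)).2
  have h3 := (hb (l ⟨l.length, by omega⟩)).1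
  have : l.length ≤ b := by omega
  exact_mod_cast this

open Cardinal in
theorem natTrdeg_mono_of_surjective {k A B : Type} [Field k] [CommRing A] [CommRing B] [Algebra k A]
    [Algebra k B] (f : A →ₐ[k] B) (hf : Function.Surjective f) (hA : Algebra.trdeg k A < ℵ₀) :
    natTrdeg k B ≤ natTrdeg k A :=
  toNat_le_toNat (_root_.trdeg_le_of_surjective f hf) hA

/-- If every domain quotient of `A` has transcendence degree at most `d`, then `dim A ≤ d`. -/
theorem ringKrullDim_le_of_trdeg_quotient_le {k A : Type} [Field k] [CommRing A] [Algebra k A]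
    (d : ℕ) (hd : ∀ p : Ideal A, p.IsPrime → Algebra.trdeg k (A ⧸ p) ≤ d)
    (hA : Algebra.trdeg k A < Cardinal.aleph0) :
    ringKrullDim A ≤ d := by
  refine krullDim_le_of_strictAnti_nat (a := 0) (fun p : PrimeSpectrum A => natTrdeg k (A ⧸ p.asIdeal))
    (fun p q h => natTrdeg_quotient_lt hA h) fun p => ⟨Nat.zero_le _, ?_⟩
  have := Cardinal.toNat_le_toNat (hd p.asIdeal p.2) Cardinal.natCast_lt_aleph0
  simpa [natTrdeg] using this

/-- Lying over gives a prime above the head of a chain, and going up lifts the rest. -/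
theorem ringKrullDim_le_of_isIntegral_of_injective {A B : Type} [CommRing A] [CommRing B] (f : A →+* B)
    (hf : f.IsIntegral) (hi : Function.Injective f) : ringKrullDim A ≤ ringKrullDim B := by
  algebraize [f]
  refine iSup_le fun l => ?_
  obtain ⟨Q, -, hQ, h⟩ := Ideal.exists_ideal_over_prime_of_isIntegral (S := B) l.head.asIdeal ⊥
    ((Ideal.comap_bot_of_injective f hi).trans_le bot_le)
  have : Q.LiesOver l.head.asIdeal := ⟨h.symm⟩
  obtain ⟨L, h1, -⟩ := Ideal.exists_ltSeries_of_hasGoingUp l Q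
  rw [← h1]
  exact Order.LTSeries.length_le_krullDim L

/-- The zero ideal is the minimal prime of A, and minimal primes are contractions along an injective
map. This reduces comparisons of transcendence degree to the case where B is a domain. -/
theorem exists_isPrime_injective_quotient {A B : Type} [CommRing A] [IsDomain A] [CommRing B]
    (f : A →+* B) (hf : Function.Injective f) :
    ∃ p : Ideal B, p.IsPrime ∧ Function.Injective ((Ideal.Quotient.mk p).comp f) := by
  obtain ⟨p, hp, h⟩ := Ideal.exists_comap_eq_of_mem_minimalPrimes_of_injective hf ⊥
    (by rw [IsDomain.minimalPrimes_eq_singleton_bot]; rfl)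
  refine ⟨p, hp, (injective_iff_map_eq_zero _).2 fun a ha => ?_⟩
  have : a ∈ p.comap f := by
    rw [Ideal.mem_comap, ← Ideal.Quotient.eq_zero_iff_mem]
    exact ha
  rwa [h] at this

/-- A finitely generated algebra containing a polynomial ring in `d` variables has dimension at
least `d`. -/
theorem card_le_ringKrullDim {k B ι : Type} [Field k] [CommRing B] [Algebra k B]
    [Algebra.FiniteType k B] [Finite ι] (f : MvPolynomial ι k →ₐ[k] B)
    (hf : Function.Injective f) : (Nat.card ι : WithBot ℕ∞) ≤ ringKrullDim B := by
  obtain ⟨p, hp, hpi⟩ := exists_isPrime_injective_quotient f.toRingHom hf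
  refine le_trans ?_ (ringKrullDim_le_of_surjective (Ideal.Quotient.mk p)
    Ideal.Quotient.mk_surjective)
  -- Noether normalization of the domain `B ⧸ p`: its dimension is at least s, and s bounds its
  -- transcendence degree, which is at least the number of variables in ι.
  obtain ⟨s, g, hg, hgi⟩ := exists_integral_inj_algHom_of_fg k (B ⧸ p)
  refine le_trans ?_ (ringKrullDim_le_of_isIntegral_of_injective g.toRingHom hgi hg)
  rw [MvPolynomial.ringKrullDim_of_isNoetherianRing, ringKrullDim_eq_zero_of_field, zero_add]
  have h1 : Algebra.trdeg k (B ⧸ p) ≤ s := by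
    have ha : Algebra.IsAlgebraic (Algebra.adjoin k (Set.range fun i => g (MvPolynomial.X i)))
        (B ⧸ p) := by
      refine ⟨fun b => ?_⟩
      obtain ⟨P, hP, hb⟩ := hgi b
      have hr : ∀ y, g y ∈ Algebra.adjoin k (Set.range fun i => g (MvPolynomial.X i)) := by
        intro y
        rw [Algebra.adjoin_range_eq_range_aeval]
        refine ⟨y, ?_⟩
        conv_rhs => rw [← MvPolynomial.aeval_X_left_apply y]
        exact (MvPolynomial.comp_aeval_apply _ g y).symm
      let g' : MvPolynomial (Fin s) k →+*
          Algebra.adjoin k (Set.range fun i => g (MvPolynomial.X i)) :=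
        (g : MvPolynomial (Fin s) k →+* B ⧸ p).codRestrict _ hr
      refine IsIntegral.isAlgebraic ⟨P.map g', hP.map _, ?_⟩
      rw [Polynomial.eval₂_map]
      exact hb
    refine (Algebra.IsAlgebraic.trdeg_le_cardinalMk k
      (Set.range fun i => g (MvPolynomial.X i))).trans ?_
    exact (Cardinal.mk_range_le).trans (by simp)
  have h2 := lift_trdeg_le_of_injective ((Ideal.Quotient.mkₐ k p).comp f) hpi
  rw [MvPolynomial.trdeg_of_isDomain, Cardinal.lift_id, Cardinal.lift_id, Cardinal.lift_id] at h2
  have h3 : (Nat.card ι : Cardinal) ≤ s := by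
    rw [Nat.cast_card]
    exact h2.trans h1
  have h4 : Nat.card ι ≤ s := by exact_mod_cast h3
  simpa using (by exact_mod_cast h4 : (Nat.card ι : WithBot ℕ∞) ≤ s)


/-- In a matrix of determinant one over a domain, some entry of the first row is algebraic over
every subalgebra that contains the other entries. -/
theorem exists_isAlgebraic_entry_of_det_eq_one {k B : Type} [Field k] [CommRing B] [IsDomain B]
    [Algebra k B] {d : ℕ} (P : Matrix (Fin (d + 1)) (Fin (d + 1)) B) (hP : P.det = 1) :
    ∃ j₀, ∀ T : Subalgebra k B, (∀ i j, (i, j) ≠ (0, j₀) → P i j ∈ T) → IsAlgebraic T (P 0 j₀) := by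
  -- Some minor along the first row is nonzero, otherwise the determinant would vanish. The Laplace
  -- expansion is then a linear equation for the entry `P 0 j₀` with that minor, up to sign, as
  -- leading coefficient.
  obtain ⟨j₀, hj₀⟩ : ∃ j, (P.submatrix Fin.succ (Fin.succAbove j)).det ≠ 0 := by
    by_contra! h
    rw [Matrix.det_succ_row_zero] at hP
    simp [h] at hP
  refine ⟨j₀, fun T hT => ?_⟩
  have hmem : ∀ j, (P.submatrix Fin.succ (Fin.succAbove j)).det ∈ T := fun j => by
    rw [Matrix.det_apply]
    refine Subalgebra.sum_mem _ fun σ _ => ?_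
    rw [Units.smul_def]
    exact Subalgebra.zsmul_mem _ (Subalgebra.prod_mem _ fun i _ => hT _ _ (by simp)) _
  have hr : 1 - ∑ j ∈ Finset.univ.erase j₀,
      (-1) ^ (j : ℕ) * P 0 j * (P.submatrix Fin.succ (Fin.succAbove j)).det ∈ T := by
    refine Subalgebra.sub_mem _ (Subalgebra.one_mem _) (Subalgebra.sum_mem _ fun j hj => ?_)
    refine Subalgebra.mul_mem _ (Subalgebra.mul_mem _ ?_ (hT _ _ ?_)) (hmem j)
    · exact Subalgebra.pow_mem _ (Subalgebra.neg_mem _ (Subalgebra.one_mem _)) _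
    · simpa using Finset.ne_of_mem_erase hj
  have hl : (-1) ^ (j₀ : ℕ) * (P.submatrix Fin.succ (Fin.succAbove j₀)).det ∈ T :=
    Subalgebra.mul_mem _
      (Subalgebra.pow_mem _ (Subalgebra.neg_mem _ (Subalgebra.one_mem _)) _) (hmem j₀)
  refine ⟨Polynomial.C ⟨_, hl⟩ * Polynomial.X - Polynomial.C ⟨_, hr⟩, fun h => ?_, ?_⟩
  · have := congrArg (fun p => Polynomial.coeff p 1) h
    simp only [Polynomial.coeff_sub, Polynomial.coeff_C_mul, Polynomial.coeff_X_one, mul_one,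
      Polynomial.coeff_C_succ, sub_zero, Polynomial.coeff_zero] at this
    have h2 := congrArg Subtype.val this
    simp only [ZeroMemClass.coe_zero, mul_eq_zero] at h2
    exact h2.elim (pow_ne_zero _ (by simp)) hj₀
  · simp only [map_sub, map_mul, Polynomial.aeval_C, Polynomial.aeval_X, Subalgebra.algebraMap_def,
      Algebra.algebraMap_self, RingHom.id_apply]
    rw [Matrix.det_succ_row_zero, ← Finset.add_sum_erase _ _ (Finset.mem_univ j₀)] at hP
    linear_combination hP

/-- B is algebraic over the subalgebra generated by the other `Fintype.card κ - 2` generators, so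
their number bounds the transcendence degree. -/
theorem trdeg_le_of_isAlgebraic_pair {k B κ : Type} [Field k] [CommRing B] [IsDomain B]
    [Algebra k B] [Fintype κ] [DecidableEq κ] (c : κ → B) (hc : Algebra.adjoin k (Set.range c) = ⊤)
    {i₁ i₂ : κ} (hi : i₁ ≠ i₂)
    (h₁ : IsAlgebraic (Algebra.adjoin k (c '' {i₁, i₂}ᶜ)) (c i₁))
    (h₂ : IsAlgebraic (Algebra.adjoin k (c '' {i₁, i₂}ᶜ)) (c i₂)) :
    Algebra.trdeg k B ≤ (Fintype.card κ - 2 : ℕ) := by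
  have ha : Algebra.IsAlgebraic (Algebra.adjoin k (c '' {i₁, i₂}ᶜ)) B := by
    refine ⟨fun b => ?_⟩
    suffices h : Algebra.adjoin k (Set.range c) ≤
        (Subalgebra.algebraicClosure (Algebra.adjoin k (c '' {i₁, i₂}ᶜ)) B).restrictScalars k from
      h (hc ▸ Algebra.mem_top)
    rw [Algebra.adjoin_le_iff]
    rintro _ ⟨i, rfl⟩
    by_cases e₁ : i = i₁
    · subst e₁; exact h₁
    by_cases e₂ : i = i₂
    · subst e₂; exact h₂
    exact isAlgebraic_algebraMap (⟨c i, Algebra.subset_adjoin ⟨i, by simp [e₁, e₂], rfl⟩⟩ :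
      Algebra.adjoin k (c '' {i₁, i₂}ᶜ))
  refine (Algebra.IsAlgebraic.trdeg_le_cardinalMk k (c '' {i₁, i₂}ᶜ)).trans ?_
  refine Cardinal.mk_image_le.trans ?_
  rw [Cardinal.mk_fintype, Nat.cast_le]
  have : Fintype.card ({i₁, i₂}ᶜ : Set κ) = Fintype.card κ - 2 := by
    rw [Fintype.card_compl_set]
    congr 1
    rw [← Set.toFinset_card]
    simp [hi]
  exact this.le

/-! ### The dimension of G -/

namespace SteinerKronecker

/-- The coordinates on a pair of square matrices of sizes `2` and `m + 2`. -/
abbrev GroupIndex (m : ℕ) : Type := (Fin 2 × Fin 2) ⊕ (Fin (m + 2) × Fin (m + 2))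

/-- Each of the two determinant equations removes one coordinate: the value is 3 + ((m+2)² - 1), the
dimension of SL(2) × SL(m+2). -/
theorem card_groupIndex (m : ℕ) : Fintype.card (GroupIndex m) - 2 = (m + 2) ^ 2 + 2 := by
  simp only [Fintype.card_sum, Fintype.card_prod, Fintype.card_fin]
  have : 4 ≤ (m + 2) ^ 2 := by nlinarith [Nat.zero_le m]
  rw [← sq (m + 2)]
  omega

theorem trdeg_le_of_det_eq_one {k B : Type} [Field k] [CommRing B] [IsDomain B] [Algebra k B]
    {m : ℕ} (c : GroupIndex m → B) (hc : Algebra.adjoin k (Set.range c) = ⊤)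
    (h₁ : (Matrix.of fun i j => c (Sum.inl (i, j))).det = 1)
    (h₂ : (Matrix.of fun i j => c (Sum.inr (i, j))).det = 1) :
    Algebra.trdeg k B ≤ ((m + 2) ^ 2 + 2 : ℕ) := by
  obtain ⟨j₁, hj₁⟩ := exists_isAlgebraic_entry_of_det_eq_one (k := k) _ h₁
  obtain ⟨j₂, hj₂⟩ := exists_isAlgebraic_entry_of_det_eq_one (k := k) _ h₂
  rw [← card_groupIndex]
  refine trdeg_le_of_isAlgebraic_pair c hc (i₁ := Sum.inl (0, j₁)) (i₂ := Sum.inr (0, j₂))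
    (by simp) (hj₁ _ ?_) (hj₂ _ ?_)
  · exact fun i j h => Algebra.subset_adjoin ⟨Sum.inl (i, j), by simpa using h, rfl⟩
  · exact fun i j h => Algebra.subset_adjoin ⟨Sum.inr (i, j), by simpa using h, rfl⟩

/-- The polynomials det - 1 lie in the vanishing ideal of V, so both determinant relations survive
in every domain onto which the coordinate ring of V maps. -/
theorem trdeg_le_of_surjective_of_vanishing {k K B : Type} [Field k] [Field K] [Algebra k K]
    [CommRing B] [IsDomain B] [Algebra k B] {m : ℕ} (V : Set (GroupIndex m → K))
    (h₁ : ∀ x ∈ V, (Matrix.of fun i j => x (Sum.inl (i, j))).det = 1)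
    (h₂ : ∀ x ∈ V, (Matrix.of fun i j => x (Sum.inr (i, j))).det = 1)
    (π : MvPolynomial (GroupIndex m) k →ₐ[k] B) (hπ : Function.Surjective π)
    (hV : ∀ F ∈ MvPolynomial.vanishingIdeal k V, π F = 0) :
    Algebra.trdeg k B ≤ ((m + 2) ^ 2 + 2 : ℕ) := by
  have hdet : ∀ {d : ℕ} (e : Fin d × Fin d → GroupIndex m),
      (∀ x ∈ V, (Matrix.of fun i j => x (e (i, j))).det = 1) →
      (Matrix.of fun i j => π (MvPolynomial.X (e (i, j)))).det = 1 := by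
    intro d e he
    have h : (Matrix.of fun i j =>
        (MvPolynomial.X (e (i, j)) : MvPolynomial (GroupIndex m) k)).det - 1 ∈
        MvPolynomial.vanishingIdeal k V := by
      intro x hx
      rw [map_sub, map_one, ← he x hx, AlgHom.map_det, sub_eq_zero]
      congr 1
      ext i j
      simp
    have h2 := hV _ h
    rw [map_sub, map_one, sub_eq_zero, AlgHom.map_det] at h2
    exact h2
  refine trdeg_le_of_det_eq_one (fun i => π (MvPolynomial.X i)) ?_ (hdet Sum.inl h₁) (hdet Sum.inr h₂)
  rw [Set.range_comp' π, ← AlgHom.map_adjoin, MvPolynomial.adjoin_range_X, Algebra.map_top,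
    AlgHom.range_eq_top]
  exact hπ

theorem trdeg_quotient_le {k K : Type} [Field k] [Field K] [Algebra k K] {m : ℕ}
    (V : Set (GroupIndex m → K))
    (h₁ : ∀ x ∈ V, (Matrix.of fun i j => x (Sum.inl (i, j))).det = 1)
    (h₂ : ∀ x ∈ V, (Matrix.of fun i j => x (Sum.inr (i, j))).det = 1)
    (p : Ideal (MvPolynomial (GroupIndex m) k ⧸ MvPolynomial.vanishingIdeal k V)) (hp : p.IsPrime) :
    Algebra.trdeg k ((MvPolynomial (GroupIndex m) k ⧸ MvPolynomial.vanishingIdeal k V) ⧸ p) ≤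
      ((m + 2) ^ 2 + 2 : ℕ) := by
  refine trdeg_le_of_surjective_of_vanishing V h₁ h₂
    ((Ideal.Quotient.mkₐ k p).comp (Ideal.Quotient.mkₐ k _))
    ((Ideal.Quotient.mkₐ_surjective k p).comp (Ideal.Quotient.mkₐ_surjective k _)) fun F hF => ?_
  change Ideal.Quotient.mk p (Ideal.Quotient.mk _ _) = 0
  rw [Ideal.Quotient.eq_zero_iff_mem.2 hF, map_zero]

theorem det_groupCoords_inl {m : ℕ} (g : GroupG m) :
    (Matrix.of fun i j => groupCoords g (Sum.inl (i, j))).det = 1 := g.1.2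

theorem det_groupCoords_inr {m : ℕ} (g : GroupG m) :
    (Matrix.of fun i j => groupCoords g (Sum.inr (i, j))).det = 1 := g.2.2

/-- Functions given on `G` by polynomials over an extension `K` of `ℂ` satisfy a polynomial
relation over `K` as soon as there are more than `dim G` of them. -/
theorem exists_relation_on_group {K τ : Type} [Field K] [Algebra ℂ K] [Fintype τ] {m : ℕ}
    (hτ : (m + 2) ^ 2 + 2 < Fintype.card τ) (y : τ → MvPolynomial (GroupIndex m) K) :
    ∃ F : MvPolynomial τ K, F ≠ 0 ∧ ∀ h : GroupG m, MvPolynomial.aeval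
      (fun t => MvPolynomial.aeval (fun i => algebraMap ℂ K (groupCoords h i)) (y t)) F = 0 := by
  by_contra! hcon
  let V : Set (GroupIndex m → K) := Set.range fun (h : GroupG m) i => algebraMap ℂ K (groupCoords h i)
  -- Without a relation, the polynomial ring in τ would embed into the ring of K-polynomial
  -- functions on G, hence into a domain quotient of it, whose transcendence degree is at most dim
  -- G.
  let f : MvPolynomial τ K →ₐ[K] MvPolynomial (GroupIndex m) K ⧸ MvPolynomial.vanishingIdeal K V :=
    (Ideal.Quotient.mkₐ K _).comp (MvPolynomial.aeval y)
  have hf : Function.Injective f := by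
    refine (injective_iff_map_eq_zero f).2 fun F hF => ?_
    by_contra h0
    obtain ⟨h, hh⟩ := hcon F h0
    apply hh
    have hF' : MvPolynomial.aeval y F ∈ MvPolynomial.vanishingIdeal K V :=
      Ideal.Quotient.eq_zero_iff_mem.1 hF
    have := hF' _ ⟨h, rfl⟩
    rw [← this]
    exact (MvPolynomial.comp_aeval_apply y _ F).symm
  obtain ⟨p, hp, hpi⟩ := exists_isPrime_injective_quotient f.toRingHom hf
  have h1 := lift_trdeg_le_of_injective ((Ideal.Quotient.mkₐ K p).comp f) hpi
  rw [MvPolynomial.trdeg_of_isDomain, Cardinal.lift_id, Cardinal.lift_id, Cardinal.lift_id] at h1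
  have hV : ∀ {d : ℕ} (e : Fin d × Fin d → GroupIndex m),
      (∀ h : GroupG m, (Matrix.of fun i j => groupCoords h (e (i, j))).det = 1) →
      ∀ x ∈ V, (Matrix.of fun i j => x (e (i, j))).det = 1 := by
    rintro d e he _ ⟨h, rfl⟩
    have := congrArg (algebraMap ℂ K) (he h)
    rwa [RingHom.map_det, map_one] at this
  have h2 := h1.trans (trdeg_quotient_le V (hV Sum.inl det_groupCoords_inl)
    (hV Sum.inr det_groupCoords_inr) p hp)
  rw [Cardinal.mk_fintype, Nat.cast_le] at h2
  omega

/-- The determinant is an affine function of the upper left entry, with the complementary minor as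
slope, so that entry can be solved for. -/
theorem exists_det_eq_one_of_minor_ne_zero {d : ℕ} (x : Fin (d + 1) × Fin (d + 1) → ℂ)
    (hx : (Matrix.of fun i j : Fin d => x (i.succ, j.succ)).det ≠ 0) :
    ∃ g : Matrix.SpecialLinearGroup (Fin (d + 1)) ℂ, ∀ i j, (i, j) ≠ (0, 0) → g.1 i j = x (i, j) := by
  let P : ℂ → Matrix (Fin (d + 1)) (Fin (d + 1)) ℂ :=
    fun t => Matrix.of fun i j => if (i, j) = (0, 0) then t else x (i, j)
  have hP : ∀ t, (P t).det = t * (Matrix.of fun i j : Fin d => x (i.succ, j.succ)).det + (P 0).det := by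
    intro t
    have hs : ∀ t (j : Fin d → Fin (d + 1)), (P t).submatrix Fin.succ j = (P 0).submatrix Fin.succ j := by
      intro t j
      ext a b
      simp [P]
    rw [Matrix.det_succ_row_zero, Matrix.det_succ_row_zero (P 0), Fin.sum_univ_succ,
      Fin.sum_univ_succ]
    simp only [hs t]
    have h0 : (P 0).submatrix Fin.succ (Fin.succAbove 0) =
        Matrix.of fun i j : Fin d => x (i.succ, j.succ) := by
      ext a b
      simp [P]
    rw [h0]
    simp [P]
  refine ⟨⟨P ((1 - (P 0).det) / (Matrix.of fun i j : Fin d => x (i.succ, j.succ)).det), ?_⟩, ?_⟩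
  · rw [hP, div_mul_cancel₀ _ hx]
    ring
  · intro i j h
    simp only [P, Matrix.of_apply, if_neg h]

/-- The coordinates on `G` other than the two upper left entries. -/
abbrev FreeGroupIndex (m : ℕ) : Type :=
  {i : GroupIndex m // i ≠ Sum.inl (0, 0) ∧ i ≠ Sum.inr (0, 0)}

/-- The determinant takes the value 1 at the identity matrix; injectivity of e makes that point well
defined. -/
theorem det_X_ne_zero {σ : Type} {d : ℕ} (e : Fin d × Fin d → σ) (he : Function.Injective e) :
    (Matrix.of fun i j => (MvPolynomial.X (e (i, j)) : MvPolynomial σ ℂ)).det ≠ 0 := by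
  intro h
  have h1 := congrArg (MvPolynomial.aeval
    (fun s => (Function.extend e (fun p => if p.1 = p.2 then (1 : ℂ) else 0) 0 s : ℂ))) h
  rw [map_zero, AlgHom.map_det] at h1
  have h2 : ((Matrix.of fun i j => (MvPolynomial.X (e (i, j)) : MvPolynomial σ ℂ)).map
    (MvPolynomial.aeval
      (fun s => (Function.extend e (fun p => if p.1 = p.2 then (1 : ℂ) else 0) 0 s : ℂ)))) = 1 := by
    ext i j
    simp [he.extend_apply, Matrix.one_apply]
  rw [show (MvPolynomial.aeval _).mapMatrix _ = 1 from h2, Matrix.det_one] at h1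
  exact one_ne_zero h1

/-- G projects onto a dense subset of the space of free coordinates: every point where both
complementary minors are nonzero lifts to G. Multiplying F by the two minors restricts attention to
such points. -/
theorem eq_zero_of_vanishing_on_group {m : ℕ} (F : MvPolynomial (FreeGroupIndex m) ℂ)
    (hF : ∀ g : GroupG m, MvPolynomial.aeval (fun i => groupCoords g i.1) F = 0) : F = 0 := by
  let e₁ : Fin 1 × Fin 1 → FreeGroupIndex m := fun p => ⟨Sum.inl (p.1.succ, p.2.succ), by simp⟩
  let e₂ : Fin (m + 1) × Fin (m + 1) → FreeGroupIndex m :=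
    fun p => ⟨Sum.inr (p.1.succ, p.2.succ), by simp⟩
  have he₁ : Function.Injective e₁ := fun p q h => by
    simpa [e₁, Prod.ext_iff] using h
  have he₂ : Function.Injective e₂ := fun p q h => by
    simpa [e₂, Prod.ext_iff] using h
  by_contra h0
  obtain ⟨x, hx⟩ : ∃ x : FreeGroupIndex m → ℂ, MvPolynomial.eval x
      (F * (Matrix.of fun i j => (MvPolynomial.X (e₁ (i, j)) : MvPolynomial _ ℂ)).det *
      (Matrix.of fun i j => (MvPolynomial.X (e₂ (i, j)) : MvPolynomial _ ℂ)).det) ≠ 0 := by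
    by_contra! h
    exact mul_ne_zero (mul_ne_zero h0 (det_X_ne_zero e₁ he₁)) (det_X_ne_zero e₂ he₂)
      (MvPolynomial.funext fun x => by rw [h x, map_zero])
  rw [map_mul, map_mul, RingHom.map_det, RingHom.map_det] at hx
  let x' : GroupIndex m → ℂ := Function.extend Subtype.val x 0
  have hx' : ∀ i : FreeGroupIndex m, x' i.1 = x i := fun i => Subtype.val_injective.extend_apply _ _ _
  obtain ⟨g₁, hg₁⟩ := exists_det_eq_one_of_minor_ne_zero (fun p => x' (Sum.inl p)) (by
    have := right_ne_zero_of_mul (left_ne_zero_of_mul hx)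
    convert this using 2
    ext i j
    simp only [RingHom.mapMatrix_apply, Matrix.map_apply, Matrix.of_apply, MvPolynomial.eval_X]
    exact hx' (e₁ (i, j)))
  obtain ⟨g₂, hg₂⟩ := exists_det_eq_one_of_minor_ne_zero (fun p => x' (Sum.inr p)) (by
    have := right_ne_zero_of_mul hx
    convert this using 2
    ext i j
    simp only [RingHom.mapMatrix_apply, Matrix.map_apply, Matrix.of_apply, MvPolynomial.eval_X]
    exact hx' (e₂ (i, j)))
  apply left_ne_zero_of_mul (left_ne_zero_of_mul hx)
  have := hF (g₁, g₂)
  rw [MvPolynomial.aeval_eq_eval] at this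
  convert this using 3
  funext i
  rw [← hx' i]
  obtain ⟨⟨i, j⟩ | ⟨i, j⟩, hi⟩ := i
  · exact (hg₁ i j fun h => hi.1 (by rw [h])).symm
  · exact (hg₂ i j fun h => hi.2 (by rw [h])).symm

/-- The determinant equations bound the dimension above; the free coordinates are algebraically
independent on G and bound it below. -/
theorem algDim_univ (m : ℕ) :
    algDim (Set.univ : Set (GroupG m)) = ((m + 2) ^ 2 + 2 : ℕ) := by
  rw [algDim, Set.image_univ]
  apply le_antisymm
  · refine ringKrullDim_le_of_trdeg_quotient_le (k := ℂ) _
      (fun p hp => trdeg_quotient_le _ ?_ ?_ p hp) ?_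
    · rintro _ ⟨g, rfl⟩
      exact det_groupCoords_inl g
    · rintro _ ⟨g, rfl⟩
      exact det_groupCoords_inr g
    · exact trdeg_lt_aleph0_of_finiteType
  · have := card_le_ringKrullDim ((Ideal.Quotient.mkₐ ℂ
      (MvPolynomial.vanishingIdeal ℂ (Set.range (groupCoords (m := m))))).comp
      (MvPolynomial.rename (Subtype.val : FreeGroupIndex m → GroupIndex m))) ?_
    · convert this
      rw [Nat.card_eq_fintype_card, ← card_groupIndex]
      have h1 := Fintype.card_subtype_compl
        (fun i : GroupIndex m => i = Sum.inl (0, 0) ∨ i = Sum.inr (0, 0))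
      rw [Fintype.card_subtype_eq_or_eq_of_ne (by simp)] at h1
      rw [← h1]
      exact Fintype.card_congr (Equiv.subtypeEquivRight fun i => by simp)
    · refine (injective_iff_map_eq_zero _).2 fun F hF => eq_zero_of_vanishing_on_group F fun g => ?_
      have h : MvPolynomial.rename Subtype.val F ∈
        MvPolynomial.vanishingIdeal ℂ (Set.range (groupCoords (m := m))) :=
        Ideal.Quotient.eq_zero_iff_mem.1 hF
      have := h _ ⟨g, rfl⟩
      rwa [MvPolynomial.aeval_rename] at this

end SteinerKronecker


/-! ### Perfectness of G, and dimension of finite subsets -/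

-- Conjugation by diag(a, a⁻¹) multiplies the parameter of a transvection by a². The commutator with
-- the transvection of parameter x therefore has parameter (a² - 1)x, which equals c for x = c / (a²
-- - 1).
open Matrix.SpecialLinearGroup in
open scoped commutatorElement in
theorem Matrix.SpecialLinearGroup.transvection_mem_commutator_of_sq_ne_one {F ι : Type*} [Field F]
    [Fintype ι] [DecidableEq ι] {i j : ι} (hij : i ≠ j) {a : F} (ha : a ≠ 0) (hasq : a ^ 2 ≠ 1)
    (c : F) :
    transvection hij c ∈ commutator (Matrix.SpecialLinearGroup ι F) := by
  have h1 : diag2n hij a ha * transvection hij (c / (a ^ 2 - 1)) =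
      transvection hij (a ^ 2 * (c / (a ^ 2 - 1))) * diag2n hij a ha := by
    refine Subtype.ext ?_
    rw [coe_mul, coe_mul, transvection_coe, transvection_coe, diag2n_coe, mul_add, add_mul, mul_one,
      one_mul]
    congr 1
    ext x y
    rw [Matrix.diagonal_mul, Matrix.mul_diagonal, Matrix.single_apply, Matrix.single_apply]
    split_ifs <;> grind
  have h2 : ⁅diag2n hij a ha, transvection hij (c / (a ^ 2 - 1))⁆ = transvection hij c := by
    rw [commutatorElement_def, h1, mul_inv_cancel_right, transvection_inv, ← transvection_add]
    congr 1
    have := sub_ne_zero.2 hasq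
    field_simp
    ring
  rw [← h2]
  exact Subgroup.commutator_mem_commutator (Subgroup.mem_top _) (Subgroup.mem_top _)

-- The right side is w(a) w(-1), where w(a) denotes the Weyl element built from the parameters a,
-- -a⁻¹, a.
open Matrix.SpecialLinearGroup in
theorem Matrix.SpecialLinearGroup.diag2n_eq_prod_transvection {F ι : Type*} [Field F]
    [Fintype ι] [DecidableEq ι] {i j : ι} (hij : i ≠ j) {a : F} (ha : a ≠ 0) :
    diag2n hij a ha = transvection hij a * transvection hij.symm (-a⁻¹) * transvection hij a *
      transvection hij (-1) * transvection hij.symm 1 * transvection hij (-1) := by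
  refine Subtype.ext ?_
  simp only [coe_mul, transvection_coe, diag2n_coe]
  simp only [mul_add, add_mul, one_mul, mul_one, Matrix.single_mul_single_same,
    Matrix.single_mul_single_of_ne _ _ _ _ hij, Matrix.single_mul_single_of_ne _ _ _ _ hij.symm,
    add_zero, mul_inv_cancel₀ ha, inv_mul_cancel₀ ha, neg_mul, mul_neg,
    neg_neg]
  ext x y
  simp only [Matrix.add_apply, Matrix.single_apply, Matrix.one_apply, Matrix.diagonal_apply]
  grind

open Matrix.SpecialLinearGroup in
theorem Matrix.SpecialLinearGroup.commutator_eq_top_of_sq_ne_one {F ι : Type*} [Field F]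
    [Fintype ι] [DecidableEq ι] [Nontrivial ι] {a : F} (ha : a ≠ 0) (hasq : a ^ 2 ≠ 1) :
    commutator (Matrix.SpecialLinearGroup ι F) = ⊤ := by
  have ht : ∀ (i j : ι) (hij : i ≠ j) (c : F),
      transvection hij c ∈ commutator (Matrix.SpecialLinearGroup ι F) :=
    fun i j hij c => transvection_mem_commutator_of_sq_ne_one hij ha hasq c
  refine le_antisymm le_top fun A _ => diagonal_transvection_induction' (· ∈ commutator _) A
    (fun i j hij c hc => ?_) ht (fun _ _ => mul_mem)
  rw [diag2n_eq_prod_transvection]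
  exact mul_mem (mul_mem (mul_mem (mul_mem (mul_mem (ht _ _ _ _) (ht _ _ _ _)) (ht _ _ _ _))
    (ht _ _ _ _)) (ht _ _ _ _)) (ht _ _ _ _)

namespace SteinerKronecker

/-- A perfect group has no nontrivial characters; this is what turns relative invariants into
invariants. -/
theorem commutator_groupG (m : ℕ) : commutator (GroupG m) = ⊤ := by
  have h1 : ∀ d : ℕ, commutator (Matrix.SpecialLinearGroup (Fin (d + 2)) ℂ) = ⊤ := fun d =>
    Matrix.SpecialLinearGroup.commutator_eq_top_of_sq_ne_one (a := 2) two_ne_zero (by norm_num)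
  rw [commutator_def, ← Subgroup.top_prod_top, Subgroup.commutator_prod_prod, ← commutator_def,
    ← commutator_def, h1 0, h1 m]

/-- The coordinate ring embeds into the finite-dimensional algebra of functions on the set, so it is
Artinian. Nonemptiness keeps the ring nonzero; otherwise the dimension would be `⊥`. -/
theorem algDim_of_finite {m : ℕ} {S : Set (GroupG m)} (hS : S.Finite) (hne : S.Nonempty) :
    algDim S = 0 := by
  let V := groupCoords '' S
  have hV : Finite V := (hS.image groupCoords).to_subtype
  let f : (MvPolynomial (GroupIndex m) ℂ ⧸ MvPolynomial.vanishingIdeal ℂ V) →ₐ[ℂ] (V → ℂ) :=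
    Ideal.Quotient.liftₐ _ (AlgHom.pi fun x : V => MvPolynomial.aeval x.1)
      fun F hF => funext fun x => hF x.1 x.2
  have hf : Function.Injective f := by
    refine (injective_iff_map_eq_zero f).2 fun F hF => ?_
    obtain ⟨F, rfl⟩ := Ideal.Quotient.mk_surjective F
    exact Ideal.Quotient.eq_zero_iff_mem.2 fun x hx => congrFun hF ⟨x, hx⟩
  have : Module.Finite ℂ (MvPolynomial (GroupIndex m) ℂ ⧸ MvPolynomial.vanishingIdeal ℂ V) :=
    Module.Finite.of_injective f.toLinearMap hf
  have hart : IsArtinianRing (MvPolynomial (GroupIndex m) ℂ ⧸ MvPolynomial.vanishingIdeal ℂ V) :=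
    IsArtinianRing.of_finite ℂ _
  have hnt : Nontrivial (MvPolynomial (GroupIndex m) ℂ ⧸ MvPolynomial.vanishingIdeal ℂ V) := by
    refine Ideal.Quotient.nontrivial_iff.2 fun h => ?_
    obtain ⟨g, hg⟩ := hne
    have h1 : (1 : MvPolynomial (GroupIndex m) ℂ) ∈ MvPolynomial.vanishingIdeal ℂ V :=
      h ▸ Submodule.mem_top
    have := h1 _ ⟨g, hg, rfl⟩
    rw [map_one] at this
    exact one_ne_zero this
  exact ringKrullDimZero_iff_ringKrullDim_eq_zero.1 (isArtinianRing_iff_krullDimLE_zero.1 hart)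

end SteinerKronecker

/-! ### Descent of relations to a fixed field -/

/-- A polynomial relation between all conjugates of `x` yields one over the fixed field. -/
theorem exists_relation_over_fixedField {k K τ : Type} [Field k] [Field K] [Algebra k K]
    (Γ : Subgroup (K ≃ₐ[k] K)) (x : τ → K) (F : MvPolynomial τ K) (hF0 : F ≠ 0)
    (hF : ∀ σ ∈ Γ, MvPolynomial.aeval (fun t => σ (x t)) F = 0) :
    ¬ AlgebraicIndependent (IntermediateField.fixedField Γ) x := by
  classical
  let I : Set (MvPolynomial τ K) :=
    {F | F ≠ 0 ∧ ∀ σ ∈ Γ, MvPolynomial.aeval (fun t => σ (x t)) F = 0}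
  -- Artin's argument: take a common relation of minimal support and scale one coefficient to 1.
  -- Applying σ to the coefficients and subtracting cancels that coefficient, so minimality forces
  -- every coefficient to be fixed.
  obtain ⟨P, hP, hmin⟩ : ∃ P ∈ I, ∀ Q ∈ I, P.support.card ≤ Q.support.card := by
    obtain ⟨P, hP, h⟩ := WellFounded.has_min (measure fun P : MvPolynomial τ K => P.support.card).wf
      I ⟨F, hF0, hF⟩
    exact ⟨P, hP, fun Q hQ => not_lt.1 (h Q hQ)⟩
  obtain ⟨u, hu⟩ := MvPolynomial.support_nonempty.2 hP.1
  have hu' := MvPolynomial.mem_support_iff.1 hu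
  let Q := MvPolynomial.C (P.coeff u)⁻¹ * P
  have hQc : ∀ v, Q.coeff v = (P.coeff u)⁻¹ * P.coeff v := fun v => MvPolynomial.coeff_C_mul _ _ _
  have hQu : Q.coeff u = 1 := by rw [hQc, inv_mul_cancel₀ hu']
  have hQs : Q.support ⊆ P.support := by
    intro v hv
    rw [MvPolynomial.mem_support_iff, hQc] at hv
    exact MvPolynomial.mem_support_iff.2 (right_ne_zero_of_mul hv)
  have hQ : ∀ σ ∈ Γ, MvPolynomial.aeval (fun t => σ (x t)) Q = 0 := fun σ hσ => by
    rw [map_mul, hP.2 σ hσ, mul_zero]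
  have hfix : ∀ σ ∈ Γ, MvPolynomial.map (σ : K →+* K) Q = Q := by
    intro σ hσ
    by_contra hne
    have hR : MvPolynomial.map (σ : K →+* K) Q - Q ∈ I := by
      refine ⟨sub_ne_zero.2 hne, fun τ' hτ' => ?_⟩
      -- Applying σ to the relation for σ⁻¹τ' shows that the conjugated polynomial satisfies the
      -- relation for τ'.
      have h := congrArg σ (hQ (σ⁻¹ * τ') (Γ.mul_mem (Γ.inv_mem hσ) hτ'))
      rw [map_zero] at h
      rw [map_sub, hQ τ' hτ', sub_zero, ← h, MvPolynomial.aeval_def, MvPolynomial.aeval_def,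
        MvPolynomial.eval₂_map, ← RingHom.coe_coe (σ : K ≃ₐ[k] K), MvPolynomial.hom_eval₂]
      congr 1
      funext t
      exact (congrArg (fun ρ : K ≃ₐ[k] K => ρ (x t)) (mul_inv_cancel_left σ τ')).symm
    have hlt : (MvPolynomial.map (σ : K →+* K) Q - Q).support.card < P.support.card := by
      refine Finset.card_lt_card ((Finset.ssubset_iff_of_subset fun v hv => ?_).2 ⟨u, hu, ?_⟩)
      · by_contra hv'
        have : Q.coeff v = 0 := MvPolynomial.notMem_support_iff.1 fun h => hv' (hQs h)
        rw [MvPolynomial.mem_support_iff, MvPolynomial.coeff_sub, MvPolynomial.coeff_map, this] at hv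
        simp at hv
      · rw [MvPolynomial.notMem_support_iff, MvPolynomial.coeff_sub, MvPolynomial.coeff_map, hQu]
        simp
    exact absurd (hmin _ hR) (not_le.2 hlt)
  obtain ⟨Q', hQ'⟩ : ∃ Q' : MvPolynomial τ (IntermediateField.fixedField Γ),
      MvPolynomial.map (algebraMap _ K) Q' = Q := by
    rw [← Set.mem_range, MvPolynomial.mem_range_map_iff_coeffs_subset]
    rintro c hc
    obtain ⟨v, -, rfl⟩ := MvPolynomial.mem_coeffs_iff.1 hc
    refine ⟨⟨Q.coeff v, fun σ => ?_⟩, rfl⟩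
    have := congrArg (MvPolynomial.coeff v) (hfix σ.1 σ.2)
    rwa [MvPolynomial.coeff_map] at this
  intro hind
  have h1 : MvPolynomial.aeval x Q' = 0 := by
    have := hQ 1 Γ.one_mem
    rw [← hQ', MvPolynomial.aeval_map_algebraMap] at this
    exact this
  have h2 : Q' = 0 := (injective_iff_map_eq_zero _).1 hind Q' h1
  rw [← hQ', h2, map_zero, MvPolynomial.coeff_zero] at hQu
  exact zero_ne_one hQu


/-! ### Invariant functions: lower bound for the transcendence degree -/

namespace SteinerKronecker

open scoped Kronecker

/-- The ring of polynomial functions on `Hom(W, I ⊗ V)`. -/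
abbrev PolyRing (n m : ℕ) : Type := MvPolynomial (HomIndex n m) ℂ

/-- The tautological point of `Hom(W, I ⊗ V)` with values in its coordinate ring. -/
noncomputable def coordMatrix (n m : ℕ) :
    Matrix (Fin 2 × Fin (n + 1)) (Fin (m + 2)) (PolyRing n m) :=
  Matrix.of fun r j => MvPolynomial.X (r, j)

variable {n m : ℕ}

/-- Two polynomial functions with the same values are equal. -/
theorem eq_of_polyEval_eq {f f' : PolyRing n m} (h : ∀ A : HomSpace n m, polyEval A f = polyEval A f') :
    f = f' :=
  MvPolynomial.funext fun x => h (Matrix.of fun r j => x (r, j))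

/-- `(P ⊗ id_V) ∘ A ∘ Q` over an arbitrary ring. -/
def matrixAct {R : Type} [CommRing R] (P : Matrix (Fin 2) (Fin 2) R)
    (A : Matrix (Fin 2 × Fin (n + 1)) (Fin (m + 2)) R) (Q : Matrix (Fin (m + 2)) (Fin (m + 2)) R) :
    Matrix (Fin 2 × Fin (n + 1)) (Fin (m + 2)) R :=
  (P ⊗ₖ (1 : Matrix (Fin (n + 1)) (Fin (n + 1)) R)) * A * Q

theorem matrixAct_map {R R' : Type} [CommRing R] [CommRing R'] (φ : R →+* R')
    (P : Matrix (Fin 2) (Fin 2) R) (A : Matrix (Fin 2 × Fin (n + 1)) (Fin (m + 2)) R)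
    (Q : Matrix (Fin (m + 2)) (Fin (m + 2)) R) :
    (matrixAct P A Q).map φ = matrixAct (P.map φ) (A.map φ) (Q.map φ) := by
  rw [matrixAct, Matrix.map_mul, Matrix.map_mul, matrixAct]
  congr 2
  ext i j
  simp [Matrix.one_apply, apply_ite φ]

theorem smul_eq_matrixAct (g : GroupG m) (A : HomSpace n m) :
    g • A = matrixAct g.1.1 A (g.2⁻¹).1 := rfl

/-- Composition of polynomial functions with the action of `g`. -/
noncomputable def actHom (g : GroupG m) : PolyRing n m →ₐ[ℂ] PolyRing n m :=
  MvPolynomial.aeval fun p => matrixAct (g.1.1.map MvPolynomial.C) (coordMatrix n m)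
    ((g.2⁻¹).1.map MvPolynomial.C) p.1 p.2

theorem polyEval_actHom (g : GroupG m) (A : HomSpace n m) (f : PolyRing n m) :
    polyEval A (actHom g f) = polyEval (g • A) f := by
  have h : (polyEval A).comp (actHom g) = polyEval (g • A) := by
    refine MvPolynomial.algHom_ext fun p => ?_
    have h1 := matrixAct_map (polyEval A : PolyRing n m →+* ℂ) (g.1.1.map MvPolynomial.C)
      (coordMatrix n m) ((g.2⁻¹).1.map MvPolynomial.C)
    have h2 : ∀ {d : ℕ} (B : Matrix (Fin d) (Fin d) ℂ),
        (B.map MvPolynomial.C).map (polyEval A : PolyRing n m →+* ℂ) = B := fun B => by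
      ext i j
      simp [polyEval]
    have h3 : (coordMatrix n m).map (polyEval A : PolyRing n m →+* ℂ) = A := by
      ext i j
      simp [polyEval, coordMatrix]
    rw [h2, h2, h3, ← smul_eq_matrixAct] at h1
    rw [AlgHom.comp_apply, actHom, MvPolynomial.aeval_X, polyEval, polyEval, MvPolynomial.aeval_X,
      ← h1]
    rfl
  exact DFunLike.congr_fun h f

/-- Pulling back functions is contravariant; hence the inverse in `actEquiv`. -/
theorem actHom_comp (g h : GroupG m) :
    (actHom g).comp (actHom h) = actHom (n := n) (h * g) := by
  refine AlgHom.ext fun f => eq_of_polyEval_eq fun A => ?_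
  rw [AlgHom.comp_apply, polyEval_actHom, polyEval_actHom, polyEval_actHom, mul_smul]

theorem actHom_one : actHom (1 : GroupG m) = AlgHom.id ℂ (PolyRing n m) := by
  refine AlgHom.ext fun f => eq_of_polyEval_eq fun A => ?_
  rw [polyEval_actHom, one_smul, AlgHom.id_apply]

theorem mem_invariants_iff {f : PolyRing n m} :
    f ∈ invariants n m ↔ ∀ g : GroupG m, actHom g f = f :=
  ⟨fun hf g => eq_of_polyEval_eq fun A => by rw [polyEval_actHom]; exact hf g A,
    fun h g A => by rw [← polyEval_actHom, h g]⟩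

variable (n m) in
/-- The action of `G` on polynomial functions by automorphisms. -/
noncomputable def actEquiv : GroupG m →* (PolyRing n m ≃ₐ[ℂ] PolyRing n m) where
  toFun g := AlgEquiv.ofAlgHom (actHom g⁻¹) (actHom g)
    (by rw [actHom_comp, mul_inv_cancel, actHom_one]) (by rw [actHom_comp, inv_mul_cancel, actHom_one])
  map_one' := by
    ext1 f
    change actHom (1 : GroupG m)⁻¹ f = f
    rw [inv_one, actHom_one, AlgHom.id_apply]
  map_mul' g h := by
    ext1 f
    change actHom (g * h)⁻¹ f = actHom g⁻¹ (actHom h⁻¹ f)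
    rw [mul_inv_rev, ← actHom_comp, AlgHom.comp_apply]

theorem actEquiv_apply (g : GroupG m) (f : PolyRing n m) : actEquiv n m g f = actHom g⁻¹ f := rfl

theorem mem_invariants_iff_actEquiv {f : PolyRing n m} :
    f ∈ invariants n m ↔ ∀ g : GroupG m, actEquiv n m g f = f := by
  rw [mem_invariants_iff]
  exact ⟨fun h g => h g⁻¹, fun h g => by
    have := h g⁻¹
    rwa [actEquiv_apply, inv_inv] at this⟩

open scoped commutatorElement in
/-- Relative invariants of `G` are invariants. -/
theorem mem_invariants_of_associated {f : PolyRing n m}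
    (h : ∀ g : GroupG m, Associated f (actEquiv n m g f)) : f ∈ invariants n m := by
  have hc : ∀ g : GroupG m, ∃ c : ℂ, actEquiv n m g f = MvPolynomial.C c * f := by
    intro g
    obtain ⟨u, hu⟩ := h g
    obtain ⟨c, -, hc⟩ := (MvPolynomial.isUnit_iff_eq_C_of_isReduced).1 u.isUnit
    exact ⟨c, by rw [← hu, hc, mul_comm]⟩
  let H : Subgroup (GroupG m) :=
    { carrier := {g | actEquiv n m g f = f}
      one_mem' := by rw [Set.mem_ofPred_eq, map_one]; rfl
      mul_mem' := fun {g g'} hg hg' => by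
        rw [Set.mem_ofPred_eq] at hg hg' ⊢
        rw [map_mul, AlgEquiv.mul_apply, hg', hg]
      inv_mem' := fun {g} hg => by
        rw [Set.mem_ofPred_eq] at hg ⊢
        conv_lhs => rw [← hg, ← AlgEquiv.mul_apply, ← map_mul, inv_mul_cancel, map_one]
        rfl }
  -- Each g multiplies f by a scalar, and scalars commute, so commutators fix f.
  have hH : commutator (GroupG m) ≤ H := by
    rw [commutator_def, Subgroup.commutator_le]
    rintro g - g' -
    obtain ⟨c, hc₁⟩ := hc g
    obtain ⟨d, hd₁⟩ := hc g'
    change actEquiv n m ⁅g, g'⁆ f = f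
    have e : ∀ (k : GroupG m) (a : ℂ), actEquiv n m k (MvPolynomial.C a * f) =
        MvPolynomial.C a * actEquiv n m k f := fun k a => by
      rw [← MvPolynomial.algebraMap_eq, map_mul, AlgEquiv.commutes]
    have h1 : actEquiv n m (g * g') f = actEquiv n m (g' * g) f := by
      rw [map_mul, map_mul, AlgEquiv.mul_apply, AlgEquiv.mul_apply, hd₁, hc₁, e, e, hc₁, hd₁]
      ring
    have h2 : ⁅g, g'⁆ = (g * g') * (g' * g)⁻¹ := by
      rw [commutatorElement_def, mul_inv_rev]
      group
    obtain ⟨a, ha⟩ := hc (g' * g)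
    obtain ⟨b, hb⟩ := hc (g' * g)⁻¹
    have h3 : actEquiv n m (g' * g)⁻¹ (actEquiv n m (g' * g) f) = f := by
      rw [← AlgEquiv.mul_apply, ← map_mul, inv_mul_cancel, map_one]
      rfl
    rw [ha, e, hb] at h3
    rw [h2, map_mul, AlgEquiv.mul_apply, hb, e, h1, ha]
    conv_rhs => rw [← h3]
    ring
  rw [mem_invariants_iff_actEquiv]
  intro g
  exact hH (commutator_groupG m ▸ Subgroup.mem_top g)

variable (n m) in
/-- The field of rational functions on `Hom(W, I ⊗ V)`. -/
abbrev RatField : Type := FractionRing (PolyRing n m)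

variable (n m) in
/-- The automorphisms of the field of rational functions induced by `G`. -/
noncomputable def fieldAut : GroupG m →* (RatField n m ≃ₐ[ℂ] RatField n m) :=
  (IsFractionRing.fieldEquivOfAlgEquivHom ℂ (RatField n m)).comp (actEquiv n m)

theorem fieldAut_algebraMap (g : GroupG m) (f : PolyRing n m) :
    fieldAut n m g (algebraMap _ _ f) = algebraMap _ (RatField n m) (actEquiv n m g f) := by
  simp [fieldAut]

/-- An invariant rational function is a quotient of invariant polynomials. -/
theorem exists_invariants_of_mem_fixedField {x : RatField n m}
    (hx : x ∈ IntermediateField.fixedField (fieldAut n m).range) :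
    ∃ a b : PolyRing n m, a ∈ invariants n m ∧ b ∈ invariants n m ∧ b ≠ 0 ∧
      x * algebraMap _ _ b = algebraMap _ _ a := by
  let a := IsFractionRing.num (PolyRing n m) x
  let b : PolyRing n m := IsFractionRing.den (PolyRing n m) x
  have hb : b ≠ 0 := nonZeroDivisors.coe_ne_zero _
  have hinj : Function.Injective (algebraMap (PolyRing n m) (RatField n m)) :=
    IsFractionRing.injective _ _
  have hbK : algebraMap _ (RatField n m) b ≠ 0 := fun h => hb (hinj (h.trans (map_zero _).symm))
  have hxab : x * algebraMap _ _ b = algebraMap _ _ a := by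
    have := IsFractionRing.mk'_num_den' (A := PolyRing n m) x
    rw [← this, div_mul_cancel₀ _ hbK]
  have hrel : IsRelPrime a b := IsFractionRing.num_den_reduced _ x
  -- Invariance of x = a/b, with denominators cleared. As a and b are coprime, and so are their
  -- transforms, b and its transform divide each other; the same unit then relates a to its
  -- transform.
  have key : ∀ g, actEquiv n m g a * b = a * actEquiv n m g b := by
    intro g
    have h1 : fieldAut n m g x = x := hx ⟨fieldAut n m g, g, rfl⟩
    have h2 := congrArg (fieldAut n m g) hxab
    rw [map_mul, h1, fieldAut_algebraMap, fieldAut_algebraMap] at h2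
    apply hinj
    rw [map_mul, map_mul, ← h2, ← hxab]
    ring
  have hrel' : ∀ g, IsRelPrime (actEquiv n m g a) (actEquiv n m g b) := by
    intro g d h1 h2
    have e : d = actEquiv n m g ((actEquiv n m g).symm d) := by simp
    rw [e] at h1 h2 ⊢
    rw [map_dvd_iff] at h1 h2
    exact (hrel h1 h2).map _
  have hba : ∀ g, Associated b (actEquiv n m g b) := fun g => by
    refine associated_of_dvd_dvd ?_ ?_
    · exact hrel.symm.dvd_of_dvd_mul_left ⟨_, (key g).symm.trans (mul_comm _ _)⟩
    · exact (hrel' g).symm.dvd_of_dvd_mul_left ⟨_, (key g).trans (mul_comm _ _)⟩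
  have haa : ∀ g, Associated a (actEquiv n m g a) := fun g => by
    obtain ⟨u, hu⟩ := hba g
    refine ⟨u, ?_⟩
    have := key g
    rw [← hu] at this
    exact mul_right_cancel₀ hb (by rw [this]; ring)
  exact ⟨a, b, mem_invariants_of_associated haa, mem_invariants_of_associated hba, hb, hxab⟩

/-- More than `dim G` coordinates are algebraically dependent over the invariant field. -/
theorem not_algebraicIndependent_fixedField {τ : Type} [Fintype τ] (x : τ → HomIndex n m)
    (hτ : (m + 2) ^ 2 + 2 < Fintype.card τ) :
    ¬ AlgebraicIndependent (IntermediateField.fixedField (fieldAut n m).range)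
      (fun t => algebraMap _ (RatField n m) (MvPolynomial.X (x t) : PolyRing n m)) := by
  let K := RatField n m
  let P : Matrix (Fin 2) (Fin 2) (MvPolynomial (GroupIndex m) K) :=
    Matrix.of fun i j => MvPolynomial.X (Sum.inl (i, j))
  let Q : Matrix (Fin (m + 2)) (Fin (m + 2)) (MvPolynomial (GroupIndex m) K) :=
    Matrix.of fun i j => MvPolynomial.X (Sum.inr (i, j))
  let X : Matrix (Fin 2 × Fin (n + 1)) (Fin (m + 2)) K :=
    Matrix.of fun r j => algebraMap _ K (MvPolynomial.X (r, j) : PolyRing n m)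
  -- The orbit of the tautological matrix under a variable group element. The adjugate replaces the
  -- inverse, with which it agrees in determinant one, so that the entries are polynomials in the
  -- group coordinates.
  let M := matrixAct P (X.map MvPolynomial.C) Q.adjugate
  obtain ⟨F, hF0, hF⟩ := exists_relation_on_group (K := K) hτ fun t => M (x t).1 (x t).2
  refine exists_relation_over_fixedField _ _ F hF0 ?_
  rintro _ ⟨g, rfl⟩
  -- The automorphism attached to g is pullback along g⁻¹, so the relation is used at that group
  -- element.
  rw [← hF g⁻¹]
  congr 2
  funext t
  let ev : MvPolynomial (GroupIndex m) K →ₐ[K] K :=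
    MvPolynomial.aeval fun i => algebraMap ℂ K (groupCoords g⁻¹ i)
  have h1 := matrixAct_map (ev : MvPolynomial (GroupIndex m) K →+* K) P (X.map MvPolynomial.C)
    Q.adjugate
  have h2 := matrixAct_map (algebraMap (PolyRing n m) K) ((g⁻¹).1.1.map MvPolynomial.C)
    (coordMatrix n m) (((g⁻¹).2⁻¹).1.map MvPolynomial.C)
  have h3 : (matrixAct P (X.map MvPolynomial.C) Q.adjugate).map (ev : _ →+* K) =
      (matrixAct ((g⁻¹).1.1.map MvPolynomial.C) (coordMatrix n m)
        (((g⁻¹).2⁻¹).1.map MvPolynomial.C)).map (algebraMap (PolyRing n m) K) := by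
    have hC : ∀ c : ℂ, algebraMap (PolyRing n m) K (MvPolynomial.C c) = algebraMap ℂ K c :=
      fun c => (IsScalarTower.algebraMap_apply ℂ (PolyRing n m) K c).symm
    rw [h1, h2]
    congr 1
    · ext i j
      simp only [P, ev, Matrix.map_apply, Matrix.of_apply, RingHom.coe_coe, MvPolynomial.aeval_X, hC]
      rfl
    · ext i j
      simp [X, ev, coordMatrix]
    · rw [← RingHom.mapMatrix_apply, RingHom.map_adjugate, Matrix.SpecialLinearGroup.coe_inv,
        ← RingHom.mapMatrix_apply, ← RingHom.mapMatrix_apply, RingHom.map_adjugate,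
        RingHom.map_adjugate]
      congr 1
      ext i j
      simp only [Q, ev, Matrix.map_apply, Matrix.of_apply, RingHom.coe_coe, MvPolynomial.aeval_X, hC,
        RingHom.mapMatrix_apply]
      rfl
  have h4 := congrFun (congrFun h3 (x t).1) (x t).2
  change fieldAut n m g _ = _
  rw [fieldAut_algebraMap, actEquiv_apply, actHom, MvPolynomial.aeval_X]
  exact h4.symm

/-- An element a/b of K₀ is a root of the linear polynomial bX - a, so K₀ is algebraic over R, and
independence survives algebraic extension of scalars. -/
theorem algebraicIndependent_intermediateField_of_fraction {k R K τ : Type} [Field k] [CommRing R]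
    [Field K] [Algebra k K] [Algebra R K] (K₀ : IntermediateField k K)
    (hmem : ∀ r : R, algebraMap R K r ∈ K₀)
    (hfrac : ∀ x ∈ K₀, ∃ a b : R, b ≠ 0 ∧ x * algebraMap R K b = algebraMap R K a)
    {x : τ → K} (hx : AlgebraicIndependent R x) : AlgebraicIndependent K₀ x := by
  let φ : R →+* K₀ := (algebraMap R K).codRestrict K₀ hmem
  let _ : Algebra R K₀ := φ.toAlgebra
  have : IsScalarTower R K₀ K := .of_algebraMap_eq fun _ => rfl
  have halg : Algebra.IsAlgebraic R K₀ := by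
    refine ⟨fun x => ?_⟩
    obtain ⟨a, b, hb0, h⟩ := hfrac x.1 x.2
    refine ⟨Polynomial.C b * Polynomial.X - Polynomial.C a, fun h0 => hb0 ?_, ?_⟩
    · have := congrArg (fun p => Polynomial.coeff p 1) h0
      simpa only [Polynomial.coeff_sub, Polynomial.coeff_C_mul, Polynomial.coeff_X_one, mul_one,
        Polynomial.coeff_C_succ, sub_zero, Polynomial.coeff_zero] using this
    · simp only [map_sub, map_mul, Polynomial.aeval_C, Polynomial.aeval_X]
      refine Subtype.ext ?_
      change algebraMap _ K b * x.1 - algebraMap _ K a = 0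
      rw [← h]
      ring
  exact hx.extendScalars K₀

/-- A transcendence basis over the invariants can be chosen among the coordinates. It stays
independent over the field of invariant rational functions, whose elements are fractions of
invariants, so it has at most dim G members. -/
theorem trdeg_invariants_polyRing_le :
    Algebra.trdeg (invariants n m) (PolyRing n m) ≤ ((m + 2) ^ 2 + 2 : ℕ) := by
  let K := RatField n m
  let K₀ := IntermediateField.fixedField (fieldAut n m).range
  have hmem : ∀ f : invariants n m, algebraMap (PolyRing n m) K f.1 ∈ K₀ := by
    rintro ⟨f, hf⟩ ⟨_, g, rfl⟩
    change fieldAut n m g _ = _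
    rw [fieldAut_algebraMap, mem_invariants_iff_actEquiv.1 hf g]
  have htop : Algebra.adjoin (invariants n m) (Set.range (MvPolynomial.X : _ → PolyRing n m)) = ⊤ := by
    rw [eq_top_iff]
    intro f _
    have : f ∈ Algebra.adjoin ℂ (Set.range (MvPolynomial.X : _ → PolyRing n m)) := by
      rw [MvPolynomial.adjoin_range_X]
      exact Algebra.mem_top
    induction this using Algebra.adjoin_induction with
    | mem x hx => exact Algebra.subset_adjoin hx
    | algebraMap c => exact Subalgebra.algebraMap_mem _ (algebraMap ℂ (invariants n m) c)
    | add x y _ _ hx hy => exact add_mem (hx trivial) (hy trivial)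
    | mul x y _ _ hx hy => exact mul_mem (hx trivial) (hy trivial)
  have halg' : Algebra.IsAlgebraic (Algebra.adjoin (invariants n m)
      (Set.range (MvPolynomial.X : _ → PolyRing n m))) (PolyRing n m) := by
    refine ⟨fun x => ?_⟩
    exact isAlgebraic_algebraMap (⟨x, htop ▸ Algebra.mem_top⟩ : Algebra.adjoin (invariants n m)
      (Set.range (MvPolynomial.X : _ → PolyRing n m)))
  obtain ⟨t, ht, hb⟩ := isAlgebraic_iff_exists_isTranscendenceBasis_subset.1 halg'
  have hfin : Finite t := (Set.finite_range _).subset ht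
  have : Fintype t := Fintype.ofFinite t
  choose x hx using fun s : t => ht s.2
  have hind : AlgebraicIndependent (invariants n m) (fun s : t => algebraMap (PolyRing n m) K s.1) :=
    hb.1.map' (f := IsScalarTower.toAlgHom (invariants n m) (PolyRing n m) K)
      (IsFractionRing.injective _ _)
  have hind' := algebraicIndependent_intermediateField_of_fraction K₀ hmem (fun x hx => by
    obtain ⟨a, b, ha, hb, hb0, h⟩ := exists_invariants_of_mem_fixedField hx
    exact ⟨⟨a, ha⟩, ⟨b, hb⟩, fun h => hb0 (congrArg Subtype.val h), h⟩) hind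
  have hcard := mt (not_algebraicIndependent_fixedField x) (not_not.2 (by
    simp only [hx]
    exact hind'))
  rw [← hb.cardinalMk_eq_trdeg, Cardinal.mk_fintype, Nat.cast_le]
  exact not_lt.1 hcard

/-- The transcendence degree of the invariants is at least `dim Hom(W, I ⊗ V) - dim G`. -/
theorem le_trdeg_invariants :
    ((2 * (n + 1) * (m + 2) : ℕ) : Cardinal) ≤
      Algebra.trdeg ℂ (invariants n m) + ((m + 2) ^ 2 + 2 : ℕ) := by
  have : FaithfulSMul ℂ (invariants n m) :=
    (faithfulSMul_iff_algebraMap_injective _ _).2 (RingHom.injective _)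
  have : FaithfulSMul (invariants n m) (PolyRing n m) :=
    (faithfulSMul_iff_algebraMap_injective _ _).2 Subtype.val_injective
  have h := trdeg_add_eq ℂ (invariants n m) (A := PolyRing n m)
  rw [MvPolynomial.trdeg_of_isDomain, Cardinal.lift_id, Cardinal.mk_fintype] at h
  simp only [Fintype.card_prod, Fintype.card_fin] at h
  rw [← h]
  gcongr
  exact trdeg_invariants_polyRing_le

end SteinerKronecker


/-! ### Derivations and Jacobian criteria -/

/-- Algebraic elements over constants of a derivation are constants. -/
theorem Derivation.eq_zero_of_isAlgebraic {k B S K : Type*} [CommRing k] [CommRing B] [IsDomain B]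
    [CharZero B] [CommRing S] [Field K] [Algebra k S] [Algebra B S] [Algebra S K] [Algebra k K]
    [IsScalarTower k S K]
    (hB : Function.Injective (algebraMap B S)) (hK : Function.Injective (algebraMap S K))
    (D : Derivation k S K) (hD : ∀ b : B, D (algebraMap B S b) = 0) {s : S}
    (hs : IsAlgebraic B s) : D s = 0 := by
  have hder : ∀ p : Polynomial B, D (Polynomial.aeval s p) =
      algebraMap S K (Polynomial.aeval s (Polynomial.derivative p)) * D s := by
    intro p
    induction p using Polynomial.induction_on' with
    | add p q hp hq => simp only [map_add, hp, hq, add_mul]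
    | monomial i b =>
      rw [Polynomial.derivative_monomial, Polynomial.aeval_monomial, Polynomial.aeval_monomial,
        Derivation.leibniz, hD, smul_zero, add_zero, Derivation.leibniz_pow]
      have e : ((i : ℕ) • (s ^ (i - 1) • D s) : K) = (i : K) * (s ^ (i - 1) • D s) := nsmul_eq_mul _ _
      have e' : algebraMap S K (algebraMap B S (i : B)) = (i : K) := by
        rw [_root_.map_natCast, _root_.map_natCast]
      rw [e]
      simp only [Algebra.smul_def, map_mul, map_pow, e']
      ring
  classical
  -- For a relation p of minimal degree, 0 = D(p(s)) = p'(s) D(s), and p'(s) ≠ 0 by minimality in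
  -- characteristic zero.
  have hex : ∃ d : ℕ, ∃ p : Polynomial B, p ≠ 0 ∧ Polynomial.aeval s p = 0 ∧ p.natDegree = d := by
    obtain ⟨p, hp0, hp⟩ := hs
    exact ⟨_, p, hp0, hp, rfl⟩
  obtain ⟨p, hp0, hp, hpd⟩ := Nat.find_spec hex
  have hd : p.natDegree ≠ 0 := by
    intro h0
    rw [Polynomial.eq_C_of_natDegree_eq_zero h0, Polynomial.aeval_C] at hp
    have := hB (hp.trans (map_zero _).symm)
    exact hp0 (by rw [Polynomial.eq_C_of_natDegree_eq_zero h0, this, Polynomial.C_0])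
  have hlt : (Polynomial.derivative p).natDegree < p.natDegree :=
    Polynomial.natDegree_derivative_lt hd
  have hp' : Polynomial.derivative p ≠ 0 := fun h =>
    hd (Polynomial.derivative_eq_zero.1 h)
  have hne : Polynomial.aeval s (Polynomial.derivative p) ≠ 0 := fun h =>
    Nat.find_min hex (hpd ▸ hlt) ⟨_, hp', h, rfl⟩
  have := hder p
  rw [hp, map_zero] at this
  rcases mul_eq_zero.1 this.symm with h | h
  · exact absurd (hK (h.trans (map_zero _).symm)) hne
  · exact h

/-- A derivation which vanishes on a transcendence basis over constants is zero. -/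
theorem Derivation.eq_zero_of_isTranscendenceBasis {k A S K ι : Type*} [Field k] [CharZero k]
    [CommRing A] [Nontrivial A] [CommRing S] [IsDomain S] [Field K] [Algebra k A] [Algebra k S] [Algebra A S]
    [IsScalarTower k A S] [Algebra S K] [Algebra k K] [IsScalarTower k S K]
    (hK : Function.Injective (algebraMap S K)) {x : ι → S} (hx : IsTranscendenceBasis A x)
    (D : Derivation k S K) (hA : ∀ a : A, D (algebraMap A S a) = 0) (hD : ∀ i, D (x i) = 0) :
    D = 0 := by
  ext s
  have hB : ∀ b ∈ Algebra.adjoin A (Set.range x), D b = 0 := by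
    intro b hb
    induction hb using Algebra.adjoin_induction with
    | mem x hx =>
      obtain ⟨i, rfl⟩ := hx
      exact hD i
    | algebraMap a => exact hA a
    | add x y _ _ hx hy => rw [map_add, hx, hy, add_zero]
    | mul x y _ _ hx hy => rw [Derivation.leibniz, hx, hy, smul_zero, smul_zero, add_zero]
  have : CharZero S := charZero_of_injective_algebraMap (algebraMap k S).injective
  have : CharZero (Algebra.adjoin A (Set.range x)) :=
    ⟨fun a b h => Nat.cast_injective (R := S) (by simpa using congrArg Subtype.val h)⟩
  exact D.eq_zero_of_isAlgebraic (B := Algebra.adjoin A (Set.range x)) Subtype.val_injective hK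
    (fun b => hB b.1 b.2) (hx.isAlgebraic.1 s)

/-- The derivation of a polynomial ring in the direction of a vector field. -/
noncomputable def MvPolynomial.vectorField {k σ K : Type*} [Field k] [CommRing K]
    [Algebra (MvPolynomial σ k) K] [Algebra k K] [IsScalarTower k (MvPolynomial σ k) K] :
    (σ → K) →ₗ[K] Derivation k (MvPolynomial σ k) K where
  toFun v := MvPolynomial.mkDerivation k v
  map_add' v w := by
    ext i
    simp
  map_smul' c v := by
    ext i
    simp

theorem MvPolynomial.mkDerivation_eq_sum {k σ K : Type*} [Field k] [CommRing K] [Fintype σ]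
    [Algebra (MvPolynomial σ k) K] [Algebra k K] [IsScalarTower k (MvPolynomial σ k) K] (v : σ → K)
    (f : MvPolynomial σ k) : MvPolynomial.mkDerivation k v f =
      ∑ s, v s * algebraMap (MvPolynomial σ k) K (MvPolynomial.pderiv s f) := by
  classical
  induction f using MvPolynomial.induction_on with
  | C a => simp
  | add F G hF hG => simp only [map_add, hF, hG, mul_add, Finset.sum_add_distrib]
  | mul_X F j hF =>
    simp only [Derivation.leibniz, hF, MvPolynomial.mkDerivation_X, MvPolynomial.pderiv_X,
      Algebra.smul_def, Algebra.algebraMap_self, RingHom.id_apply, map_add, map_mul, mul_add, Finset.sum_add_distrib,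
      Finset.mul_sum]
    congr 1
    · rw [Finset.sum_eq_single j]
      · simp [mul_comm]
      · intro i _ hij
        simp [Pi.single_eq_of_ne hij.symm]
      · simp
    · exact Finset.sum_congr rfl fun i _ => by ring

/-- Jacobian bound: linearly independent vector fields which annihilate a subalgebra `A` of a polynomial
ring bound the transcendence degree of `A`. -/
theorem MvPolynomial.finrank_add_trdeg_le {k σ A K : Type} [Field k] [CharZero k] [Fintype σ]
    [CommRing A] [IsDomain A] [Algebra k A] [Algebra A (MvPolynomial σ k)]
    [IsScalarTower k A (MvPolynomial σ k)] [Field K]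
    [Algebra (MvPolynomial σ k) K] [Algebra k K] [IsScalarTower k (MvPolynomial σ k) K]
    (hA : Function.Injective (algebraMap A (MvPolynomial σ k)))
    (hK : Function.Injective (algebraMap (MvPolynomial σ k) K))
    (V : Submodule K (σ → K))
    (hV : ∀ v ∈ V, ∀ a : A, MvPolynomial.mkDerivation k v (algebraMap A (MvPolynomial σ k) a) = 0) :
    (Module.finrank K V : Cardinal) + Algebra.trdeg k A ≤ (Fintype.card σ : ℕ) := by
  let S := MvPolynomial σ k
  have : FaithfulSMul A S := (faithfulSMul_iff_algebraMap_injective _ _).2 hA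
  have : FaithfulSMul k A := (faithfulSMul_iff_algebraMap_injective _ _).2 (RingHom.injective _)
  have h := trdeg_add_eq k A (A := S)
  rw [MvPolynomial.trdeg_of_isDomain, Cardinal.lift_id, Cardinal.mk_fintype] at h
  obtain ⟨t, ht⟩ := exists_isTranscendenceBasis A S
  have htr := ht.cardinalMk_eq_trdeg
  have hfin : Finite t := by
    rw [← Cardinal.lt_aleph0_iff_finite, htr]
    refine lt_of_le_of_lt ?_ (Cardinal.natCast_lt_aleph0 (n := Fintype.card σ))
    rw [← h]
    exact self_le_add_left _ _
  have : Fintype t := Fintype.ofFinite t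
  -- A vector field in V is determined by its values on a transcendence basis t of the polynomial
  -- ring over A, hence dim V ≤ |t|; additivity of transcendence degree concludes.
  let Φ : V →ₗ[K] (t → K) :=
    { toFun := fun v i => MvPolynomial.mkDerivation k v.1 (i : S)
      map_add' := fun v w => by
        funext i
        exact DFunLike.congr_fun (map_add MvPolynomial.vectorField v.1 w.1) (i : S)
      map_smul' := fun c v => by
        funext i
        exact DFunLike.congr_fun (map_smul MvPolynomial.vectorField c v.1) (i : S) }
  have hΦ : Function.Injective Φ := by
    rw [injective_iff_map_eq_zero]
    intro v hv
    have h0 := Derivation.eq_zero_of_isTranscendenceBasis hK ht (MvPolynomial.mkDerivation k v.1)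
      (hV v.1 v.2) (fun i => congrFun hv i)
    refine Subtype.ext (_root_.funext fun s => ?_)
    have := DFunLike.congr_fun h0 (MvPolynomial.X s)
    rwa [MvPolynomial.mkDerivation_X] at this
  have hle := LinearMap.finrank_le_finrank_of_injective hΦ
  rw [Module.finrank_fintype_fun_eq_card] at hle
  rw [← h, add_comm, ← htr, Cardinal.mk_fintype]
  gcongr

theorem MvPolynomial.totalDegree_pderiv_lt {k ι : Type*} [CommSemiring k] (F : MvPolynomial ι k) (i : ι)
    (hF : F.totalDegree ≠ 0) : (MvPolynomial.pderiv i F).totalDegree < F.totalDegree := by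
  rw [MvPolynomial.totalDegree, Finset.sup_lt_iff (Nat.pos_of_ne_zero hF)]
  intro u hu
  rw [MvPolynomial.mem_support_iff, MvPolynomial.coeff_pderiv] at hu
  have h : u + Finsupp.single i 1 ∈ F.support :=
    MvPolynomial.mem_support_iff.2 (left_ne_zero_of_mul hu)
  have := MvPolynomial.le_totalDegree h
  rw [Finsupp.sum_add_index' (fun _ => rfl) (fun _ _ _ => rfl), Finsupp.sum_single_index rfl] at this
  omega

/-- Polynomials whose Jacobian matrix at some point is the identity are algebraically independent. -/
theorem MvPolynomial.algebraicIndependent_of_pderiv {k ι : Type*} [Field k] [CharZero k] [Fintype ι]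
    [DecidableEq ι] (g : ι → MvPolynomial ι k) (p : ι → k)
    (h : ∀ i l, MvPolynomial.eval p (MvPolynomial.pderiv l (g i)) = if i = l then 1 else 0) :
    AlgebraicIndependent k g := by
  let J : Matrix ι ι (MvPolynomial ι k) := Matrix.of fun i l => MvPolynomial.pderiv l (g i)
  have hJ : J.det ≠ 0 := by
    intro h0
    have h1 : (J.map (MvPolynomial.eval p)).det = 0 := by
      rw [← RingHom.mapMatrix_apply, ← RingHom.map_det, h0, map_zero]
    have h2 : J.map (MvPolynomial.eval p) = 1 := by
      ext i l
      exact (h i l).trans (Matrix.one_apply ..).symm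
    rw [h2, Matrix.det_one] at h1
    exact one_ne_zero h1
  have hchain : ∀ (F : MvPolynomial ι k) (l : ι), MvPolynomial.pderiv l (MvPolynomial.aeval g F) =
      ∑ i, MvPolynomial.aeval g (MvPolynomial.pderiv i F) * MvPolynomial.pderiv l (g i) := by
    intro F l
    induction F using MvPolynomial.induction_on with
    | C a => simp
    | add F G hF hG => simp only [map_add, hF, hG, add_mul, Finset.sum_add_distrib]
    | mul_X F j hF =>
      simp only [map_mul, MvPolynomial.pderiv_mul, hF, MvPolynomial.aeval_X, map_add, add_mul,
        Finset.sum_add_distrib, MvPolynomial.pderiv_X]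
      congr 1
      · rw [Finset.sum_mul]
        exact Finset.sum_congr rfl fun i _ => by ring
      · rw [Finset.sum_eq_single j]
        · simp
        · intro i _ hij
          simp [Pi.single_eq_of_ne hij.symm]
        · simp
  classical
  rw [algebraicIndependent_iff]
  by_contra hcon
  push Not at hcon
  -- For a relation F of minimal degree, the chain rule says that the vector of all (∂ᵢF)(g) is
  -- annihilated by the Jacobian matrix, whose determinant is nonzero. By minimality every ∂ᵢF
  -- vanishes, so F is constant.
  have hex : ∃ d, ∃ F : MvPolynomial ι k, MvPolynomial.aeval g F = 0 ∧ F ≠ 0 ∧ F.totalDegree = d := by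
    obtain ⟨F, hF, hF0⟩ := hcon
    exact ⟨_, F, hF, hF0, rfl⟩
  obtain ⟨F, hF, hF0, hd⟩ := Nat.find_spec hex
  have hdeg : F.totalDegree ≠ 0 := by
    intro h0
    rw [MvPolynomial.totalDegree_eq_zero_iff_eq_C] at h0
    rw [h0, MvPolynomial.aeval_C] at hF
    have := (algebraMap k (MvPolynomial ι k)).injective (hF.trans (map_zero _).symm)
    exact hF0 (by rw [h0, this, map_zero])
  have hz : ∀ i, MvPolynomial.pderiv i F = 0 := by
    have h1 : (fun i => MvPolynomial.aeval g (MvPolynomial.pderiv i F)) = 0 := by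
      refine Matrix.eq_zero_of_vecMul_eq_zero hJ ?_
      funext l
      have := hchain F l
      rw [hF, map_zero] at this
      exact this.symm
    intro i
    by_contra hne
    exact Nat.find_min hex (hd ▸ MvPolynomial.totalDegree_pderiv_lt F i hdeg)
      ⟨_, congrFun h1 i, hne, rfl⟩
  refine hdeg ?_
  rw [MvPolynomial.totalDegree_eq_zero_iff]
  intro u hu i
  by_contra hi
  have h1 := MvPolynomial.coeff_pderiv (i := i) F (u - Finsupp.single i 1)
  have h2 : u - Finsupp.single i 1 + Finsupp.single i 1 = u := by
    refine tsub_add_cancel_of_le ?_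
    rw [Finsupp.single_le_iff]
    omega
  rw [hz, h2, MvPolynomial.coeff_zero] at h1
  refine MvPolynomial.mem_support_iff.1 hu ((mul_eq_zero.1 h1.symm).resolve_right ?_)
  exact Nat.cast_add_one_ne_zero _

/-- Vectors of polynomials which are linearly independent at a point are linearly independent. -/
theorem MvPolynomial.linearIndependent_of_eval {k σ τ ι K : Type*} [Field k] [Fintype τ] [Fintype ι]
    [Field K] [Algebra (MvPolynomial σ k) K]
    (hK : Function.Injective (algebraMap (MvPolynomial σ k) K)) (w : ι → τ → MvPolynomial σ k)
    (p : σ → k) (h : LinearIndependent k fun i s => MvPolynomial.eval p (w i s)) :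
    LinearIndependent K fun i s => algebraMap (MvPolynomial σ k) K (w i s) := by
  classical
  let W : Matrix ι τ k := Matrix.of fun i s => MvPolynomial.eval p (w i s)
  -- A right inverse of the matrix at p. The product of the polynomial matrix with it has
  -- determinant 1 at p, hence nonzero determinant over K.
  obtain ⟨B, hB⟩ : ∃ B : Matrix τ ι k, W * B = 1 := by
    have h1 : Function.Injective (Matrix.vecMulLinear W) :=
      Matrix.vecMul_injective_iff.2 h
    obtain ⟨φ, hφ⟩ := LinearMap.exists_leftInverse_of_injective _ (LinearMap.ker_eq_bot.2 h1)
    refine ⟨Matrix.of fun s j => φ (Pi.single s 1) j, ?_⟩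
    ext i j
    have h2 := congrFun (LinearMap.congr_fun hφ (Pi.single i 1)) j
    have h3 : Matrix.vecMulLinear W (Pi.single i 1) = ∑ s, W i s • Pi.single s (1 : k) := by
      funext s
      simp [Finset.sum_apply, Pi.single_apply]
    rw [LinearMap.comp_apply, h3, map_sum, Finset.sum_apply] at h2
    simp only [map_smul, Pi.smul_apply, smul_eq_mul, LinearMap.id_apply] at h2
    rw [Matrix.mul_apply, Matrix.one_apply]
    simp only [Matrix.of_apply]
    rw [h2, Pi.single_apply]
    simp only [eq_comm]
  let M : Matrix ι ι (MvPolynomial σ k) :=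
    (Matrix.of w) * B.map MvPolynomial.C
  have hM : M.det ≠ 0 := by
    intro h0
    have h1 : (M.map (MvPolynomial.eval p)).det = 0 := by
      rw [← RingHom.mapMatrix_apply, ← RingHom.map_det, h0, map_zero]
    have h2 : M.map (MvPolynomial.eval p) = W * B := by
      refine Matrix.map_mul.trans ?_
      congr 1
      ext i j
      simp
    rw [h2, hB, Matrix.det_one] at h1
    exact one_ne_zero h1
  have hMK : (M.map (algebraMap (MvPolynomial σ k) K)).det ≠ 0 := by
    rw [← RingHom.mapMatrix_apply, ← RingHom.map_det]
    exact fun h0 => hM (hK (h0.trans (map_zero _).symm))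
  rw [Fintype.linearIndependent_iff]
  intro c hc
  refine congrFun (Matrix.eq_zero_of_vecMul_eq_zero hMK ?_)
  refine (congrArg _ Matrix.map_mul).trans ?_
  rw [← Matrix.vecMul_vecMul]
  have : Matrix.vecMul c ((Matrix.of w).map (algebraMap (MvPolynomial σ k) K)) = 0 := by
    rw [← hc]
    funext s
    simp [Matrix.vecMul, dotProduct, Finset.sum_apply]
  rw [this, Matrix.zero_vecMul]

/-- The differential of algebraically independent polynomials is surjective at general points. -/
theorem MvPolynomial.exists_surjective_differential {k σ ι : Type} [Field k] [CharZero k] [Fintype σ]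
    [Fintype ι] (f : ι → MvPolynomial σ k) (hf : AlgebraicIndependent k f) {h : MvPolynomial σ k}
    (hh : h ≠ 0) : ∃ a : σ → k, MvPolynomial.eval a h ≠ 0 ∧ ∀ y : ι → k, ∃ v : σ → k, ∀ i,
      ∑ s, v s * MvPolynomial.eval a (MvPolynomial.pderiv s (f i)) = y i := by
  classical
  let S := MvPolynomial σ k
  let K := FractionRing S
  have hK : Function.Injective (algebraMap S K) := IsFractionRing.injective _ _
  let J : (σ → K) →ₗ[K] (ι → K) := Matrix.mulVecLin
    (Matrix.of fun i s => algebraMap S K (MvPolynomial.pderiv s (f i)))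
  -- Vector fields in the kernel annihilate the subalgebra generated by the f i, of transcendence
  -- degree |ι|. The kernel thus has dimension at most |σ| - |ι|, and J has full rank.
  have hsurj : Function.Surjective J := by
    let _ : Algebra (MvPolynomial ι k) S := (MvPolynomial.aeval f).toRingHom.toAlgebra
    have : IsScalarTower k (MvPolynomial ι k) S :=
      .of_algebraMap_eq fun x => ((MvPolynomial.aeval f).commutes x).symm
    have h1 := MvPolynomial.finrank_add_trdeg_le (k := k) (σ := σ) (A := MvPolynomial ι k) (K := K)
      hf hK (LinearMap.ker J) (by
        intro v hv F
        have hv' : ∀ i, MvPolynomial.mkDerivation k v (f i) = 0 := by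
          intro i
          rw [MvPolynomial.mkDerivation_eq_sum]
          refine Eq.trans ?_ (congrFun (LinearMap.mem_ker.1 hv) i)
          exact Finset.sum_congr rfl fun s _ => mul_comm _ _
        change MvPolynomial.mkDerivation k v (MvPolynomial.aeval f F) = 0
        induction F using MvPolynomial.induction_on with
        | C a => simp
        | add F G hF hG => rw [map_add, map_add, hF, hG, add_zero]
        | mul_X F j hF =>
          rw [map_mul, Derivation.leibniz, hF, MvPolynomial.aeval_X, hv' j, smul_zero, smul_zero,
            add_zero])
    rw [MvPolynomial.trdeg_of_isDomain, Cardinal.lift_id, Cardinal.mk_fintype, ← Nat.cast_add,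
      Nat.cast_le] at h1
    have h2 := LinearMap.finrank_range_add_finrank_ker J
    rw [Module.finrank_fintype_fun_eq_card] at h2
    rw [← LinearMap.range_eq_top]
    refine Submodule.eq_top_of_finrank_eq (le_antisymm (Submodule.finrank_le _) ?_)
    rw [Module.finrank_fintype_fun_eq_card]
    omega
  choose V hV using fun l : ι => hsurj (Pi.single l 1)
  -- A common denominator of the rational solutions of J V = eₗ; any point where b h does not vanish
  -- will do.
  obtain ⟨b, hb⟩ := IsLocalization.exist_integer_multiples_of_finite (nonZeroDivisors S)
    (fun q : ι × σ => V q.1 q.2)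
  choose w hw using hb
  have hb0 : (b : S) ≠ 0 := nonZeroDivisors.coe_ne_zero b
  have hrel : ∀ i l, ∑ s, w (l, s) * MvPolynomial.pderiv s (f i) = if i = l then (b : S) else 0 := by
    intro i l
    apply hK
    have h1 := congrFun (hV l) i
    rw [map_sum]
    simp only [map_mul, hw]
    rw [Pi.single_apply] at h1
    rw [apply_ite (algebraMap S K), map_zero, ← mul_one (algebraMap S K b), ← mul_ite_zero, ← h1]
    simp only [J, Matrix.mulVecLin_apply, Matrix.mulVec, dotProduct, Matrix.of_apply, Finset.mul_sum,
      Algebra.smul_def]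
    exact Finset.sum_congr rfl fun s _ => by ring
  obtain ⟨a, ha⟩ : ∃ a : σ → k, MvPolynomial.eval a ((b : S) * h) ≠ 0 := by
    by_contra hcon
    push Not at hcon
    exact mul_ne_zero hb0 hh (MvPolynomial.funext fun x => (hcon x).trans (map_zero _).symm)
  rw [map_mul] at ha
  have hba := left_ne_zero_of_mul ha
  refine ⟨a, right_ne_zero_of_mul ha, fun y => ⟨fun s => ∑ l, y l / MvPolynomial.eval a (b : S) *
    MvPolynomial.eval a (w (l, s)), fun i => ?_⟩⟩
  have h2 : ∀ l, ∑ s, MvPolynomial.eval a (w (l, s)) * MvPolynomial.eval a (MvPolynomial.pderiv s (f i)) =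
      if i = l then MvPolynomial.eval a (b : S) else 0 := fun l => by
    have := congrArg (MvPolynomial.eval a) (hrel i l)
    simpa only [map_sum, map_mul, apply_ite (MvPolynomial.eval a), map_zero] using this
  calc ∑ s, (∑ l, y l / MvPolynomial.eval a (b : S) * MvPolynomial.eval a (w (l, s))) *
        MvPolynomial.eval a (MvPolynomial.pderiv s (f i))
      = ∑ l, y l / MvPolynomial.eval a (b : S) * ∑ s, MvPolynomial.eval a (w (l, s)) *
        MvPolynomial.eval a (MvPolynomial.pderiv s (f i)) := by
        simp only [Finset.sum_mul, Finset.mul_sum]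
        rw [Finset.sum_comm]
        exact Finset.sum_congr rfl fun l _ => Finset.sum_congr rfl fun s _ => by ring
    _ = y i := by
        simp only [h2, mul_ite, mul_zero, Finset.sum_ite_eq, Finset.mem_univ, if_true]
        rw [div_mul_cancel₀ _ hba]


/-! ### Invariants and the Lie algebra of G -/

/-- A linear form on matrices which vanishes on traceless rank one matrices vanishes on traceless
matrices. -/
theorem Matrix.eq_zero_of_trace_eq_zero {k d M : Type*} [Field k] [Fintype d] [DecidableEq d]
    [AddCommGroup M] [Module k M] (ℓ : Matrix d d k →ₗ[k] M)
    (h : ∀ u v : d → k, v ⬝ᵥ u = 0 → ℓ (Matrix.vecMulVec u v) = 0) {X : Matrix d d k}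
    (hX : X.trace = 0) : ℓ X = 0 := by
  have hoff : ∀ i j, i ≠ j → ℓ (Matrix.single i j 1) = 0 := by
    intro i j hij
    have := h (Pi.single i 1) (Pi.single j 1) (by simp [hij.symm])
    rwa [← Matrix.single_eq_single_vecMulVec_single] at this
  have hdiag : ∀ i j, ℓ (Matrix.single i i 1) = ℓ (Matrix.single j j 1) := by
    intro i j
    rcases eq_or_ne i j with rfl | hij
    · rfl
    -- The rank one matrix (eᵢ + eⱼ)(eᵢ - eⱼ)ᵀ equals Eᵢᵢ - Eⱼⱼ up to off-diagonal units, which ℓ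
    -- already kills.
    have h1 := h (Pi.single i 1 + Pi.single j 1) (Pi.single i 1 - Pi.single j 1)
      (by simp [hij, hij.symm])
    simp only [Matrix.vecMulVec_sub, Matrix.add_vecMulVec, ← Matrix.single_eq_single_vecMulVec_single,
      map_sub, map_add, hoff i j hij, hoff j i hij.symm] at h1
    rw [add_zero, zero_add, sub_eq_zero] at h1
    exact h1
  rcases isEmpty_or_nonempty d with hd | ⟨⟨i₀⟩⟩
  · rw [Subsingleton.elim X 0, map_zero]
  rw [Matrix.matrix_eq_sum_single X, map_sum]
  have h2 : ∀ i, ℓ (∑ j, Matrix.single i j (X i j)) = X i i • ℓ (Matrix.single i₀ i₀ 1) := by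
    intro i
    have h3 : ∀ j, ℓ (Matrix.single i j (X i j)) = X i j • ℓ (Matrix.single i j 1) := fun j => by
      rw [← map_smul, Matrix.smul_single, smul_eq_mul, mul_one]
    rw [map_sum, Finset.sum_eq_single i]
    · rw [h3, hdiag i i₀]
    · intro j _ hj
      rw [h3, hoff i j hj.symm, smul_zero]
    · simp
  simp only [h2]
  rw [← Finset.sum_smul]
  have : ∑ i, X i i = 0 := hX
  rw [this, zero_smul]

/-- A polynomial which is invariant under the flow of a nilpotent vector field is annihilated by
the corresponding derivation. -/
theorem MvPolynomial.mkDerivation_eq_zero_of_forall_aeval {k σ : Type*} [Field k] [Infinite k]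
    (f : MvPolynomial σ k) (w : σ → MvPolynomial σ k)
    (h : ∀ t : k, MvPolynomial.aeval (fun s => X s + C t * w s) f = f) :
    MvPolynomial.mkDerivation k w f = 0 := by
  let S := MvPolynomial σ k
  let φ : S →ₐ[k] Polynomial S :=
    MvPolynomial.aeval fun s => Polynomial.C (X s) + Polynomial.X * Polynomial.C (w s)
  -- Here t has become a formal variable. Equality at infinitely many constants makes it an identity
  -- of polynomials in t, and the coefficient of t is the derivative along w.
  have hφ : φ f = Polynomial.C f := by
    refine Polynomial.eq_of_infinite_eval_eq _ _ ?_
    refine (Set.infinite_range_of_injective (MvPolynomial.C_injective σ k)).mono ?_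
    rintro _ ⟨t, rfl⟩
    rw [Set.mem_ofPred_eq, Polynomial.eval_C]
    conv_rhs => rw [← h t]
    have : ((Polynomial.aeval (R := S) (C t : S)).restrictScalars k).comp φ =
        MvPolynomial.aeval (fun s => X s + C t * w s) := by
      refine MvPolynomial.algHom_ext fun s => ?_
      rw [AlgHom.comp_apply, MvPolynomial.aeval_X, MvPolynomial.aeval_X,
        AlgHom.restrictScalars_apply, map_add, map_mul, Polynomial.aeval_C, Polynomial.aeval_C,
        Polynomial.aeval_X]
      rfl
    have := DFunLike.congr_fun this f
    rwa [AlgHom.comp_apply, AlgHom.restrictScalars_apply, Polynomial.coe_aeval_eq_eval] at this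
  have h0 : ∀ F : S, (φ F).coeff 0 = F ∧ (φ F).coeff 1 = MvPolynomial.mkDerivation k w F := by
    intro F
    induction F using MvPolynomial.induction_on with
    | C a =>
      have : φ (C a) = Polynomial.C (C a) := by
        rw [← MvPolynomial.algebraMap_eq, φ.commutes]
        rfl
      rw [this]
      simp
    | add F G hF hG =>
      rw [map_add, Polynomial.coeff_add, Polynomial.coeff_add, hF.1, hF.2, hG.1, hG.2, map_add]
      exact ⟨rfl, rfl⟩
    | mul_X F j hF =>
      have hX : φ (X j) = Polynomial.C (X j) + Polynomial.X * Polynomial.C (w j) :=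
        MvPolynomial.aeval_X _ _
      rw [map_mul, Polynomial.mul_coeff_zero, Polynomial.mul_coeff_one, hF.1, hF.2, hX,
        Derivation.leibniz, MvPolynomial.mkDerivation_X]
      simp only [Polynomial.coeff_add, Polynomial.coeff_C_zero, Polynomial.coeff_C_succ,
        Polynomial.coeff_X_mul_zero, Polynomial.coeff_X_mul, add_zero, zero_add, smul_eq_mul,
        true_and]
      ring
  rw [← (h0 f).2, hφ, Polynomial.coeff_C_succ]

theorem Matrix.det_one_add_vecMulVec_of_dotProduct_eq_zero {k d : Type*} [CommRing k] [Fintype d]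
    [DecidableEq d] (t : k) {u v : d → k} (h : v ⬝ᵥ u = 0) :
    (1 + t • Matrix.vecMulVec u v).det = 1 := by
  rw [← Matrix.smul_vecMulVec, Matrix.vecMulVec_eq Unit, Matrix.det_one_add_replicateCol_mul_replicateRow,
    dotProduct_smul, h, smul_zero, add_zero]

namespace SteinerKronecker

open scoped Kronecker

variable {n m : ℕ}

/-- The vector field on `Hom(W, I ⊗ V)` given by an element of the Lie algebra. -/
noncomputable def lieField {R : Type} [CommRing R] [Algebra ℂ R]
    (A : Matrix (Fin 2 × Fin (n + 1)) (Fin (m + 2)) R) :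
    Matrix (Fin 2) (Fin 2) ℂ × Matrix (Fin (m + 2)) (Fin (m + 2)) ℂ →ₗ[ℂ] (HomIndex n m → R) where
  toFun X s := (((X.1.map (algebraMap ℂ R)) ⊗ₖ (1 : Matrix (Fin (n + 1)) (Fin (n + 1)) R)) * A -
    A * X.2.map (algebraMap ℂ R)) s.1 s.2
  map_add' X Y := by
    funext s
    have h1 : (X + Y).1.map (algebraMap ℂ R) =
      X.1.map (algebraMap ℂ R) + Y.1.map (algebraMap ℂ R) := Matrix.map_add _ (map_add _) _ _
    have h2 : (X + Y).2.map (algebraMap ℂ R) =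
      X.2.map (algebraMap ℂ R) + Y.2.map (algebraMap ℂ R) := Matrix.map_add _ (map_add _) _ _
    rw [h1, h2, Matrix.add_kronecker, Matrix.add_mul, Matrix.mul_add]
    simp only [Pi.add_apply, Matrix.sub_apply, Matrix.add_apply]
    ring
  map_smul' c X := by
    funext s
    have h1 : (c • X).1.map (algebraMap ℂ R) = algebraMap ℂ R c • X.1.map (algebraMap ℂ R) := by
      ext i j
      simp
    have h2 : (c • X).2.map (algebraMap ℂ R) = algebraMap ℂ R c • X.2.map (algebraMap ℂ R) := by
      ext i j
      simp
    rw [h1, h2, Matrix.smul_kronecker, Matrix.smul_mul, Matrix.mul_smul, ← smul_sub]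
    simp [Algebra.smul_def]

theorem map_lieField {R R' : Type} [CommRing R] [Algebra ℂ R] [CommRing R'] [Algebra ℂ R']
    (φ : R →ₐ[ℂ] R') (A : Matrix (Fin 2 × Fin (n + 1)) (Fin (m + 2)) R)
    (X : Matrix (Fin 2) (Fin 2) ℂ × Matrix (Fin (m + 2)) (Fin (m + 2)) ℂ) (s : HomIndex n m) :
    φ (lieField A X s) = lieField (A.map φ) X s := by
  simp [lieField, Matrix.mul_apply, Matrix.kroneckerMap_apply, Matrix.one_apply, apply_ite φ]

theorem lieField_inl {R : Type} [CommRing R] [Algebra ℂ R]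
    (A : Matrix (Fin 2 × Fin (n + 1)) (Fin (m + 2)) R) (X : Matrix (Fin 2) (Fin 2) ℂ)
    (s : HomIndex n m) : lieField A (X, 0) s =
      ((X.map (algebraMap ℂ R) ⊗ₖ (1 : Matrix (Fin (n + 1)) (Fin (n + 1)) R)) * A) s.1 s.2 := by
  simp [lieField]

theorem lieField_inr {R : Type} [CommRing R] [Algebra ℂ R]
    (A : Matrix (Fin 2 × Fin (n + 1)) (Fin (m + 2)) R) (Y : Matrix (Fin (m + 2)) (Fin (m + 2)) ℂ)
    (s : HomIndex n m) : lieField A (0, Y) s = -(A * Y.map (algebraMap ℂ R)) s.1 s.2 := by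
  simp [lieField]

theorem matrixAct_one_add {R : Type} [CommRing R] (c : R) (N : Matrix (Fin 2) (Fin 2) R)
    (A : Matrix (Fin 2 × Fin (n + 1)) (Fin (m + 2)) R) : matrixAct (1 + c • N) A 1 =
      A + c • ((N ⊗ₖ (1 : Matrix (Fin (n + 1)) (Fin (n + 1)) R)) * A) := by
  rw [matrixAct, Matrix.add_kronecker, Matrix.smul_kronecker, Matrix.one_kronecker_one,
    Matrix.mul_one, Matrix.add_mul, Matrix.one_mul, Matrix.smul_mul]

theorem matrixAct_one_sub {R : Type} [CommRing R] (c : R)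
    (N : Matrix (Fin (m + 2)) (Fin (m + 2)) R)
    (A : Matrix (Fin 2 × Fin (n + 1)) (Fin (m + 2)) R) :
    matrixAct 1 A (1 - c • N) = A - c • (A * N) := by
  rw [matrixAct, Matrix.one_kronecker_one, Matrix.one_mul, Matrix.mul_sub, Matrix.mul_one,
    Matrix.mul_smul]

theorem actHom_eq_aeval (g : GroupG m) {P : Matrix (Fin 2) (Fin 2) (PolyRing n m)}
    {Q : Matrix (Fin (m + 2)) (Fin (m + 2)) (PolyRing n m)} (hP : g.1.1.map MvPolynomial.C = P)
    (hQ : (g.2⁻¹).1.map MvPolynomial.C = Q) (f : PolyRing n m) :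
    actHom g f = MvPolynomial.aeval (fun p => matrixAct P (coordMatrix n m) Q p.1 p.2) f := by
  subst hP hQ
  rfl

theorem map_C_one_add_smul {d : ℕ} (t : ℂ) (N : Matrix (Fin d) (Fin d) ℂ) :
    (1 + t • N).map (MvPolynomial.C : ℂ → PolyRing n m) =
      1 + (MvPolynomial.C t : PolyRing n m) • N.map (algebraMap ℂ (PolyRing n m)) := by
  ext i j
  simp [Matrix.one_apply, apply_ite MvPolynomial.C, MvPolynomial.algebraMap_eq]

/-- Since v · u = 0, the matrix u vᵀ squares to zero and 1 + t u vᵀ is a one-parameter subgroup of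
SL(2). It acts affinely in t, so no exponential is needed. -/
theorem lieField_inl_invariant {f : PolyRing n m} (hf : f ∈ invariants n m) (u v : Fin 2 → ℂ)
    (huv : v ⬝ᵥ u = 0) :
    MvPolynomial.mkDerivation ℂ (lieField (coordMatrix n m) (Matrix.vecMulVec u v, 0)) f = 0 := by
  refine MvPolynomial.mkDerivation_eq_zero_of_forall_aeval f _ fun t => ?_
  let g : GroupG m := (⟨1 + t • Matrix.vecMulVec u v,
    Matrix.det_one_add_vecMulVec_of_dotProduct_eq_zero t huv⟩, 1)
  have hQ : (g.2⁻¹).1.map (MvPolynomial.C : ℂ → PolyRing n m) = 1 := by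
    change ((1 : Matrix.SpecialLinearGroup (Fin (m + 2)) ℂ)⁻¹).1.map _ = 1
    rw [inv_one]
    exact Matrix.map_one _ (map_zero _) (map_one _)
  have h := (actHom_eq_aeval g (map_C_one_add_smul t _) hQ f).symm.trans (mem_invariants_iff.1 hf g)
  rw [matrixAct_one_add] at h
  refine Eq.trans (congrArg (fun w => MvPolynomial.aeval w f) (funext fun s => ?_)) h
  exact congrArg (fun z => MvPolynomial.X s + MvPolynomial.C t * z) (lieField_inl _ _ s)

theorem lieField_inr_invariant {f : PolyRing n m} (hf : f ∈ invariants n m) (u v : Fin (m + 2) → ℂ)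
    (huv : v ⬝ᵥ u = 0) :
    MvPolynomial.mkDerivation ℂ (lieField (coordMatrix n m) (0, Matrix.vecMulVec u v)) f = 0 := by
  refine MvPolynomial.mkDerivation_eq_zero_of_forall_aeval f _ fun t => ?_
  let B : Matrix.SpecialLinearGroup (Fin (m + 2)) ℂ := ⟨1 + (-t) • Matrix.vecMulVec u v,
    Matrix.det_one_add_vecMulVec_of_dotProduct_eq_zero (-t) huv⟩
  -- The second factor acts through its inverse; the choice B⁻¹ makes B = 1 - t u vᵀ act on the
  -- right, which matches the minus sign in `lieField`.
  let g : GroupG m := (1, B⁻¹)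
  have hP : g.1.1.map (MvPolynomial.C : ℂ → PolyRing n m) = 1 := by
    change (1 : Matrix.SpecialLinearGroup (Fin 2) ℂ).1.map _ = 1
    exact Matrix.map_one _ (map_zero _) (map_one _)
  have hQ : (g.2⁻¹).1.map (MvPolynomial.C : ℂ → PolyRing n m) =
      1 - (MvPolynomial.C t : PolyRing n m) •
        (Matrix.vecMulVec u v).map (algebraMap ℂ (PolyRing n m)) := by
    change ((B⁻¹)⁻¹).1.map _ = _
    rw [inv_inv, sub_eq_add_neg, ← neg_smul, ← map_neg]
    exact map_C_one_add_smul (-t) _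
  have h := (actHom_eq_aeval g hP hQ f).symm.trans (mem_invariants_iff.1 hf g)
  rw [matrixAct_one_sub] at h
  refine Eq.trans (congrArg (fun w => MvPolynomial.aeval w f) (funext fun s => ?_)) h
  rw [lieField_inr, mul_neg, ← sub_eq_add_neg]
  rfl

variable (n m) in
/-- The derivative of a polynomial function along the vector fields of the Lie algebra. -/
noncomputable def lieDerivative (f : PolyRing n m) :
    Matrix (Fin 2) (Fin 2) ℂ × Matrix (Fin (m + 2)) (Fin (m + 2)) ℂ →ₗ[ℂ] PolyRing n m where
  toFun X := MvPolynomial.vectorField (lieField (coordMatrix n m) X) f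
  map_add' X Y := by rw [map_add, map_add, Derivation.add_apply]
  map_smul' c X := by
    rw [map_smul, algebra_compatible_smul (PolyRing n m) c, map_smul, Derivation.smul_apply,
      algebraMap_smul, RingHom.id_apply]

/-- Invariants are constant along the vector fields of the Lie algebra of `G`. -/
theorem lieDerivative_eq_zero {f : PolyRing n m} (hf : f ∈ invariants n m)
    {X : Matrix (Fin 2) (Fin 2) ℂ} {Y : Matrix (Fin (m + 2)) (Fin (m + 2)) ℂ} (hX : X.trace = 0)
    (hY : Y.trace = 0) : lieDerivative n m f (X, Y) = 0 := by
  have h1 : ((lieDerivative n m f).comp (LinearMap.inl ℂ _ _)) X = 0 :=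
    Matrix.eq_zero_of_trace_eq_zero _ (lieField_inl_invariant hf) hX
  have h2 : ((lieDerivative n m f).comp (LinearMap.inr ℂ _ _)) Y = 0 :=
    Matrix.eq_zero_of_trace_eq_zero _ (lieField_inr_invariant hf) hY
  have h3 : (X, Y) = LinearMap.inl ℂ _ _ X + LinearMap.inr ℂ _ _ Y := by simp
  rw [h3, map_add]
  exact (congrArg₂ (· + ·) h1 h2).trans (add_zero _)

/-! ### Bricks and the upper bound for the transcendence degree -/

theorem kronecker_one_mul_apply {R d e f : Type*} [CommRing R] [Fintype d] [Fintype e] [DecidableEq e]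
    (X : Matrix d d R) (A : Matrix (d × e) f R) (i : d) (k : e) (j : f) :
    ((X ⊗ₖ (1 : Matrix e e R)) * A) (i, k) j = ∑ i', X i i' * A (i', k) j := by
  rw [Matrix.mul_apply, Fintype.sum_prod_type]
  refine Finset.sum_congr rfl fun i' _ => ?_
  rw [Finset.sum_eq_single k]
  · simp
  · intro b _ hb
    simp [Matrix.one_apply_ne hb.symm]
  · simp

/-- The slice of A at the variable k is an identity block in columns c k and c k + 1, so rows c k
and c k + 1 of Y are the rows of X placed in these columns. Where two windows are shifted by one,
the second row of X is compared with the shifted first row, which forces X to be scalar. Since the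
windows cover all columns, Y is the same scalar. -/
theorem exists_brick_of_cover (c : Fin (n + 1) → ℕ) (hc : ∀ k, c k + 1 < m + 2)
    (hcov : ∀ j : Fin (m + 2), ∃ k, j.1 = c k ∨ j.1 = c k + 1) (hov : ∃ k k', c k' = c k + 1) :
    ∃ A : HomSpace n m, ∀ (X : Matrix (Fin 2) (Fin 2) ℂ)
      (Y : Matrix (Fin (m + 2)) (Fin (m + 2)) ℂ),
      (X ⊗ₖ (1 : Matrix (Fin (n + 1)) (Fin (n + 1)) ℂ)) * A = A * Y →
        ∃ a : ℂ, X = a • 1 ∧ Y = a • 1 := by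
  let r : Fin (n + 1) → Fin 2 → Fin (m + 2) := fun k i => ⟨c k + i.1, by
    have := hc k
    omega⟩
  refine ⟨Matrix.of fun s j => if j = r s.2 s.1 then 1 else 0, fun X Y h => ?_⟩
  have H : ∀ k i j, Y (r k i) j = ∑ i', X i i' * if j = r k i' then 1 else 0 := by
    intro k i j
    have := congrFun (congrFun h (i, k)) j
    rw [kronecker_one_mul_apply] at this
    simp only [Matrix.mul_apply, Matrix.of_apply] at this
    rw [this]
    simp
  simp only [Fin.sum_univ_two] at H
  have hr : ∀ k k' i i', r k i = r k' i' ↔ c k + i.1 = c k' + i'.1 := fun k k' i i' => by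
    simp [r]
  obtain ⟨k, k', hk⟩ := hov
  have e : r k 1 = r k' 0 := by simp [hr, hk]
  have h1 := (H k 1 (r k 0)).symm.trans ((congrArg (Y · _) e).trans (H k' 0 (r k 0)))
  have h2 := (H k 1 (r k 1)).symm.trans ((congrArg (Y · _) e).trans (H k' 0 (r k 1)))
  have h3 := (H k 1 (r k' 1)).symm.trans ((congrArg (Y · _) e).trans (H k' 0 (r k' 1)))
  simp only [hr, hk] at h1 h2 h3
  norm_num at h1 h2 h3
  have e01 : X 0 1 = 0 := by simpa [add_assoc] using h3.symm
  have e11 : X 1 1 = X 0 0 := by simpa using h2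
  have e10 : X 1 0 = 0 := by simpa [add_assoc] using h1
  refine ⟨X 0 0, ?_, ?_⟩
  · ext i j
    fin_cases i <;> fin_cases j <;> simp [e01, e10, e11]
  · ext i j
    obtain ⟨l, hl⟩ := hcov i
    rcases hl with hl | hl
    · have : i = r l 0 := Fin.ext (by simpa [r] using hl)
      rw [this, H, e01]
      simp [Matrix.one_apply, eq_comm]
    · have : i = r l 1 := Fin.ext (by simpa [r] using hl)
      rw [this, H, e10, e11]
      simp [Matrix.one_apply, eq_comm]

/-- The Kronecker modules in the stable range have a member with only scalar endomorphisms. -/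
theorem exists_brick (hmn : m < 2 * n) (hne : ¬ (n = 1 ∧ m = 0)) :
    ∃ A : HomSpace n m, ∀ (X : Matrix (Fin 2) (Fin 2) ℂ)
      (Y : Matrix (Fin (m + 2)) (Fin (m + 2)) ℂ),
      (X ⊗ₖ (1 : Matrix (Fin (n + 1)) (Fin (n + 1)) ℂ)) * A = A * Y →
        ∃ a : ℂ, X = a • 1 ∧ Y = a • 1 := by
  rcases Nat.eq_zero_or_pos m with rfl | hm
  · have hn : 2 ≤ n := by omega
    -- With two columns there is a single window and no shift. The slices are the identity, E₀₁ and
    -- E₁₀: the first gives X = Y, and commuting with the other two makes X scalar. This takes three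
    -- variables, hence n ≥ 2.
    refine ⟨Matrix.of fun s j => if s.2.1 = 0 then (if j = s.1 then 1 else 0) else
      if s.2.1 = 1 then (if s.1 = 0 ∧ j = 1 then 1 else 0) else
      if s.2.1 = 2 then (if s.1 = 1 ∧ j = 0 then 1 else 0) else 0, fun X Y h => ?_⟩
    have H := fun i (k : Fin (n + 1)) j =>
      (kronecker_one_mul_apply X _ i k j).symm.trans (congrFun (congrFun h (i, k)) j)
    simp only [Matrix.mul_apply, Matrix.of_apply, Fin.sum_univ_two] at H
    have H0 := fun i j => H i ⟨0, by omega⟩ j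
    have H1 := fun i j => H i ⟨1, by omega⟩ j
    have H2 := fun i j => H i ⟨2, by omega⟩ j
    have a00 := H0 0 0
    have a01 := H0 0 1
    have a10 := H0 1 0
    have a11 := H0 1 1
    have b1 := H1 0 1
    have b0 := H1 0 0
    have c0 := H2 1 0
    have c1 := H2 1 1
    simp at a00 a01 a10 a11 b1 b0 c0 c1
    refine ⟨Y 0 0, ?_, ?_⟩
    · ext i j
      fin_cases i <;> fin_cases j <;> simp [a00, a01, a10, c0, ← b0, ← c1]
    · ext i j
      fin_cases i <;> fin_cases j <;> simp [← b0, ← c1, ← a00, ← b1]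
  -- Windows start at 0, 2, 4, … while they fit. All later indices, among them n because m < 2n, use
  -- one odd start near the end: it catches the last column when m + 2 is odd and supplies the
  -- shifted overlap in either case.
  · refine exists_brick_of_cover
      (fun k => if 2 * k.1 + 1 < m + 2 then 2 * k.1 else 2 * ((m + 1) / 2) - 1) ?_ ?_ ?_
    · intro k
      split_ifs <;> omega
    · intro j
      by_cases hj : 2 * (j.1 / 2) + 1 < m + 2
      · refine ⟨⟨j.1 / 2, by omega⟩, ?_⟩
        simp only [hj, if_true]
        omega
      · refine ⟨⟨n, by omega⟩, ?_⟩
        rw [if_neg (by simp only; omega)]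
        omega
    · refine ⟨⟨(m + 1) / 2 - 1, by omega⟩, ⟨n, by omega⟩, ?_⟩
      simp only
      rw [if_neg (by omega), if_pos (by omega)]
      omega

/-- The Lie algebra of `G`. -/
noncomputable def lieAlgebraG (m : ℕ) :
    Submodule ℂ (Matrix (Fin 2) (Fin 2) ℂ × Matrix (Fin (m + 2)) (Fin (m + 2)) ℂ) :=
  LinearMap.ker ((Matrix.traceLinearMap (Fin 2) ℂ ℂ).prodMap
    (Matrix.traceLinearMap (Fin (m + 2)) ℂ ℂ))

theorem mem_lieAlgebraG {X : Matrix (Fin 2) (Fin 2) ℂ × Matrix (Fin (m + 2)) (Fin (m + 2)) ℂ} :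
    X ∈ lieAlgebraG m ↔ X.1.trace = 0 ∧ X.2.trace = 0 := by
  rw [lieAlgebraG, LinearMap.mem_ker, LinearMap.prodMap_apply, Prod.mk_eq_zero]
  rfl

theorem finrank_lieAlgebraG : Module.finrank ℂ (lieAlgebraG m) = (m + 2) ^ 2 + 2 := by
  have h := LinearMap.finrank_range_add_finrank_ker ((Matrix.traceLinearMap (Fin 2) ℂ ℂ).prodMap
    (Matrix.traceLinearMap (Fin (m + 2)) ℂ ℂ))
  have hs : ∀ d : ℕ, Function.Surjective (Matrix.traceLinearMap (Fin (d + 1)) ℂ ℂ) := fun d c =>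
    ⟨Matrix.single 0 0 c, by simp⟩
  rw [LinearMap.range_eq_top.2 (Function.Surjective.prodMap (hs 1) (hs (m + 1))), finrank_top,
    Module.finrank_prod, Module.finrank_prod, Module.finrank_matrix, Module.finrank_matrix,
    Module.finrank_self, Fintype.card_fin, Fintype.card_fin] at h
  change _ + Module.finrank ℂ (lieAlgebraG m) = _ at h
  nlinarith

/-- The transcendence degree of the invariants is at most `dim Hom(W, I ⊗ V) - dim G`. -/
theorem trdeg_invariants_le (hmn : m < 2 * n) (hne : ¬ (n = 1 ∧ m = 0)) :
    (((m + 2) ^ 2 + 2 : ℕ) : Cardinal) + Algebra.trdeg ℂ (invariants n m) ≤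
      (2 * (n + 1) * (m + 2) : ℕ) := by
  let K := RatField n m
  have hK : Function.Injective (algebraMap (PolyRing n m) K) := IsFractionRing.injective _ _
  obtain ⟨A, hA⟩ := exists_brick hmn hne
  let b := Module.finBasis ℂ (lieAlgebraG m)
  let w : Fin (Module.finrank ℂ (lieAlgebraG m)) → HomIndex n m → PolyRing n m :=
    fun i => lieField (coordMatrix n m) (b i).1
  have hind : LinearIndependent ℂ fun i s => MvPolynomial.eval (fun p => A p.1 p.2) (w i s) := by
    have h1 : (fun i s => MvPolynomial.eval (fun p => A p.1 p.2) (w i s)) =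
        ((lieField A).comp (lieAlgebraG m).subtype) ∘ b := by
      funext i s
      have h2 := map_lieField (polyEval A) (coordMatrix n m) (b i).1 s
      have h3 : (coordMatrix n m).map (polyEval A) = A := by
        ext i j
        simp [polyEval, coordMatrix]
      rw [h3] at h2
      exact h2
    rw [h1]
    refine b.linearIndependent.map' _ (LinearMap.ker_eq_bot.2 ?_)
    rw [injective_iff_map_eq_zero]
    rintro ⟨⟨X, Y⟩, hXY⟩ h0
    have h2 : (X ⊗ₖ (1 : Matrix (Fin (n + 1)) (Fin (n + 1)) ℂ)) * A = A * Y := by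
      rw [← sub_eq_zero]
      ext s j
      exact congrFun h0 (s, j)
    -- At a brick only pairs of equal scalars give the zero vector, and trace zero excludes nonzero
    -- ones.
    obtain ⟨a, rfl, rfl⟩ := hA X Y h2
    obtain ⟨h3, -⟩ := mem_lieAlgebraG.1 hXY
    have : a = 0 := by simpa using h3
    subst this
    simp
  -- Independence at the brick spreads to the generic point.
  have hindK := MvPolynomial.linearIndependent_of_eval hK w _ hind
  let V := Submodule.span K (Set.range fun i s => algebraMap (PolyRing n m) K (w i s))
  have hrank : Module.finrank K V = (m + 2) ^ 2 + 2 := by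
    rw [finrank_span_eq_card hindK, Fintype.card_fin, finrank_lieAlgebraG]
  have h := MvPolynomial.finrank_add_trdeg_le (k := ℂ) (σ := HomIndex n m) (A := invariants n m)
    (K := K) Subtype.val_injective hK V (by
      intro v hv f
      change MvPolynomial.vectorField (k := ℂ) v f.1 = 0
      induction hv using Submodule.span_induction with
      | mem x hx =>
        obtain ⟨i, rfl⟩ := hx
        have h1 := lieDerivative_eq_zero f.2 (mem_lieAlgebraG.1 (b i).2).1
          (mem_lieAlgebraG.1 (b i).2).2
        have h2 : MvPolynomial.mkDerivation ℂ (w i) f.1 = 0 := h1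
        rw [MvPolynomial.mkDerivation_eq_sum] at h2
        change MvPolynomial.mkDerivation ℂ (fun s => algebraMap (PolyRing n m) K (w i s)) f.1 = 0
        rw [MvPolynomial.mkDerivation_eq_sum]
        have h3 := congrArg (algebraMap (PolyRing n m) K) h2
        rw [map_sum, map_zero] at h3
        rw [← h3]
        exact Finset.sum_congr rfl fun s _ => (map_mul _ _ _).symm
      | zero => rw [map_zero, Derivation.zero_apply]
      | add x y _ _ hx hy => rw [map_add, Derivation.add_apply, hx, hy, add_zero]
      | smul c x _ hx => rw [map_smul, Derivation.smul_apply, hx, smul_zero])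
  rw [hrank] at h
  simpa only [Fintype.card_prod, Fintype.card_fin] using h

end SteinerKronecker


/-! ### The dimension of Proj of a graded subalgebra of a polynomial ring -/

open AlgebraicGeometry

/-- The Krull dimension of `Proj` is that of the order of relevant homogeneous primes. -/
theorem AlgebraicGeometry.topologicalKrullDim_proj {A : Type} [CommRing A] [Algebra ℂ A]
    (𝒜 : ℕ → Submodule ℂ A) [GradedAlgebra 𝒜] :
    topologicalKrullDim (Proj 𝒜) = Order.krullDim (ProjectiveSpectrum 𝒜) := by
  -- Irreducible closed sets correspond to their generic points with inclusion reversed: larger sets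
  -- belong to smaller primes.
  rw [← Order.krullDim_orderDual (α := ProjectiveSpectrum 𝒜)]
  let e : TopologicalSpace.IrreducibleCloseds (Proj 𝒜) ≃o (ProjectiveSpectrum 𝒜)ᵒᵈ :=
    { toEquiv := (irreducibleSetEquivPoints (α := Proj 𝒜)).toEquiv.trans OrderDual.toDual
      map_rel_iff' := by
        intro a b
        refine Iff.trans ?_ (irreducibleSetEquivPoints (α := Proj 𝒜)).map_rel_iff
        refine Iff.trans (ProjectiveSpectrum.le_iff_mem_closure 𝒜
          (irreducibleSetEquivPoints (α := Proj 𝒜) b) (irreducibleSetEquivPoints (α := Proj 𝒜) a)) ?_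
        exact specializes_iff_mem_closure.symm }
  exact Order.krullDim_eq_of_orderIso e

namespace MvPolynomial

variable {σ : Type}

/-- Restriction of polynomial functions to the subspace spanned by the first vectors of a sequence. -/
noncomputable def restrictSpan (v : ℕ → σ → ℂ) (j : ℕ) :
    MvPolynomial σ ℂ →ₐ[ℂ] MvPolynomial (Fin j) ℂ :=
  aeval fun s => ∑ l : Fin j, C (v l s) * X l

theorem restrictSpan_isHomogeneous (v : ℕ → σ → ℂ) (j : ℕ) {d : ℕ} {f : MvPolynomial σ ℂ}
    (hf : f.IsHomogeneous d) : (restrictSpan v j f).IsHomogeneous d := by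
  have h := hf.aeval (fun s => ∑ l : Fin j, C (v l s) * X l) (fun s =>
    IsHomogeneous.sum _ _ 1 fun l _ => (isHomogeneous_X ℂ l).C_mul _)
  rwa [one_mul] at h

/-- Restriction to the smaller subspace is restriction to the larger one followed by setting the
last coordinate to zero. The kernels thus form a chain. -/
theorem ker_restrictSpan_succ_le (v : ℕ → σ → ℂ) (j : ℕ) {f : MvPolynomial σ ℂ}
    (hf : restrictSpan v (j + 1) f = 0) : restrictSpan v j f = 0 := by
  let τ : MvPolynomial (Fin (j + 1)) ℂ →ₐ[ℂ] MvPolynomial (Fin j) ℂ :=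
    aeval (Fin.snoc (α := fun _ => MvPolynomial (Fin j) ℂ) X 0)
  have h : τ.comp (restrictSpan v (j + 1)) = restrictSpan v j := by
    refine algHom_ext fun s => ?_
    simp [restrictSpan, τ, Fin.sum_univ_castSucc]
  rw [← h, AlgHom.comp_apply, hf, map_zero]

/-- This is the chain rule at the i-th basis vector, for the linear map that sends the basis vectors
to the v l. -/
theorem eval_pderiv_restrictSpan [Fintype σ] (v : ℕ → σ → ℂ) {j : ℕ} (i l : Fin j) (F : MvPolynomial σ ℂ) :
    eval (Pi.single i 1) (pderiv l (restrictSpan v j F)) =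
      ∑ s, v l s * eval (v i) (pderiv s F) := by
  classical
  have he : ∀ G : MvPolynomial σ ℂ, eval (Pi.single i 1) (restrictSpan v j G) = eval (v i) G := by
    intro G
    have : ((aeval (Pi.single i 1 : Fin j → ℂ)).comp (restrictSpan v j)) = aeval (v i) := by
      refine algHom_ext fun s => ?_
      simp [restrictSpan, Pi.single_apply]
    have := DFunLike.congr_fun this G
    simpa [aeval_eq_eval] using this
  induction F using MvPolynomial.induction_on with
  | C a =>
    have : restrictSpan v j (C a) = C a := by
      rw [← MvPolynomial.algebraMap_eq, AlgHom.commutes]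
      rfl
    simp [this]
  | add F G hF hG => simp only [map_add, hF, hG, mul_add, Finset.sum_add_distrib]
  | mul_X F t hF =>
    have hX : pderiv l (restrictSpan v j (X t)) = C (v l t) := by
      simp [restrictSpan, pderiv_X, Pi.single_apply]
    rw [map_mul, pderiv_mul, map_add, map_mul, map_mul, hF, he, he, hX, eval_X, eval_C]
    simp only [pderiv_mul, map_add, map_mul, eval_X, pderiv_X, mul_add, Finset.sum_add_distrib]
    congr 1
    · rw [Finset.sum_mul]
      exact Finset.sum_congr rfl fun s _ => by ring
    · rw [Finset.sum_eq_single t]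
      · simp [mul_comm]
      · intro b _ hb
        simp [Pi.single_eq_of_ne hb.symm]
      · simp

/-- Along a general flag of linear subspaces, algebraically independent forms restrict to functions of
maximal transcendence degree. -/
theorem exists_restrictSpan_algebraicIndependent [Fintype σ] {r : ℕ}
    (f : Fin (r + 1) → MvPolynomial σ ℂ) (hf : AlgebraicIndependent ℂ f) {d : ℕ}
    (hd : (f 0).IsHomogeneous d) : ∃ (v : ℕ → σ → ℂ) (c : Matrix (Fin (r + 1)) (Fin (r + 1)) ℂ),
      ∀ j : Fin (r + 1), AlgebraicIndependent ℂ fun i : Fin (j + 1) =>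
        restrictSpan v (j + 1) (∑ l, C (c (Fin.castLE j.2 i) l) * f l) := by
  classical
  have hd0 : d ≠ 0 := by
    rintro rfl
    have h1 := hf.transcendental 0
    rw [totalDegree_eq_zero_iff_eq_C.1 ((totalDegree_zero_iff_isHomogeneous _).2 hd)] at h1
    exact h1 (isAlgebraic_algebraMap _)
  obtain ⟨a, ha, hsurj⟩ := exists_surjective_differential f hf (hf.ne_zero 0)
  let D : (σ → ℂ) → Fin (r + 1) → ℂ := fun v i => ∑ s, v s * eval a (pderiv s (f i))
  -- By Euler's identity the derivative of f 0 at a in the direction a is d · f₀(a). So the base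
  -- point a can serve as the first vector of the flag, and every subspace of the flag then contains
  -- it.
  have hD0 : D a 0 ≠ 0 := by
    have h1 := congrArg (eval a) hd.sum_X_mul_pderiv
    simp only [map_sum, map_mul, eval_X, map_nsmul] at h1
    change D a 0 = _ at h1
    rw [h1, nsmul_eq_mul]
    exact mul_ne_zero (Nat.cast_ne_zero.2 hd0) ha
  choose w hw using fun l : Fin (r + 1) => hsurj (Pi.single l 1)
  let u : Fin (r + 1) → σ → ℂ := fun l => if l = 0 then a else w l
  -- The differentials of the f i along the vectors u: first column D a, then standard basis
  -- vectors, so the determinant is `D a 0`. Recombining the f i by T⁻¹ makes the Jacobian at a the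
  -- identity on each step of the flag.
  let T : Matrix (Fin (r + 1)) (Fin (r + 1)) ℂ := Matrix.updateCol 1 0 (D a)
  have hT : ∀ i l, T i l = D (u l) i := by
    intro i l
    rcases eq_or_ne l 0 with rfl | hl
    · simp [T, u]
    · simp only [T, u, if_neg hl, Matrix.updateCol_ne hl]
      refine Eq.trans ?_ (hw l i).symm
      rw [Matrix.one_apply, Pi.single_apply]
  have hdet : T.det ≠ 0 := by
    have : T.det = D a 0 := by
      rw [← Matrix.cramer_apply, Matrix.cramer_one]
      rfl
    rwa [this]
  have hc : T⁻¹ * T = 1 := Matrix.nonsing_inv_mul _ (isUnit_iff_ne_zero.2 hdet)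
  refine ⟨fun l => if h : l < r + 1 then u ⟨l, h⟩ else 0, T⁻¹, fun j => ?_⟩
  refine algebraicIndependent_of_pderiv _ (Pi.single 0 1) fun i l => ?_
  rw [eval_pderiv_restrictSpan]
  have hl : (l : ℕ) < r + 1 := by omega
  have e0 : u ⟨((0 : Fin (j.1 + 1)) : ℕ), by simp⟩ = a := if_pos (by simp)
  rw [dif_pos hl, dif_pos (by simp), e0]
  have h1 : ∀ s, eval a (pderiv s (∑ l, C (T⁻¹ (Fin.castLE j.2 i) l) * f l)) =
      ∑ l, T⁻¹ (Fin.castLE j.2 i) l * eval a (pderiv s (f l)) := fun s => by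
    simp only [map_sum, pderiv_C_mul, map_mul, eval_C]
  calc ∑ s, u ⟨l, hl⟩ s * eval a (pderiv s (∑ l, C (T⁻¹ (Fin.castLE j.2 i) l) * f l))
      = ∑ b, T⁻¹ (Fin.castLE j.2 i) b * D (u ⟨l, hl⟩) b := by
        simp only [h1, D, Finset.mul_sum]
        rw [Finset.sum_comm]
        exact Finset.sum_congr rfl fun b _ => Finset.sum_congr rfl fun s _ => by ring
    _ = (T⁻¹ * T) (Fin.castLE j.2 i) ⟨l, hl⟩ := by
        rw [Matrix.mul_apply]
        exact Finset.sum_congr rfl fun b _ => by rw [hT]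
    _ = if i = l then 1 else 0 := by
        rw [hc, Matrix.one_apply]
        simp [Fin.ext_iff]

end MvPolynomial

section GradedSubalgebra

variable {σ A : Type} [CommRing A] [Algebra ℂ A] (𝒜 : ℕ → Submodule ℂ A)
  [GradedAlgebra 𝒜] (ι : A →ₐ[ℂ] MvPolynomial σ ℂ)

theorem map_decompose_eq_homogeneousComponent
    (hg : ∀ d a, a ∈ 𝒜 d ↔ (ι a).IsHomogeneous d) (a : A) (d : ℕ) :
    ι (DirectSum.decompose 𝒜 a d) = MvPolynomial.homogeneousComponent d (ι a) := by
  classical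
  conv_rhs => rw [← DirectSum.sum_support_decompose 𝒜 a, map_sum, map_sum]
  have h : ∀ i, MvPolynomial.homogeneousComponent d (ι (DirectSum.decompose 𝒜 a i)) =
      if d = i then ι (DirectSum.decompose 𝒜 a i) else 0 := fun i =>
    MvPolynomial.homogeneousComponent_of_mem ((hg i _).1 (DirectSum.decompose 𝒜 a i).2)
  simp only [h, Finset.sum_ite_eq]
  split_ifs with hd
  · rfl
  · rw [DFinsupp.notMem_support_iff.1 hd, ZeroMemClass.coe_zero, map_zero]

/-- The constant term of an element of a graded subalgebra of a polynomial ring. -/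
noncomputable def constTerm : A →ₐ[ℂ] ℂ :=
  (MvPolynomial.aeval fun _ => 0).comp ι

theorem decompose_zero_eq_algebraMap (hι : Function.Injective ι)
    (hg : ∀ d a, a ∈ 𝒜 d ↔ (ι a).IsHomogeneous d) (a : A) :
    (DirectSum.decompose 𝒜 a 0 : A) = algebraMap ℂ A (constTerm ι a) := by
  apply hι
  rw [map_decompose_eq_homogeneousComponent 𝒜 ι hg, MvPolynomial.homogeneousComponent_zero,
    AlgHom.commutes, constTerm, AlgHom.comp_apply, MvPolynomial.algebraMap_eq,
    MvPolynomial.aeval_zero']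
  rfl

theorem sub_constTerm_mem_irrelevant (hι : Function.Injective ι)
    (hg : ∀ d a, a ∈ 𝒜 d ↔ (ι a).IsHomogeneous d) (a : A) :
    a - algebraMap ℂ A (constTerm ι a) ∈ HomogeneousIdeal.irrelevant 𝒜 := by
  rw [HomogeneousIdeal.mem_irrelevant_iff, GradedRing.proj_apply, DirectSum.decompose_sub,
    DirectSum.sub_apply, AddSubgroupClass.coe_sub, decompose_zero_eq_algebraMap 𝒜 ι hι hg,
    decompose_zero_eq_algebraMap 𝒜 ι hι hg, AlgHom.commutes]
  exact sub_self _

-- A relevant homogeneous prime lies strictly inside the kernel of the constant term, so its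
-- quotient has transcendence degree between 1 and r + 1, a window of width r.
open Cardinal in
theorem krullDim_projectiveSpectrum_le (hι : Function.Injective ι)
    (hg : ∀ d a, a ∈ 𝒜 d ↔ (ι a).IsHomogeneous d) {r : ℕ} (hr : Algebra.trdeg ℂ A = (r + 1 : ℕ)) :
    Order.krullDim (ProjectiveSpectrum 𝒜) ≤ r := by
  have hA : Algebra.trdeg ℂ A < ℵ₀ := hr ▸ natCast_lt_aleph0
  refine krullDim_le_of_strictAnti_nat (a := 1)
    (fun p : ProjectiveSpectrum 𝒜 => natTrdeg ℂ (A ⧸ p.asHomogeneousIdeal.toIdeal))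
    (fun p q h => natTrdeg_quotient_lt hA h) fun p => ⟨?_, ?_⟩
  · have hprime : (RingHom.ker (constTerm ι)).IsPrime := RingHom.ker_isPrime _
    have hle : p.asHomogeneousIdeal.toIdeal ≤ RingHom.ker (constTerm ι) := by
      intro a ha
      rw [RingHom.mem_ker]
      by_contra h0
      have h1 : (DirectSum.decompose 𝒜 a 0 : A) ∈ p.asHomogeneousIdeal.toIdeal :=
        p.asHomogeneousIdeal.isHomogeneous 0 ha
      rw [decompose_zero_eq_algebraMap 𝒜 ι hι hg] at h1
      exact p.isPrime.ne_top (Ideal.eq_top_of_isUnit_mem _ h1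
        ((isUnit_iff_ne_zero.2 h0).map (algebraMap ℂ A)))
    have hne : p.asHomogeneousIdeal.toIdeal ≠ RingHom.ker (constTerm ι) := by
      intro he
      refine p.not_irrelevant_le fun a ha => ?_
      have h1 : a ∈ p.asHomogeneousIdeal.toIdeal := by
        have h2 : (DirectSum.decompose 𝒜 a 0 : A) = 0 := ha
        rw [decompose_zero_eq_algebraMap 𝒜 ι hι hg] at h2
        rw [he, RingHom.mem_ker]
        have := congrArg (constTerm ι) h2
        rwa [AlgHom.commutes, map_zero] at this
      exact h1
    exact Nat.one_le_of_lt (natTrdeg_quotient_lt hA (lt_of_le_of_ne hle hne))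
  · refine (natTrdeg_mono_of_surjective (Ideal.Quotient.mkₐ ℂ _)
      (Ideal.Quotient.mkₐ_surjective ℂ _) hA).trans ?_
    rw [natTrdeg, hr, toNat_natCast, add_comm]

/-- The kernel of the restriction to a linear subspace, as a homogeneous ideal. -/
noncomputable def restrictIdeal (hg : ∀ d a, a ∈ 𝒜 d ↔ (ι a).IsHomogeneous d) (v : ℕ → σ → ℂ)
    (j : ℕ) : HomogeneousIdeal 𝒜 where
  toSubmodule := RingHom.ker ((MvPolynomial.restrictSpan v j).comp ι)
  is_homogeneous' := by
    intro d a ha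
    rw [RingHom.mem_ker] at ha ⊢
    classical
    have h1 := congrArg (MvPolynomial.homogeneousComponent d) ha
    rw [← DirectSum.sum_support_decompose 𝒜 a, map_sum, map_sum, map_zero] at h1
    have h : ∀ i, MvPolynomial.homogeneousComponent d
        ((MvPolynomial.restrictSpan v j).comp ι (DirectSum.decompose 𝒜 a i)) =
        if d = i then (MvPolynomial.restrictSpan v j).comp ι (DirectSum.decompose 𝒜 a i) else 0 :=
      fun i => MvPolynomial.homogeneousComponent_of_mem
        (MvPolynomial.restrictSpan_isHomogeneous v j ((hg i _).1 (DirectSum.decompose 𝒜 a i).2))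
    simp only [h, Finset.sum_ite_eq] at h1
    split_ifs at h1 with hd
    · exact h1
    · rw [DFinsupp.notMem_support_iff.1 hd, ZeroMemClass.coe_zero, map_zero]

-- Homogeneous elements generate A, so a transcendence basis can be extracted from them.
open Cardinal in
theorem exists_homogeneous_transcendenceBasis [IsDomain A] {r : ℕ} (hr : Algebra.trdeg ℂ A = r) :
    ∃ f : Fin r → A, AlgebraicIndependent ℂ f ∧ ∀ i, ∃ d, f i ∈ 𝒜 d := by
  have htop : Algebra.adjoin ℂ {a : A | ∃ d, a ∈ 𝒜 d} = ⊤ := by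
    rw [eq_top_iff]
    intro a _
    classical
    rw [← DirectSum.sum_support_decompose 𝒜 a]
    exact sum_mem fun i _ => Algebra.subset_adjoin ⟨i, (DirectSum.decompose 𝒜 a i).2⟩
  have : FaithfulSMul ℂ A := (faithfulSMul_iff_algebraMap_injective _ _).2 (RingHom.injective _)
  have halg : Algebra.IsAlgebraic (Algebra.adjoin ℂ {a : A | ∃ d, a ∈ 𝒜 d}) A :=
    ⟨fun x => isAlgebraic_algebraMap (⟨x, htop ▸ Algebra.mem_top⟩ :
      Algebra.adjoin ℂ {a : A | ∃ d, a ∈ 𝒜 d})⟩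
  obtain ⟨t, ht, hb⟩ := isAlgebraic_iff_exists_isTranscendenceBasis_subset.1 halg
  have hcard := hb.cardinalMk_eq_trdeg
  rw [hr] at hcard
  obtain ⟨e⟩ : Nonempty (Fin r ≃ t) := by
    rw [← Cardinal.eq, hcard, mk_fin]
  exact ⟨fun i => e i, hb.1.comp e e.injective, fun i => ht (e i).2⟩

-- Finite generation of A is not assumed, so the chain is explicit: the kernels of restriction to
-- the members of a general flag. The quotient for the j-dimensional member has transcendence degree
-- exactly j, which makes the inclusions strict.
open Cardinal in
theorem le_krullDim_projectiveSpectrum [IsDomain A] [Fintype σ] (hι : Function.Injective ι)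
    (hg : ∀ d a, a ∈ 𝒜 d ↔ (ι a).IsHomogeneous d) {r : ℕ} (hr : Algebra.trdeg ℂ A = (r + 1 : ℕ)) :
    (r : WithBot ℕ∞) ≤ Order.krullDim (ProjectiveSpectrum 𝒜) := by
  obtain ⟨f, hf, hhom⟩ := exists_homogeneous_transcendenceBasis 𝒜 hr
  obtain ⟨d, hd⟩ := hhom 0
  obtain ⟨v, c, hvc⟩ := MvPolynomial.exists_restrictSpan_algebraicIndependent (fun i => ι (f i))
    (hf.map' hι) ((hg d _).1 hd)
  let φ : ∀ j : ℕ, A →ₐ[ℂ] MvPolynomial (Fin j) ℂ := fun j => (MvPolynomial.restrictSpan v j).comp ι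
  let F : Fin (r + 1) → A := fun i => ∑ l, algebraMap ℂ A (c i l) * f l
  have hF : ∀ j : Fin (r + 1), AlgebraicIndependent ℂ
      fun i : Fin (j + 1) => φ (j + 1) (F (Fin.castLE j.2 i)) := by
    intro j
    have e : (fun i : Fin (j + 1) => φ (j + 1) (F (Fin.castLE j.2 i))) = fun i : Fin (j + 1) =>
        MvPolynomial.restrictSpan v (j + 1)
          (∑ l, MvPolynomial.C (c (Fin.castLE j.2 i) l) * ι (f l)) := funext fun i => by
      simp only [φ, F, AlgHom.comp_apply, map_sum, map_mul, AlgHom.commutes,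
        ← MvPolynomial.algebraMap_eq]
    rw [e]
    exact hvc j
  have htr : ∀ j : Fin (r + 1), natTrdeg ℂ (A ⧸ (restrictIdeal 𝒜 ι hg v (j + 1)).toIdeal) = j + 1 := by
    intro j
    have hup : Algebra.trdeg ℂ (A ⧸ (restrictIdeal 𝒜 ι hg v (j + 1)).toIdeal) ≤ (j + 1 : ℕ) := by
      have h1 := trdeg_le_of_injective (Ideal.kerLiftAlg (φ (j + 1))) (Ideal.kerLiftAlg_injective _)
      rw [MvPolynomial.trdeg_of_isDomain, lift_id, mk_fin] at h1
      exact h1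
    have hlow : ((j + 1 : ℕ) : Cardinal) ≤
        Algebra.trdeg ℂ (A ⧸ (restrictIdeal 𝒜 ι hg v (j + 1)).toIdeal) := by
      have h1 : AlgebraicIndependent ℂ fun i : Fin (j + 1) =>
          (Ideal.Quotient.mk (RingHom.ker (φ (j + 1))) (F (Fin.castLE j.2 i))) :=
        AlgebraicIndependent.of_comp (Ideal.kerLiftAlg (φ (j + 1))) (hF j)
      have h2 := h1.cardinalMk_le_trdeg
      rwa [mk_fin] at h2
    rw [natTrdeg, le_antisymm hup hlow, toNat_natCast]
  -- The subspaces have dimension j + 1, starting from a line, since the zero subspace would give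
  -- the irrelevant ideal. If a kernel contained that ideal, `F 0` would restrict to a constant and
  -- be algebraic.
  let P : Fin (r + 1) → ProjectiveSpectrum 𝒜 := fun j =>
    { asHomogeneousIdeal := restrictIdeal 𝒜 ι hg v (j + 1)
      isPrime := RingHom.ker_isPrime (φ (j + 1))
      not_irrelevant_le := fun hle => by
        have h1 : F 0 - algebraMap ℂ A (constTerm ι (F 0)) ∈ RingHom.ker (φ (j + 1)) :=
          hle (sub_constTerm_mem_irrelevant 𝒜 ι hι hg (F 0))
        rw [RingHom.mem_ker, map_sub, sub_eq_zero, AlgHom.commutes] at h1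
        have h2 := (hF j).transcendental 0
        refine h2 ?_
        have h3 : (Fin.castLE j.2 (0 : Fin (j.1 + 1))) = (0 : Fin (r + 1)) := rfl
        rw [h3, h1]
        exact isAlgebraic_algebraMap _ }
  have hlt : ∀ i (h : i + 1 < r + 1), P ⟨i + 1, h⟩ < P ⟨i, by omega⟩ := by
    intro i h
    refine lt_of_le_of_ne (fun a ha => ?_) fun he => ?_
    · exact MvPolynomial.ker_restrictSpan_succ_le v (i + 1) ha
    · have h1 : natTrdeg ℂ (A ⧸ (restrictIdeal 𝒜 ι hg v (i + 1 + 1)).toIdeal) = i + 1 + 1 :=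
        htr ⟨i + 1, h⟩
      have h2 : natTrdeg ℂ (A ⧸ (restrictIdeal 𝒜 ι hg v (i + 1)).toIdeal) = i + 1 :=
        htr ⟨i, by omega⟩
      have h3 : restrictIdeal 𝒜 ι hg v (i + 1 + 1) = restrictIdeal 𝒜 ι hg v (i + 1) :=
        congrArg ProjectiveSpectrum.asHomogeneousIdeal he
      rw [h3, h2] at h1
      omega
  let L : LTSeries (ProjectiveSpectrum 𝒜) :=
    { length := r
      toFun := fun j => P (Fin.rev j)
      step := fun j => by
        have h := hlt (Fin.rev j).1 (by omega)
        have e1 : (Fin.rev j.castSucc) = ⟨(Fin.rev j).1 + 1, by omega⟩ := by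
          ext
          simp only [Fin.val_rev, Fin.val_castSucc]
          omega
        have e2 : (Fin.rev j.succ) = ⟨(Fin.rev j).1, by omega⟩ := by
          ext
          simp only [Fin.val_rev, Fin.val_succ]
          omega
        change P _ < P _
        rw [e1, e2]
        exact h }
  exact Order.LTSeries.length_le_krullDim L

/-- The dimension of `Proj` of a graded subalgebra of a polynomial ring. -/
theorem topologicalKrullDim_proj_eq [IsDomain A] [Fintype σ] (hι : Function.Injective ι)
    (hg : ∀ d a, a ∈ 𝒜 d ↔ (ι a).IsHomogeneous d) {r : ℕ} (hr : Algebra.trdeg ℂ A = (r + 1 : ℕ)) :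
    topologicalKrullDim (Proj 𝒜) = r := by
  rw [topologicalKrullDim_proj]
  exact le_antisymm (krullDim_projectiveSpectrum_le 𝒜 ι hι hg hr)
    (le_krullDim_projectiveSpectrum 𝒜 ι hι hg hr)

end GradedSubalgebra

/-! ### The dimension of the quotient -/

namespace SteinerKronecker

/-- The dimension of the moduli space. -/
theorem dim_kroneckerModuli_add_algDim {n m : ℕ} (hmn : m < 2 * n) (hne : ¬ (n = 1 ∧ m = 0)) :
    topologicalKrullDim (kroneckerModuli n m) + algDim (Set.univ : Set (GroupG m)) =
      topologicalKrullDim (projHom n m) := by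
  have h := le_antisymm (trdeg_invariants_le hmn hne) (by
    rw [add_comm (((m + 2) ^ 2 + 2 : ℕ) : Cardinal)]
    exact le_trdeg_invariants)
  obtain ⟨t, ht⟩ : ∃ t : ℕ, Algebra.trdeg ℂ (invariants n m) = t :=
    Cardinal.lt_aleph0.1 ((self_le_add_left _ _).trans_lt
      (h ▸ Cardinal.natCast_lt_aleph0))
  rw [ht] at h
  have h' : (m + 2) ^ 2 + 2 + t = 2 * (n + 1) * (m + 2) := by exact_mod_cast h
  -- Proj has dimension t - 1 only for t ≥ 1. If t = 0, then m + 3 ≤ 2(n + 1) gives (m+3)(m+2) ≤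
  -- (m+2)² + 2, so m = 0 and 6 = 4(n + 1), which is absurd.
  have hpos : t ≠ 0 := by
    rintro rfl
    have h1 : (m + 3) * (m + 2) ≤ 2 * (n + 1) * (m + 2) := Nat.mul_le_mul_right _ (by omega)
    have hm : m = 0 := by nlinarith
    subst hm
    omega
  obtain ⟨r, rfl⟩ := Nat.exists_eq_succ_of_ne_zero hpos
  obtain ⟨N, hN⟩ : ∃ N, 2 * (n + 1) * (m + 2) = N + 1 := ⟨(m + 2) ^ 2 + 2 + r, by omega⟩
  have h1 : topologicalKrullDim (kroneckerModuli n m) = r :=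
    topologicalKrullDim_proj_eq (invariantGrading n m) (invariants n m).val Subtype.val_injective
      (fun d a => Iff.rfl) ht
  have h2 : topologicalKrullDim (projHom n m) = N :=
    topologicalKrullDim_proj_eq (MvPolynomial.homogeneousSubmodule (HomIndex n m) ℂ)
      (AlgHom.id ℂ (PolyRing n m)) Function.injective_id (fun d a => Iff.rfl) (by
        rw [MvPolynomial.trdeg_of_isDomain, Cardinal.lift_id, Cardinal.mk_fintype, ← hN]
        simp only [Fintype.card_prod, Fintype.card_fin])
  rw [h1, h2, algDim_univ]
  have : r + ((m + 2) ^ 2 + 2) = N := by omega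
  exact_mod_cast this

end SteinerKronecker


/-! ### Sections, their local values, and homotheties -/

namespace SteinerKronecker

open CategoryTheory AlgebraicGeometry TopologicalSpace Opposite

section Homothety

variable {A : Type} [CommRing A] [Algebra ℂ A] (𝒜 : ℕ → Submodule ℂ A) [GradedAlgebra 𝒜]

variable {U V : (Proj 𝒜).Opens} {d : ℕ}

/-- The value of a regular function at a point. -/
def funVal (r : Γ(Proj 𝒜, U)) (x : ProjectiveSpectrum.top 𝒜) (hx : (x : Proj 𝒜) ∈ U) : LocAt 𝒜 x :=
  evalStruct 𝒜 U r ⟨x, hx⟩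

/-- The value of a section of the structure sheaf at a point. -/
def structVal (r : Γ(structureModule 𝒜, U)) (x : ProjectiveSpectrum.top 𝒜)
    (hx : (x : Proj 𝒜) ∈ U) : LocAt 𝒜 x :=
  evalStruct 𝒜 U (show Γ(Proj 𝒜, U) from r) ⟨x, hx⟩

/-- The value of a section of a twisting sheaf at a point. -/
def twistVal (s : Γ(twistingSheaf 𝒜 d, U)) (x : ProjectiveSpectrum.top 𝒜)
    (hx : (x : Proj 𝒜) ∈ U) : LocAt 𝒜 x :=
  (show twistSections 𝒜 d U from s).1 ⟨x, hx⟩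

theorem funVal_ext {r s : Γ(Proj 𝒜, U)} (h : ∀ x hx, funVal 𝒜 r x hx = funVal 𝒜 s x hx) :
    r = s :=
  Subtype.ext (funext fun x => HomogeneousLocalization.val_injective _ (h x.1 x.2))

theorem structVal_ext {r s : Γ(structureModule 𝒜, U)}
    (h : ∀ x hx, structVal 𝒜 r x hx = structVal 𝒜 s x hx) : r = s :=
  funVal_ext 𝒜 h

theorem twistVal_ext {r s : Γ(twistingSheaf 𝒜 d, U)}
    (h : ∀ x hx, twistVal 𝒜 r x hx = twistVal 𝒜 s x hx) : r = s :=
  Subtype.ext (funext fun x => h x.1 x.2)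

theorem funVal_add (r s : Γ(Proj 𝒜, U)) (x : ProjectiveSpectrum.top 𝒜) (hx : (x : Proj 𝒜) ∈ U) :
    funVal 𝒜 (r + s) x hx = funVal 𝒜 r x hx + funVal 𝒜 s x hx :=
  congrFun (map_add (evalStruct 𝒜 U) r s) ⟨x, hx⟩

theorem funVal_mul (r s : Γ(Proj 𝒜, U)) (x : ProjectiveSpectrum.top 𝒜) (hx : (x : Proj 𝒜) ∈ U) :
    funVal 𝒜 (r * s) x hx = funVal 𝒜 r x hx * funVal 𝒜 s x hx :=
  congrFun (map_mul (evalStruct 𝒜 U) r s) ⟨x, hx⟩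

theorem funVal_one (x : ProjectiveSpectrum.top 𝒜) (hx : (x : Proj 𝒜) ∈ U) :
    funVal 𝒜 (1 : Γ(Proj 𝒜, U)) x hx = 1 :=
  congrFun (map_one (evalStruct 𝒜 U)) ⟨x, hx⟩

theorem structVal_smul (r : Γ(Proj 𝒜, U)) (s : Γ(structureModule 𝒜, U))
    (x : ProjectiveSpectrum.top 𝒜) (hx : (x : Proj 𝒜) ∈ U) :
    structVal 𝒜 (r • s) x hx = funVal 𝒜 r x hx * structVal 𝒜 s x hx :=
  funVal_mul 𝒜 r (show Γ(Proj 𝒜, U) from s) x hx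

theorem twistVal_smul (r : Γ(Proj 𝒜, U)) (s : Γ(twistingSheaf 𝒜 d, U))
    (x : ProjectiveSpectrum.top 𝒜) (hx : (x : Proj 𝒜) ∈ U) :
    twistVal 𝒜 (r • s) x hx = funVal 𝒜 r x hx * twistVal 𝒜 s x hx := rfl

theorem twistVal_add (r s : Γ(twistingSheaf 𝒜 d, U)) (x : ProjectiveSpectrum.top 𝒜)
    (hx : (x : Proj 𝒜) ∈ U) :
    twistVal 𝒜 (r + s) x hx = twistVal 𝒜 r x hx + twistVal 𝒜 s x hx := rfl

theorem structVal_map (i : V ⟶ U) (s : Γ(structureModule 𝒜, U)) (x : ProjectiveSpectrum.top 𝒜)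
    (hx : (x : Proj 𝒜) ∈ V) :
    structVal 𝒜 ((structureModule 𝒜).presheaf.map i.op s) x hx = structVal 𝒜 s x (i.le hx) := rfl

theorem twistVal_map (i : V ⟶ U) (s : Γ(twistingSheaf 𝒜 d, U)) (x : ProjectiveSpectrum.top 𝒜)
    (hx : (x : Proj 𝒜) ∈ V) :
    twistVal 𝒜 ((twistingSheaf 𝒜 d).presheaf.map i.op s) x hx = twistVal 𝒜 s x (i.le hx) := rfl

theorem funVal_constSection (c : ℂ) (x : ProjectiveSpectrum.top 𝒜) (hx : (x : Proj 𝒜) ∈ U) :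
    funVal 𝒜 (constSection 𝒜 U c) x hx = Localization.mk (algebraMap ℂ A c) 1 := rfl

variable (U) in
theorem constSection_add (c d : ℂ) :
    constSection 𝒜 U (c + d) = constSection 𝒜 U c + constSection 𝒜 U d :=
  funVal_ext 𝒜 fun x hx => by
    rw [funVal_add, funVal_constSection, funVal_constSection, funVal_constSection, map_add,
      Localization.add_mk_self]

variable (U) in
theorem constSection_mul (c d : ℂ) :
    constSection 𝒜 U (c * d) = constSection 𝒜 U c * constSection 𝒜 U d :=
  funVal_ext 𝒜 fun x hx => by
    rw [funVal_mul, funVal_constSection, funVal_constSection, funVal_constSection, map_mul,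
      Localization.mk_mul, one_mul]

variable (U) in
theorem constSection_one : constSection 𝒜 U 1 = 1 :=
  funVal_ext 𝒜 fun x hx => by
    rw [funVal_constSection, map_one, funVal_one]
    exact Localization.mk_one

theorem homothety_app_apply (F : (Proj 𝒜).Modules) (c : ℂ) (s : Γ(F, U)) :
    (homothety 𝒜 F c).app U s = constSection 𝒜 U c • s := rfl

theorem modules_hom_ext {F F' : (Proj 𝒜).Modules} {φ ψ : F ⟶ F'}
    (h : ∀ U (s : Γ(F, U)), φ.app U s = ψ.app U s) : φ = ψ :=
  Scheme.Modules.hom_ext _ _ fun U => by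
    ext s
    exact h U s

theorem app_map {F F' : (Proj 𝒜).Modules} (ψ : F ⟶ F') (i : V ⟶ U)
    (s : Γ(F, U)) : ψ.app V (F.presheaf.map i.op s) = F'.presheaf.map i.op (ψ.app U s) :=
  congr($(ψ.mapPresheaf.naturality i.op) s)

/-- Morphisms of modules are linear over constant sections, so homotheties are natural. -/
theorem homothety_comp {F F' : (Proj 𝒜).Modules} (ψ : F ⟶ F') (c : ℂ) :
    homothety 𝒜 F c ≫ ψ = ψ ≫ homothety 𝒜 F' c :=
  modules_hom_ext 𝒜 fun U s => ψ.app_smul (constSection 𝒜 U c) s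

theorem homothety_add (F : (Proj 𝒜).Modules) (c d : ℂ) :
    homothety 𝒜 F (c + d) = homothety 𝒜 F c + homothety 𝒜 F d :=
  modules_hom_ext 𝒜 fun U s => (congrArg (· • s) (constSection_add 𝒜 U c d)).trans (add_smul _ _ s)

theorem homothety_mul (F : (Proj 𝒜).Modules) (c d : ℂ) :
    homothety 𝒜 F (c * d) = homothety 𝒜 F d ≫ homothety 𝒜 F c :=
  modules_hom_ext 𝒜 fun U s => (congrArg (· • s) (constSection_mul 𝒜 U c d)).trans (mul_smul _ _ s)

theorem homothety_one (F : (Proj 𝒜).Modules) : homothety 𝒜 F 1 = 𝟙 F :=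
  modules_hom_ext 𝒜 fun U s => (congrArg (· • s) (constSection_one 𝒜 U)).trans (one_smul _ s)

/-- The scalars as endomorphisms of a sheaf of modules. -/
noncomputable def homothetyHom (F : (Proj 𝒜).Modules) : ℂ →+ (F ⟶ F) :=
  AddMonoidHom.mk' (homothety 𝒜 F) (homothety_add 𝒜 F)

theorem homothetyHom_apply (F : (Proj 𝒜).Modules) (c : ℂ) :
    homothetyHom 𝒜 F c = homothety 𝒜 F c := rfl

theorem homothety_zero (F : (Proj 𝒜).Modules) : homothety 𝒜 F 0 = 0 := map_zero (homothetyHom 𝒜 F)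

variable (U) in
/-- The unit section of the structure sheaf. -/
def oneSection : Γ(structureModule 𝒜, U) := (1 : Γ(Proj 𝒜, U))

theorem structureModule_hom_ext {F : (Proj 𝒜).Modules} {φ ψ : structureModule 𝒜 ⟶ F}
    (h : ∀ U, φ.app U (oneSection 𝒜 U) = ψ.app U (oneSection 𝒜 U)) : φ = ψ :=
  modules_hom_ext 𝒜 fun U s => by
    have e : s = (show Γ(Proj 𝒜, U) from s) • oneSection 𝒜 U :=
      (mul_one (show Γ(Proj 𝒜, U) from s)).symm
    rw [e, Scheme.Modules.Hom.app_smul, Scheme.Modules.Hom.app_smul, h]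

variable (U) in
/-- The section of `𝒪(d)` given by a form of degree `d`. -/
def formSection (a : A) (ha : a ∈ 𝒜 d) : Γ(twistingSheaf 𝒜 d, U) := twistSection 𝒜 a ha U

theorem twistVal_formSection (a : A) (ha : a ∈ 𝒜 d) (x : ProjectiveSpectrum.top 𝒜)
    (hx : (x : Proj 𝒜) ∈ U) : twistVal 𝒜 (formSection 𝒜 U a ha) x hx = Localization.mk a 1 := rfl

theorem twistMul_app_oneSection (a : A) (ha : a ∈ 𝒜 d) :
    (twistMul 𝒜 a ha).app U (oneSection 𝒜 U) = formSection 𝒜 U a ha := by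
  have h := SheafOfModules.unitHomEquiv_apply_coe (R := (Proj 𝒜).ringCatSheaf) (twistingSheaf 𝒜 d)
    (twistMul 𝒜 a ha) (op U)
  refine h.symm.trans ?_
  rw [twistMul, Equiv.apply_symm_apply]
  rfl

theorem twistMul_add (a b : A) (ha : a ∈ 𝒜 d) (hb : b ∈ 𝒜 d) :
    twistMul 𝒜 (a + b) (Submodule.add_mem _ ha hb) = twistMul 𝒜 a ha + twistMul 𝒜 b hb := by
  refine structureModule_hom_ext 𝒜 fun U => ?_
  have e : (twistMul 𝒜 a ha + twistMul 𝒜 b hb).app U (oneSection 𝒜 U) =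
      (twistMul 𝒜 a ha).app U (oneSection 𝒜 U) + (twistMul 𝒜 b hb).app U (oneSection 𝒜 U) := rfl
  rw [e, twistMul_app_oneSection, twistMul_app_oneSection, twistMul_app_oneSection]
  refine twistVal_ext 𝒜 fun x hx => ?_
  rw [twistVal_add, twistVal_formSection, twistVal_formSection, twistVal_formSection,
    Localization.add_mk_self]

theorem twistMul_smul (c : ℂ) (a : A) (ha : a ∈ 𝒜 d) :
    twistMul 𝒜 (c • a) (Submodule.smul_mem _ c ha) = twistMul 𝒜 a ha ≫ homothety 𝒜 _ c := by
  refine structureModule_hom_ext 𝒜 fun U => ?_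
  have e : (twistMul 𝒜 a ha ≫ homothety 𝒜 _ c).app U (oneSection 𝒜 U) =
      constSection 𝒜 U c • (twistMul 𝒜 a ha).app U (oneSection 𝒜 U) := rfl
  rw [e, twistMul_app_oneSection, twistMul_app_oneSection]
  refine twistVal_ext 𝒜 fun x hx => ?_
  rw [twistVal_smul, twistVal_formSection, twistVal_formSection, funVal_constSection,
    Localization.mk_mul, one_mul, ← Algebra.smul_def]

/-- A fraction of degree zero as a function on an open set where the denominator does not vanish. -/
def fractionSection {i : ℕ} (r s : A) (hr : r ∈ 𝒜 i)
    (hs : s ∈ 𝒜 i) (h : ∀ x : ProjectiveSpectrum.top 𝒜, (x : Proj 𝒜) ∈ U → s ∈ complAt 𝒜 x) :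
    Γ(Proj 𝒜, U) :=
  (⟨fun x => HomogeneousLocalization.mk ⟨i, ⟨r, hr⟩, ⟨s, hs⟩, h x.1 x.2⟩,
    fun x => ⟨U, x.2, 𝟙 _, i, ⟨r, hr⟩, ⟨s, hs⟩, fun y => h y.1 y.2, fun _ => rfl⟩⟩ :
    (ProjectiveSpectrum.Proj.structureSheaf 𝒜).1.obj (op U))

theorem funVal_fractionSection {i : ℕ} (r s : A)
    (hr : r ∈ 𝒜 i) (hs : s ∈ 𝒜 i)
    (h : ∀ x : ProjectiveSpectrum.top 𝒜, (x : Proj 𝒜) ∈ U → s ∈ complAt 𝒜 x)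
    (x : ProjectiveSpectrum.top 𝒜) (hx : (x : Proj 𝒜) ∈ U) :
    funVal 𝒜 (fractionSection 𝒜 r s hr hs h) x hx = Localization.mk r ⟨s, h x hx⟩ := rfl

theorem exists_twistVal_eq (s : Γ(twistingSheaf 𝒜 d, U)) (x : ProjectiveSpectrum.top 𝒜)
    (hx : (x : Proj 𝒜) ∈ U) : ∃ (V : (Proj 𝒜).Opens) (_ : (x : Proj 𝒜) ∈ V) (_ : V ⟶ U) (k : ℕ)
      (r q : A), r ∈ 𝒜 (d + k) ∧ q ∈ 𝒜 k ∧ ∀ (y : ProjectiveSpectrum.top 𝒜)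
        (_ : (y : Proj 𝒜) ∈ V) (hy' : (y : Proj 𝒜) ∈ U), ∃ hq : q ∈ complAt 𝒜 y,
        twistVal 𝒜 s y hy' = Localization.mk r ⟨q, hq⟩ := by
  obtain ⟨V, hxV, i, k, r, q, hr, hq, h⟩ := (show twistSections 𝒜 d U from s).2 ⟨x, hx⟩
  exact ⟨V, hxV, i, k, r, q, hr, hq, fun y hy _ => h ⟨y, hy⟩⟩

theorem mem_top_opens (x : ProjectiveSpectrum.top 𝒜) : (x : Proj 𝒜) ∈ (⊤ : (Proj 𝒜).Opens) := trivial

/-- The value of a morphism `𝒪(1) ⟶ 𝒪` on a fraction is determined by its values on forms. -/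
theorem structVal_app_of_form (ψ : twistingSheaf 𝒜 1 ⟶ structureModule 𝒜) {f : A} (hf : f ∈ 𝒜 1)
    (s : Γ(twistingSheaf 𝒜 1, U)) (x : ProjectiveSpectrum.top 𝒜) (hx : (x : Proj 𝒜) ∈ U)
    (hfx : f ∈ complAt 𝒜 x) :
    Localization.mk f 1 * structVal 𝒜 (ψ.app U s) x hx =
      twistVal 𝒜 s x hx * structVal 𝒜 (ψ.app ⊤ (formSection 𝒜 ⊤ f hf)) x
        (mem_top_opens 𝒜 x) := by
  obtain ⟨V, hxV, i, k, r, q, hr, hq, h⟩ := exists_twistVal_eq 𝒜 s x hx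
  -- Where f does not vanish, the section s = r/q equals (r/(qf)) · f, a function times the form f;
  -- linearity of ψ then gives the formula.
  let W : (Proj 𝒜).Opens := V ⊓ Proj.basicOpen 𝒜 f
  have hxW : (x : Proj 𝒜) ∈ W := ⟨hxV, hfx⟩
  let j : W ⟶ U := homOfLE inf_le_left ≫ i
  have hden : ∀ y : ProjectiveSpectrum.top 𝒜, (y : Proj 𝒜) ∈ W → q * f ∈ complAt 𝒜 y :=
    fun y hy => Submonoid.mul_mem _ (h y hy.1 (j.le hy)).1 hy.2
  have hr' : r ∈ 𝒜 (k + 1) := by rwa [add_comm] at hr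
  let ρ : Γ(Proj 𝒜, W) :=
    fractionSection 𝒜 r (q * f) hr' (SetLike.GradedMul.mul_mem hq hf) hden
  have e : (twistingSheaf 𝒜 1).presheaf.map j.op s = ρ •
      (twistingSheaf 𝒜 1).presheaf.map (homOfLE le_top : W ⟶ ⊤).op (formSection 𝒜 ⊤ f hf) := by
    refine twistVal_ext 𝒜 fun y hy => ?_
    obtain ⟨h1, h2⟩ := h y hy.1 (j.le hy)
    rw [twistVal_map, h2, twistVal_smul, funVal_fractionSection, twistVal_map,
      twistVal_formSection, Localization.mk_mul, Localization.mk_eq_mk_iff,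
      Localization.r_iff_exists]
    exact ⟨1, by simp [mul_comm, mul_left_comm]⟩
  have e2 := congrArg (fun t => structVal 𝒜 (ψ.app W t) x hxW) e
  simp only [Scheme.Modules.Hom.app_smul, app_map, structVal_smul, structVal_map] at e2
  obtain ⟨h1, h2⟩ := h x hxV hx
  rw [e2, h2, ← mul_assoc]
  congr 1
  rw [funVal_fractionSection, Localization.mk_mul, Localization.mk_eq_mk_iff,
    Localization.r_iff_exists]
  exact ⟨1, by simp [mul_comm, mul_left_comm]⟩

end Homothety

end SteinerKronecker


/-! ### Vanishing of Hom(𝒪(1), 𝒪) on projective space -/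

namespace SteinerKronecker

open CategoryTheory AlgebraicGeometry TopologicalSpace Opposite

section

variable {A : Type} [CommRing A] [Algebra ℂ A] (𝒜 : ℕ → Submodule ℂ A) [GradedAlgebra 𝒜]

/-- Functions on `D₊(f)` are fractions with denominator a power of `f`. -/
theorem exists_funVal_eq_on_basicOpen {f : A} (hf : f ∈ 𝒜 1) (r : Γ(Proj 𝒜, Proj.basicOpen 𝒜 f)) :
    ∃ (N : ℕ) (p : A), p ∈ 𝒜 N ∧ ∀ (x : ProjectiveSpectrum.top 𝒜)
      (hx : (x : Proj 𝒜) ∈ Proj.basicOpen 𝒜 f),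
      funVal 𝒜 r x hx = Localization.mk p ⟨f ^ N, Submonoid.pow_mem (complAt 𝒜 x) hx N⟩ := by
  obtain ⟨z, rfl⟩ : ∃ z, (Proj.basicOpenIsoAway 𝒜 f hf one_pos).hom z = r :=
    ⟨(Proj.basicOpenIsoAway 𝒜 f hf one_pos).inv r, by simp⟩
  obtain ⟨N, p, hp, rfl⟩ := HomogeneousLocalization.Away.mk_surjective 𝒜 hf z
  refine ⟨N, p, by simpa using hp, fun x hx => ?_⟩
  rfl

end

section Coordinates

variable {n : ℕ}

/-- The generic point of projective space. -/
noncomputable def genericPt (n : ℕ) : ProjectiveSpectrum.top (coordGrading n) :=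
  ({ asHomogeneousIdeal := ⊥
     isPrime := by
       rw [HomogeneousIdeal.toIdeal_bot]
       exact Ideal.isPrime_bot
     not_irrelevant_le := fun h => by
       have h1 : (MvPolynomial.X 0 : MvPolynomial (Fin (n + 1)) ℂ) ∈
           HomogeneousIdeal.irrelevant (coordGrading n) := by
         rw [HomogeneousIdeal.mem_irrelevant_iff, GradedRing.proj_apply]
         exact DirectSum.decompose_of_mem_ne (coordGrading n)
           ((MvPolynomial.mem_homogeneousSubmodule _ _).2 (MvPolynomial.isHomogeneous_X ℂ 0))
           one_ne_zero
       have h2 := h h1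
       exact MvPolynomial.X_ne_zero 0 h2 } : ProjectiveSpectrum (coordGrading n))

theorem mem_complAt_genericPt {f : MvPolynomial (Fin (n + 1)) ℂ} (hf : f ≠ 0) :
    f ∈ complAt (coordGrading n) (genericPt n) := fun h => hf h

/-- The polynomial ring is a domain, so values at the generic point turn identities of sections into
identities of polynomials. -/
theorem localization_genericPt_injective {a b : MvPolynomial (Fin (n + 1)) ℂ}
    (h : (Localization.mk a 1 : LocAt (coordGrading n) (genericPt n)) = Localization.mk b 1) :
    a = b := by
  rw [Localization.mk_eq_mk_iff, Localization.r_iff_exists] at h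
  obtain ⟨c, hc⟩ := h
  have hc0 : (c : MvPolynomial (Fin (n + 1)) ℂ) ≠ 0 := fun h0 => c.2 (by
    change (c : MvPolynomial (Fin (n + 1)) ℂ) = 0
    exact h0)
  simpa [hc0] using hc

theorem X_mem (k : Fin (n + 1)) : (MvPolynomial.X k : MvPolynomial (Fin (n + 1)) ℂ) ∈ coordGrading n 1 :=
  MvPolynomial.isHomogeneous_X ℂ k

theorem exists_X_mem_complAt (x : ProjectiveSpectrum.top (coordGrading n)) :
    ∃ k : Fin (n + 1), (MvPolynomial.X k : MvPolynomial (Fin (n + 1)) ℂ) ∈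
      complAt (coordGrading n) x := by
  have h := Proj.iSup_basicOpen_eq_top' (coordGrading n)
    (fun k : Fin (n + 1) => (MvPolynomial.X k : MvPolynomial (Fin (n + 1)) ℂ))
    (fun k => ⟨1, X_mem k⟩) (by
      rw [eq_top_iff]
      intro f _
      have : f ∈ Algebra.adjoin ℂ (Set.range (MvPolynomial.X : Fin (n + 1) → _)) := by
        rw [MvPolynomial.adjoin_range_X]
        exact Algebra.mem_top
      induction this using Algebra.adjoin_induction with
      | mem x hx => exact Algebra.subset_adjoin hx
      | algebraMap c =>
        exact Subalgebra.algebraMap_mem _ (algebraMap ℂ (coordGrading n 0) c)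
      | add x y _ _ hx hy => exact add_mem (hx trivial) (hy trivial)
      | mul x y _ _ hx hy => exact mul_mem (hx trivial) (hy trivial))
  have hx : (x : Proj (coordGrading n)) ∈
      (⨆ k : Fin (n + 1), Proj.basicOpen (coordGrading n) (MvPolynomial.X k)) := by
    rw [h]
    trivial
  obtain ⟨k, hk⟩ := Opens.mem_iSup.1 hx
  exact ⟨k, hk⟩

theorem eq_zero_of_X_pow_dvd {p : MvPolynomial (Fin (n + 1)) ℂ} {N : ℕ} (hp : p.IsHomogeneous N)
    {k : Fin (n + 1)} (h : MvPolynomial.X k ^ (N + 1) ∣ p) : p = 0 := by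
  by_contra h0
  obtain ⟨q, rfl⟩ := h
  have h1 := hp.totalDegree h0
  rw [MvPolynomial.totalDegree_mul_of_isDomain (left_ne_zero_of_mul h0) (right_ne_zero_of_mul h0),
    MvPolynomial.totalDegree_X_pow] at h1
  omega

/-- There are no morphisms `𝒪(1) ⟶ 𝒪` on a projective space of positive dimension. -/
theorem twistingSheaf_one_hom_eq_zero (hn : 1 ≤ n)
    (ψ : twistingSheaf (coordGrading n) 1 ⟶ structureModule (coordGrading n)) : ψ = 0 := by
  let 𝒜 := coordGrading n
  let t : Fin (n + 1) → Γ(structureModule 𝒜, ⊤) := fun k =>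
    ψ.app ⊤ (formSection 𝒜 ⊤ (MvPolynomial.X k) (X_mem k))
  have hloc : ∀ k, ∃ (N : ℕ) (p : MvPolynomial (Fin (n + 1)) ℂ), p ∈ 𝒜 N ∧
      ∀ (x : ProjectiveSpectrum.top 𝒜) (hx : MvPolynomial.X k ∈ complAt 𝒜 x),
      structVal 𝒜 (t k) x (mem_top_opens 𝒜 x) =
        Localization.mk p ⟨MvPolynomial.X k ^ N, Submonoid.pow_mem (complAt 𝒜 x) hx N⟩ := fun k =>
    exists_funVal_eq_on_basicOpen 𝒜 (X_mem k) (show Γ(Proj 𝒜, Proj.basicOpen 𝒜 (MvPolynomial.X k)) from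
      (structureModule 𝒜).presheaf.map (homOfLE le_top :
        Proj.basicOpen 𝒜 (MvPolynomial.X k) ⟶ ⊤).op (t k))
  choose N p hp hval using hloc
  -- Linearity gives xⱼ ψ(xₖ) = xₖ ψ(xⱼ) at the generic point; here ψ(xₖ) is pₖ / xₖ^Nₖ, and
  -- denominators are cleared.
  have hrel : ∀ j k, p k * MvPolynomial.X j ^ (N j + 1) = p j * MvPolynomial.X k ^ (N k + 1) := by
    intro j k
    have hη := fun i : Fin (n + 1) => mem_complAt_genericPt (n := n) (MvPolynomial.X_ne_zero (R := ℂ) i)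
    have h := structVal_app_of_form 𝒜 ψ (X_mem j) (formSection 𝒜 ⊤ (MvPolynomial.X k) (X_mem k))
      (genericPt n) (mem_top_opens 𝒜 _) (hη j)
    change _ * structVal 𝒜 (t k) _ _ = _ * structVal 𝒜 (t j) _ _ at h
    rw [hval k _ (hη k), hval j _ (hη j), twistVal_formSection, Localization.mk_mul,
      Localization.mk_mul, Localization.mk_eq_mk_iff, Localization.r_iff_exists] at h
    obtain ⟨c, hc⟩ := h
    have hc0 : (c : MvPolynomial (Fin (n + 1)) ℂ) ≠ 0 := fun h0 => c.2 h0
    have := mul_left_cancel₀ hc0 hc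
    simp only [one_mul] at this
    rw [pow_succ, pow_succ]
    linear_combination this
  -- A second variable xⱼ exists because n ≥ 1. As xₖ is prime and does not divide xⱼ, its power Nₖ
  -- + 1 divides pₖ, a form of degree only Nₖ.
  have hp0 : ∀ k, p k = 0 := by
    intro k
    obtain ⟨j, hj⟩ : ∃ j : Fin (n + 1), j ≠ k := by
      have : Nontrivial (Fin (n + 1)) := Fin.nontrivial_iff_two_le.2 (by omega)
      exact exists_ne k
    refine eq_zero_of_X_pow_dvd (N := N k) (k := k) (hp k) ?_
    refine (MvPolynomial.X_prime (i := k)).pow_dvd_of_dvd_mul_right _ (b := MvPolynomial.X j ^ (N j + 1)) ?_ ?_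
    · intro h
      exact hj (MvPolynomial.X_dvd_X.1 ((MvPolynomial.X_prime (i := k)).dvd_of_dvd_pow h)).symm
    · exact ⟨p j, by rw [hrel j k, mul_comm]⟩
  refine modules_hom_ext 𝒜 fun U s => structVal_ext 𝒜 fun x hx => ?_
  -- At every point some variable is a unit, so vanishing of ψ on the variables gives vanishing
  -- everywhere.
  obtain ⟨k, hk⟩ := exists_X_mem_complAt x
  have h := structVal_app_of_form 𝒜 ψ (X_mem k) s x hx hk
  change _ = _ * structVal 𝒜 (t k) x (mem_top_opens 𝒜 x) at h
  rw [hval k x hk, hp0, Localization.mk_zero, mul_zero] at h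
  have hu : IsUnit (Localization.mk (MvPolynomial.X k) 1 : LocAt 𝒜 x) :=
    IsLocalization.map_units (LocAt 𝒜 x) (⟨MvPolynomial.X k, hk⟩ : complAt 𝒜 x)
  exact ((hu.mul_right_eq_zero).1 h).trans (congrFun (map_zero (evalStruct 𝒜 U)) ⟨x, hx⟩).symm

end Coordinates

end SteinerKronecker


/-! ### Scalar matrices acting on direct sums -/

namespace SteinerKronecker

open CategoryTheory AlgebraicGeometry TopologicalSpace Opposite Limits

section ConstantMatrices

theorem biproduct_matrix_comp_matrix {C : Type*} [Category C] [Preadditive C]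
    [HasFiniteBiproducts C] {I J K : Type} [Fintype I] [Fintype J] [Fintype K] {f : I → C}
    {g : J → C} {h : K → C} (a : ∀ i j, f i ⟶ g j) (b : ∀ j k, g j ⟶ h k) :
    biproduct.matrix a ≫ biproduct.matrix b = biproduct.matrix fun i k => ∑ j, a i j ≫ b j k := by
  refine biproduct.hom_ext' _ _ fun i => ?_
  rw [biproduct.ι_matrix_assoc, biproduct.lift_matrix, biproduct.ι_matrix]

theorem biproduct_matrix_inj {C : Type*} [Category C] [Preadditive C]
    [HasFiniteBiproducts C] {I J : Type} [Finite I] [Finite J] {f : I → C}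
    {g : J → C} {a b : ∀ i j, f i ⟶ g j} (h : biproduct.matrix a = biproduct.matrix b) (i : I)
    (j : J) : a i j = b i j := by
  rw [← biproduct.matrix_components a i j, h, biproduct.matrix_components]

variable {A : Type} [CommRing A] [Algebra ℂ A] (𝒜 : ℕ → Submodule ℂ A) [GradedAlgebra 𝒜]
  {I J : Type} [Fintype I] [Fintype J]

/-- The endomorphism of `F ⊗ ℂᴵ` given by a matrix of scalars. -/
noncomputable def constMat (F : (Proj 𝒜).Modules) (M : Matrix I I ℂ) :
    biproduct (fun _ : I => F) ⟶ biproduct (fun _ : I => F) :=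
  biproduct.matrix fun i j => homothety 𝒜 F (M i j)

/-- The entry (i, j) maps summand i to summand j, so the matrix product matches composition in
diagrammatic order, without transpose. -/
theorem constMat_mul (F : (Proj 𝒜).Modules) (M N : Matrix I I ℂ) :
    constMat 𝒜 F (M * N) = constMat 𝒜 F M ≫ constMat 𝒜 F N := by
  rw [constMat, constMat, constMat, biproduct_matrix_comp_matrix]
  congr 1
  funext i k
  rw [Matrix.mul_apply, ← homothetyHom_apply, map_sum]
  exact Finset.sum_congr rfl fun j _ => by rw [homothetyHom_apply, mul_comm, homothety_mul]

theorem constMat_smul_one [DecidableEq I] (F : (Proj 𝒜).Modules) (c : ℂ) :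
    constMat 𝒜 F (c • (1 : Matrix I I ℂ)) = homothety 𝒜 (biproduct fun _ : I => F) c := by
  refine biproduct.hom_ext _ _ fun j => biproduct.hom_ext' _ _ fun i => ?_
  rw [homothety_comp, biproduct.ι_π_assoc, constMat, biproduct.ι_matrix_assoc, biproduct.lift_π,
    Matrix.smul_apply, Matrix.one_apply]
  by_cases h : i = j
  · subst h
    simp
  · simp [h, homothety_zero]

theorem constMat_one [DecidableEq I] (F : (Proj 𝒜).Modules) : constMat 𝒜 F (1 : Matrix I I ℂ) = 𝟙 _ := by
  rw [← one_smul ℂ (1 : Matrix I I ℂ), constMat_smul_one, homothety_one]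

/-- The automorphism of `F ⊗ ℂᴵ` given by a pair of inverse matrices. -/
noncomputable def constMatIso [DecidableEq I] (F : (Proj 𝒜).Modules) {M N : Matrix I I ℂ} (h : M * N = 1) (h' : N * M = 1) :
    biproduct (fun _ : I => F) ≅ biproduct (fun _ : I => F) where
  hom := constMat 𝒜 F M
  inv := constMat 𝒜 F N
  hom_inv_id := by rw [← constMat_mul, h, constMat_one]
  inv_hom_id := by rw [← constMat_mul, h', constMat_one]

theorem constMat_injective {F : (Proj 𝒜).Modules} (hF : Function.Injective (homothety 𝒜 F)) :
    Function.Injective (constMat 𝒜 F : Matrix I I ℂ → _) := fun M N h => by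
  ext i j
  exact hF (biproduct_matrix_inj h i j)

theorem twistMul_congr {d : ℕ} {a b : A} (h : a = b) (ha : a ∈ 𝒜 d) :
    twistMul 𝒜 a ha = twistMul 𝒜 b (h ▸ ha) := by
  subst h
  rfl

/-- Multiplication by forms of degree `d` is additive in the form. -/
noncomputable def twistMulHom (d : ℕ) : 𝒜 d →+ (structureModule 𝒜 ⟶ twistingSheaf 𝒜 d) :=
  AddMonoidHom.mk' (fun a => twistMul 𝒜 a.1 a.2) fun a b => twistMul_add 𝒜 a.1 b.1 a.2 b.2

theorem twistMul_sum_smul {d : ℕ} (c : I → ℂ) (a : I → A) (ha : ∀ i, a i ∈ 𝒜 d) :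
    twistMul 𝒜 (∑ i, c i • a i) (Submodule.sum_mem _ fun i _ => Submodule.smul_mem _ _ (ha i)) =
      ∑ i, twistMul 𝒜 (a i) (ha i) ≫ homothety 𝒜 _ (c i) := by
  have h := map_sum (twistMulHom 𝒜 d) (fun i => c i • (⟨a i, ha i⟩ : 𝒜 d)) Finset.univ
  refine Eq.trans ?_ (h.trans (Finset.sum_congr rfl fun i _ => twistMul_smul 𝒜 (c i) (a i) (ha i)))
  refine twistMul_congr 𝒜 ?_ _
  rw [AddSubmonoidClass.coe_finsetSum]
  rfl

theorem constMat_comp_twistMul {d : ℕ} (P : Matrix I I ℂ) (a : I → J → A)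
    (ha : ∀ i j, a i j ∈ 𝒜 d) :
    constMat 𝒜 (structureModule 𝒜) P ≫ biproduct.matrix (fun i j => twistMul 𝒜 (a i j) (ha i j)) =
      biproduct.matrix fun i j => twistMul 𝒜 (∑ i', P i i' • a i' j)
        (Submodule.sum_mem _ fun i' _ => Submodule.smul_mem _ _ (ha i' j)) := by
  rw [constMat, biproduct_matrix_comp_matrix]
  congr 1
  funext i j
  rw [twistMul_sum_smul 𝒜 (P i) (fun i' => a i' j) fun i' => ha i' j]
  exact Finset.sum_congr rfl fun i' _ => homothety_comp 𝒜 (twistMul 𝒜 (a i' j) (ha i' j)) (P i i')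

theorem twistMul_comp_constMat {d : ℕ} (Q : Matrix J J ℂ) (a : I → J → A)
    (ha : ∀ i j, a i j ∈ 𝒜 d) :
    biproduct.matrix (fun i j => twistMul 𝒜 (a i j) (ha i j)) ≫ constMat 𝒜 (twistingSheaf 𝒜 d) Q =
      biproduct.matrix fun i j => twistMul 𝒜 (∑ j', Q j' j • a i j')
        (Submodule.sum_mem _ fun j' _ => Submodule.smul_mem _ _ (ha i j')) := by
  rw [constMat, biproduct_matrix_comp_matrix]
  congr 1
  funext i j
  rw [twistMul_sum_smul 𝒜 (fun j' => Q j' j) (fun j' => a i j') fun j' => ha i j']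

theorem biproduct_hom_eq_zero {F F' : (Proj 𝒜).Modules} (h : ∀ ψ : F ⟶ F', ψ = 0)
    (ψ : biproduct (fun _ : I => F) ⟶ biproduct (fun _ : J => F')) : ψ = 0 := by
  refine biproduct.hom_ext _ _ fun j => biproduct.hom_ext' _ _ fun i => ?_
  rw [zero_comp, comp_zero]
  exact h _

/-- An endomorphism of `coker f` that is a homothety comes from an endomorphism of the target
of `f` that is a homothety, if there are no morphisms from the target to the source. -/
theorem eq_homothety_of_cokernel {X Y : (Proj 𝒜).Modules} (f : X ⟶ Y) [Mono f]
    (h0 : ∀ ψ : Y ⟶ X, ψ = 0) (β : Y ⟶ Y) (c : ℂ)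
    (h : β ≫ cokernel.π f = cokernel.π f ≫ homothety 𝒜 (cokernel f) c) : β = homothety 𝒜 Y c := by
  have h1 : (β - homothety 𝒜 Y c) ≫ cokernel.π f = 0 := by
    rw [Preadditive.sub_comp, h, homothety_comp, sub_self]
  -- The difference is killed by the projection to the cokernel, so it factors through the
  -- monomorphism f, and the factor Y ⟶ X is zero.
  have h2 := Abelian.monoLift_comp f _ h1
  rw [h0 (Abelian.monoLift f _ h1), zero_comp] at h2
  exact sub_eq_zero.1 h2.symm

/-- The compatible pair (p, q) induces an automorphism of the cokernel, a homothety c by simplicity.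
This lifts to q, and cancelling the monomorphism f passes it to p. -/
theorem exists_homothety_of_isSimpleSheaf {X Y : (Proj 𝒜).Modules} (f : X ⟶ Y) [Mono f]
    (h0 : ∀ ψ : Y ⟶ X, ψ = 0) (hs : IsSimpleSheaf 𝒜 (cokernel f)) (p : X ≅ X) (q : Y ≅ Y)
    (w : f ≫ q.hom = p.hom ≫ f) :
    ∃ c : ℂ, p.hom = homothety 𝒜 X c ∧ q.hom = homothety 𝒜 Y c := by
  obtain ⟨c, hc, -⟩ := hs (cokernel.mapIso f f p q w)
  have hq := eq_homothety_of_cokernel 𝒜 f h0 q.hom c (by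
    rw [← hc]
    exact (cokernel.π_desc _ _ _).symm)
  refine ⟨c, ?_, hq⟩
  rw [← cancel_mono f, ← w, hq, homothety_comp]

end ConstantMatrices

/-! ### Stabilizers of points with simple cokernel -/

section Stabilizer

open scoped Kronecker

variable {n m : ℕ}

/-- The ratio is recovered from the image of the section x₀, read at the generic point. -/
theorem twist_homothety_injective :
    Function.Injective (homothety (coordGrading n) (twistingSheaf (coordGrading n) 1)) := by
  intro c d h
  have h1 := congrArg (fun φ => twistVal (coordGrading n) (φ.app ⊤
    (formSection (coordGrading n) ⊤ (MvPolynomial.X 0) (X_mem 0))) (genericPt n)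
      (mem_top_opens _ _)) h
  simp only [homothety_app_apply, twistVal_smul, twistVal_formSection, funVal_constSection] at h1
  rw [Localization.mk_mul, Localization.mk_mul, one_mul] at h1
  have h2 := localization_genericPt_injective h1
  exact MvPolynomial.C_injective _ _ (mul_right_cancel₀ (MvPolynomial.X_ne_zero _) h2)

theorem structure_homothety_injective :
    Function.Injective (homothety (coordGrading n) (structureModule (coordGrading n))) := by
  intro c d h
  refine twist_homothety_injective (n := n) ?_
  have h1 := congrArg (· ≫ twistMul (coordGrading n) (MvPolynomial.X 0) (X_mem 0)) h
  simp only [homothety_comp, ← twistMul_smul] at h1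
  have h2 := congrArg (fun φ => twistVal (coordGrading n) (φ.app ⊤
    (oneSection (coordGrading n) ⊤)) (genericPt n) (mem_top_opens _ _)) h1
  simp only [twistMul_app_oneSection, twistVal_formSection] at h2
  have h3 := localization_genericPt_injective h2
  rw [MvPolynomial.smul_eq_C_mul, MvPolynomial.smul_eq_C_mul] at h3
  rw [MvPolynomial.C_injective _ _ (mul_right_cancel₀ (MvPolynomial.X_ne_zero _) h3)]

theorem linearForm_kronecker_mul (P : Matrix (Fin 2) (Fin 2) ℂ) (A : HomSpace n m) (i : Fin 2)
    (j : Fin (m + 2)) : linearForm ((P ⊗ₖ (1 : Matrix (Fin (n + 1)) (Fin (n + 1)) ℂ)) * A) i j =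
      ∑ i', P i i' • linearForm A i' j := by
  simp only [linearForm, kronecker_one_mul_apply, Finset.smul_sum]
  rw [Finset.sum_comm]
  refine Finset.sum_congr rfl fun k _ => ?_
  rw [map_sum, Finset.sum_mul]
  refine Finset.sum_congr rfl fun i' _ => ?_
  rw [MvPolynomial.smul_eq_C_mul, map_mul, mul_assoc]

theorem linearForm_mul (A : HomSpace n m) (Q : Matrix (Fin (m + 2)) (Fin (m + 2)) ℂ) (i : Fin 2)
    (j : Fin (m + 2)) : linearForm (A * Q) i j = ∑ j', Q j' j • linearForm A i j' := by
  simp only [linearForm, Matrix.mul_apply, Finset.smul_sum]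
  rw [Finset.sum_comm]
  refine Finset.sum_congr rfl fun k _ => ?_
  rw [map_sum, Finset.sum_mul]
  refine Finset.sum_congr rfl fun i' _ => ?_
  rw [MvPolynomial.smul_eq_C_mul, map_mul, mul_comm (MvPolynomial.C (A (i, k) i')), mul_assoc]

theorem steinerMap_congr {A : HomSpace n m} {a : Fin 2 → Fin (m + 2) → MvPolynomial (Fin (n + 1)) ℂ}
    (ha : ∀ i j, a i j ∈ coordGrading n 1) (h : ∀ i j, linearForm A i j = a i j) :
    steinerMap A = biproduct.matrix fun i j => twistMul (coordGrading n) (a i j) (ha i j) := by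
  obtain rfl : linearForm A = a := funext fun i => funext fun j => h i j
  rfl

theorem constMat_comp_steinerMap (P : Matrix (Fin 2) (Fin 2) ℂ) (A : HomSpace n m) :
    constMat (coordGrading n) (structureModule (coordGrading n)) P ≫ steinerMap A =
      steinerMap ((P ⊗ₖ (1 : Matrix (Fin (n + 1)) (Fin (n + 1)) ℂ)) * A) :=
  (constMat_comp_twistMul (coordGrading n) P (linearForm A) (linearForm_mem A)).trans
    (steinerMap_congr _ (linearForm_kronecker_mul P A)).symm

theorem steinerMap_comp_constMat (A : HomSpace n m) (Q : Matrix (Fin (m + 2)) (Fin (m + 2)) ℂ) :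
    steinerMap A ≫ constMat (coordGrading n) (twistingSheaf (coordGrading n) 1) Q =
      steinerMap (A * Q) :=
  (twistMul_comp_constMat (coordGrading n) Q (linearForm A) (linearForm_mem A)).trans
    (steinerMap_congr _ (linearForm_mul A Q)).symm

/-- If `F_A` is simple, a pair of matrices fixing `A` is a pair of equal scalars. -/
theorem eq_scalar_of_isSimpleSheaf (hn : 1 ≤ n) {A : HomSpace n m} [Mono (steinerMap A)]
    (hs : IsSimpleSheaf (coordGrading n) (steinerSheaf A)) {P P' : Matrix (Fin 2) (Fin 2) ℂ}
    {Q Q' : Matrix (Fin (m + 2)) (Fin (m + 2)) ℂ} (hP : P * P' = 1) (hP' : P' * P = 1)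
    (hQ : Q * Q' = 1) (hQ' : Q' * Q = 1)
    (h : (P ⊗ₖ (1 : Matrix (Fin (n + 1)) (Fin (n + 1)) ℂ)) * A = A * Q) :
    ∃ c : ℂ, P = c • 1 ∧ Q = c • 1 := by
  have w : steinerMap A ≫ constMat (coordGrading n) (twistingSheaf (coordGrading n) 1) Q =
      constMat (coordGrading n) (structureModule (coordGrading n)) P ≫ steinerMap A := by
    rw [steinerMap_comp_constMat, constMat_comp_steinerMap, h]
  obtain ⟨c, h1, h2⟩ := exists_homothety_of_isSimpleSheaf (coordGrading n) (steinerMap A)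
    (biproduct_hom_eq_zero _ (twistingSheaf_one_hom_eq_zero hn)) hs
    (constMatIso _ (structureModule _) hP hP') (constMatIso _ (twistingSheaf _ 1) hQ hQ') w
  exact ⟨c, constMat_injective _ structure_homothety_injective
      (h1.trans (constMat_smul_one _ _ c).symm),
    constMat_injective _ twist_homothety_injective (h2.trans (constMat_smul_one _ _ c).symm)⟩

theorem mem_stab_iff {A : HomSpace n m} (hA : A ≠ 0) (g : GroupG m) :
    g ∈ stab A hA ↔ ∃ a : ℂˣ, a • A = g • A := by
  rw [stab, MulAction.mem_stabilizer_iff, Projectivization.smul_mk, Projectivization.mk_eq_mk_iff]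

theorem coe_stab_eq (hn : 1 ≤ n) {A : HomSpace n m} (hA : A ≠ 0) [Mono (steinerMap A)]
    (hs : IsSimpleSheaf (coordGrading n) (steinerSheaf A)) :
    (stab A hA : Set (GroupG m)) = {g | ∃ lam mu : ℂ, lam ^ 2 = 1 ∧ mu ^ (m + 2) = 1 ∧
      (g.1 : Matrix (Fin 2) (Fin 2) ℂ) = lam • 1 ∧
      (g.2 : Matrix (Fin (m + 2)) (Fin (m + 2)) ℂ) = mu • 1} := by
  ext g
  rw [SetLike.mem_coe, mem_stab_iff, Set.mem_ofPred_eq]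
  have hdet : ∀ {k : ℕ} (g : Matrix.SpecialLinearGroup (Fin k) ℂ) {c : ℂ},
      (g : Matrix (Fin k) (Fin k) ℂ) = c • 1 → c ^ k = 1 := fun g c h => by
    have := g.det_coe
    rwa [h, Matrix.det_smul, Matrix.det_one, mul_one, Fintype.card_fin] at this
  have hinv : ∀ {k : ℕ} (g : Matrix.SpecialLinearGroup (Fin k) ℂ),
      (g : Matrix (Fin k) (Fin k) ℂ) * (g⁻¹).1 = 1 ∧ (g⁻¹).1 * (g : Matrix (Fin k) (Fin k) ℂ) = 1 :=
    fun g => ⟨by rw [← Matrix.SpecialLinearGroup.coe_mul, mul_inv_cancel]; rfl,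
      by rw [← Matrix.SpecialLinearGroup.coe_mul, inv_mul_cancel]; rfl⟩
  obtain ⟨hP, hP'⟩ := hinv g.1
  obtain ⟨hQ, hQ'⟩ := hinv g.2
  constructor
  · rintro ⟨a, ha⟩
    -- The scalar by which g moves A along its line is absorbed into the second factor, which leaves
    -- a pair compatible with f_A.
    have h : (g.1.1 ⊗ₖ (1 : Matrix (Fin (n + 1)) (Fin (n + 1)) ℂ)) * A = A * ((a : ℂ) • g.2.1) := by
      rw [Matrix.mul_smul, ← Matrix.smul_mul]
      change _ = (a • A) * g.2.1
      rw [ha]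
      change _ = (g.1.1 ⊗ₖ (1 : Matrix (Fin (n + 1)) (Fin (n + 1)) ℂ)) * A * (g.2⁻¹).1 * g.2.1
      rw [Matrix.mul_assoc, hQ', Matrix.mul_one]
    obtain ⟨c, h1, h2⟩ := eq_scalar_of_isSimpleSheaf hn hs hP hP'
      (Q := (a : ℂ) • g.2.1) (Q' := ((a⁻¹ : ℂˣ) : ℂ) • (g.2⁻¹).1)
      (by rw [Matrix.smul_mul, Matrix.mul_smul, smul_smul, a.mul_inv, one_smul, hQ])
      (by rw [Matrix.smul_mul, Matrix.mul_smul, smul_smul, a.inv_mul, one_smul, hQ']) h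
    -- Dividing by a shows that the second component itself is scalar; determinant one then makes
    -- both scalars roots of unity.
    have h3 : g.2.1 = (((a⁻¹ : ℂˣ) : ℂ) * c) • 1 := by
      rw [mul_smul, ← h2, smul_smul, a.inv_mul, one_smul]
    exact ⟨c, _, hdet g.1 h1, hdet g.2 h3, h1, h3⟩
  · rintro ⟨c, d, hc, hd, h1, h2⟩
    have hc0 : c ≠ 0 := fun h => by simp [h] at hc
    have hd0 : d ≠ 0 := fun h => by simp [h] at hd
    have h3 : (g.2⁻¹).1 = d⁻¹ • 1 := by
      rw [h2, Matrix.smul_mul, Matrix.one_mul] at hQ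
      rw [← hQ, smul_smul, inv_mul_cancel₀ hd0, one_smul]
    -- Scalars c and d move A to c d⁻¹ A, on the same line.
    refine ⟨Units.mk0 (c * d⁻¹) (mul_ne_zero hc0 (inv_ne_zero hd0)), ?_⟩
    change (c * d⁻¹) • A = (g.1.1 ⊗ₖ (1 : Matrix (Fin (n + 1)) (Fin (n + 1)) ℂ)) * A * (g.2⁻¹).1
    rw [h1, h3, Matrix.smul_kronecker, Matrix.one_kronecker_one, Matrix.smul_mul, Matrix.one_mul,
      Matrix.mul_smul, Matrix.mul_one, smul_smul, mul_comm]

theorem finite_scalar_pairs (m : ℕ) : {g : GroupG m | ∃ lam mu : ℂ, lam ^ 2 = 1 ∧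
      mu ^ (m + 2) = 1 ∧ (g.1 : Matrix (Fin 2) (Fin 2) ℂ) = lam • 1 ∧
      (g.2 : Matrix (Fin (m + 2)) (Fin (m + 2)) ℂ) = mu • 1}.Finite := by
  have hroots : ∀ k : ℕ, 0 < k → {z : ℂ | z ^ k = 1}.Finite := fun k hk => by
    refine (Polynomial.nthRoots k (1 : ℂ)).toFinset.finite_toSet.subset fun z hz => ?_
    simpa [Polynomial.mem_nthRoots hk] using hz
  refine Set.Finite.of_injOn (f := fun g : GroupG m => (g.1.1 0 0, g.2.1 0 0))
    (t := {z : ℂ | z ^ 2 = 1} ×ˢ {z : ℂ | z ^ (m + 2) = 1}) ?_ ?_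
    ((hroots 2 two_pos).prod (hroots (m + 2) (by omega)))
  · rintro g ⟨c, d, hc, hd, h1, h2⟩
    refine Set.mk_mem_prod ?_ ?_
    · change (g.1.1 0 0) ^ 2 = 1
      rw [h1, Matrix.smul_apply, Matrix.one_apply_eq, smul_eq_mul, mul_one, hc]
    · change (g.2.1 0 0) ^ (m + 2) = 1
      rw [h2, Matrix.smul_apply, Matrix.one_apply_eq, smul_eq_mul, mul_one, hd]
  · rintro g ⟨c, d, -, -, h1, h2⟩ g' ⟨c', d', -, -, h1', h2'⟩ h
    simp only [h1, h2, h1', h2', Matrix.smul_apply, Matrix.one_apply_eq, smul_eq_mul, mul_one,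
      Prod.mk.injEq] at h
    refine Prod.ext (Subtype.ext ?_) (Subtype.ext ?_)
    · rw [h1, h1', h.1]
    · rw [h2, h2', h.2]

end Stabilizer

end SteinerKronecker

theorem theorem3p3 (n m : ℕ) (hn : 1 ≤ n) :
    (∀ (A : SteinerKronecker.HomSpace n m) (hA : A ≠ 0),
      CategoryTheory.Mono (SteinerKronecker.steinerMap A) →
      SteinerKronecker.IsSimpleSheaf (SteinerKronecker.coordGrading n)
        (SteinerKronecker.steinerSheaf A) →
      (SteinerKronecker.stab A hA : Set (SteinerKronecker.GroupG m)) =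
          {g | ∃ lam mu : ℂ, lam ^ 2 = 1 ∧ mu ^ (m + 2) = 1 ∧
            (g.1 : Matrix (Fin 2) (Fin 2) ℂ) = lam • 1 ∧
            (g.2 : Matrix (Fin (m + 2)) (Fin (m + 2)) ℂ) = mu • 1} ∧
        Finite (SteinerKronecker.stab A hA) ∧
        SteinerKronecker.algDim (SteinerKronecker.stab A hA : Set (SteinerKronecker.GroupG m)) = 0) ∧
    (m < 2 * n → ¬ (n = 1 ∧ m = 0) →
      topologicalKrullDim (SteinerKronecker.kroneckerModuli n m) +
          SteinerKronecker.algDim (Set.univ : Set (SteinerKronecker.GroupG m)) =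
        topologicalKrullDim (SteinerKronecker.projHom n m)) :=
  ⟨fun A hA hmono hs => by
    have h := SteinerKronecker.coe_stab_eq hn hA hs
    have hfin : (SteinerKronecker.stab A hA : Set (SteinerKronecker.GroupG m)).Finite :=
      h ▸ SteinerKronecker.finite_scalar_pairs m
    exact ⟨h, hfin.to_subtype, SteinerKronecker.algDim_of_finite hfin ⟨1, one_mem _⟩⟩,
    SteinerKronecker.dim_kroneckerModuli_add_algDim⟩
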